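/- Let $n\ge 1$ and $q\in(0,1)$. Let $a=(a_{ij})_{1\le i,j\le n}$ be the Cartan matrix of $\mathfrak{sp}_{2n}$ with $a_{ii}=2$, $a_{n-1,n}=-2$, $a_{i,i+1}=-1$ for $i<n-1$, $a_{i+1,i}=-1$ for $i<n$, and all other entries $0$; let $d_i=1$ for $i<n$ and $d_n=2$. Let $U_q\mathfrak{sp}_{2n}$ be the Hopf algebra over $\mathbb C$ with generators $K_i^{\pm1},E_i,F_i$ ($1\le i\le n$) and relations $$K_iK_j=K_jK_i,\quad K_iK_i^{-1}=K_i^{-1}K_i=1,\quad K_iE_j=q^{d_ia_{ij}}E_jK_i,\quad K_iF_j=q^{-d_ia_{ij}}F_jK_i,$$ $$E_iF_j-F_jE_i=\delta_{ij}\frac{K_i-K_i^{-1}}{q^{d_i}-q^{-d_i}},$$ together with the $q$-Serre relations: for $i\ne j$ and $r=1-a_{ij}$, $$\sum_{t=0}^{r}(-1)^t\binom{r}{t}_{q^{d_i}}E_i^{r-t}E_jE_i^t=0,\qquad \sum_{t=0}^{r}(-1)^t\binom{r}{t}_{q^{d_i}}F_i^{r-t}F_jF_i^t=0,$$ where $\binom{r}{t}_Q=\frac{[r]_Q!}{[t]_Q!\,[r-t]_Q!}$,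 $[m]_Q!=[1]_Q\cdots[m]_Q$, $[m]_Q=\frac{Q^m-Q^{-m}}{Q-Q^{-1}}$. Its coproduct is given by $\Delta(E_i)=E_i\otimes1+K_i\otimes E_i$, $\Delta(F_i)=F_i\otimes K_i^{-1}+1\otimes F_i$, $\Delta(K_i)=K_i\otimes K_i$, its counit by $\varepsilon(E_i)=\varepsilon(F_i)=0$, $\varepsilon(K_i)=1$, and its antipode by $S(E_i)=-K_i^{-1}E_i$, $S(F_i)=-F_iK_i$, $S(K_i)=K_i^{-1}$. Let $\mathbb C[\mathfrak p^-]_q$ be the unital associative $\mathbb C$-algebra with generators $z_{ij}$, $1\le j\le i\le n$, and the defining relations (for $1\le j\le i\le n$ and $1\le l\le k\le n$) \begin{align*} &z_{ij}z_{kl}=q^2z_{kl}z_{ij}, && i=j=l<k \ \text{ or }\ j<i=k=l,\\ &z_{ij}z_{kl}=qz_{kl}z_{ij}, && j<l<i=k \ \text{ or }\ j=l<i<k,\\ &z_{kl}z_{ij}=z_{ij}z_{kl}, && j<l\le k<i,\\ &z_{ij}z_{kl}=z_{kl}z_{ij}+q(q^2-q^{-2})z_{lj}z_{ki}, && i=j<k=l,\\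 &z_{ij}z_{kl}=z_{kl}z_{ij}+(q^2-q^{-2})z_{lj}z_{ki}, && i=j<l<k \ \text{ or }\ j<i<k=l,\\ &z_{ij}z_{kl}=z_{kl}z_{ij}+(q-q^{-1})(qz_{li}z_{kj}+z_{ki}z_{lj}), && j<i<l<k,\\ &z_{ij}z_{kl}=z_{kl}z_{ij}+(q-q^{-1})z_{il}z_{kj}, && j<l<i<k,\\ &z_{ij}z_{kl}=qz_{kl}z_{ij}+(q-q^{-1})z_{il}z_{kj}, && j<i=l<k. \end{align*} Theorem. There is a unique $U_q\mathfrak{sp}_{2n}$-module structure on $\mathbb C[\mathfrak p^-]_q$ that makes it a $U_q\mathfrak{sp}_{2n}$-module algebra (the multiplication $\mathbb C[\mathfrak p^-]_q\otimes\mathbb C[\mathfrak p^-]_q\to\mathbb C[\mathfrak p^-]_q$ is a morphism of modules and $\xi\cdot1=\varepsilon(\xi)1$ for all $\xi\in U_q\mathfrak{sp}_{2n}$) and that acts on the generators $z_{ij}$, $1\le j\le i\le n$, as follows. For $k<n$, $$K_kz_{ij}=\begin{cases}q^2z_{ij},&i=j=k,\\ q^{-2}z_{ij},&i=j=k+1,\\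 qz_{ij},&i=k>j\text{ or }i-1>k=j,\\ q^{-1}z_{ij},&i-1=k>j\text{ or }i>k+1=j,\\ z_{ij},&\text{otherwise},\end{cases}$$ $$E_kz_{ij}=q^{-1/2}\begin{cases}(q+q^{-1})z_{i,j-1},&i=j=k+1,\\ z_{i-1,j},&i=k+1>j,\\ z_{i,j-1},&i>k+1=j,\\ 0,&\text{otherwise},\end{cases}\qquad F_kz_{ij}=q^{1/2}\begin{cases}(q+q^{-1})z_{i+1,j},&i=j=k,\\ z_{i+1,j},&i=k>j,\\ z_{i,j+1},&i>k=j,\\ 0,&\text{otherwise},\end{cases}$$ and $$K_nz_{ij}=\begin{cases}q^4z_{ij},&i=j=n,\\ q^2z_{ij},&i=n>j,\\ z_{ij},&\text{otherwise},\end{cases}\qquad F_nz_{ij}=\begin{cases}q,&i=j=n,\\0,&\text{otherwise},\end{cases}\qquad E_nz_{ij}=-\begin{cases}qz_{nn}z_{ij},&i=n\ge j,\\ z_{ni}z_{nj},&\text{otherwise}.\end{cases}$$ -/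

import Mathlib

open scoped TensorProduct

noncomputable section

namespace QSp

/-! ### The Cartan data -/

/-- The index set `{1, …, n}` of the simple roots. -/
abbrev Idx (n : ℕ) : Type := {k : ℕ // 1 ≤ k ∧ k ≤ n}

/-- The Cartan matrix `a` of `sp_{2n}` (indices run from `1` to `n`): the diagonal entries are `2`,
the entry in row `n - 1` and column `n` is `-2`, and the other entries next to the diagonal
are `-1`. -/
def cartan (n i j : ℕ) : ℤ :=
  if i = j then 2
  else if i + 1 = j then (if j = n then -2 else -1)
  else if j + 1 = i then -1
  else 0

/-- The numbers symmetrizing the Cartan matrix: `d_i = 1` for `i < n` and `d_n = 2`. -/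
def symm (n i : ℕ) : ℕ := if i = n then 2 else 1

theorem symm_mul_cartan (n : ℕ) (i j : Idx n) :
    (symm n i : ℤ) * cartan n i j = (symm n j : ℤ) * cartan n j i := by
  obtain ⟨i, hi⟩ := i
  obtain ⟨j, hj⟩ := j
  simp only [symm, cartan]
  split_ifs <;> omega

/-- The deformation parameter `q ∈ (0, 1)` as a complex number. -/
def qC (q : Set.Ioo (0 : ℝ) 1) : ℂ := ((q : ℝ) : ℂ)

theorem qC_ne_zero (q : Set.Ioo (0 : ℝ) 1) : qC q ≠ 0 := by
  have := q.2.1.ne'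
  simpa [qC] using this

/-! ### Quantum integers and Serre expressions -/

/-- The quantum integer `[m]_Q = (Q ^ m - Q ^ (-m)) / (Q - Q⁻¹)`. -/
def qInt (Q : ℂ) (m : ℕ) : ℂ := (Q ^ m - (Q⁻¹) ^ m) / (Q - Q⁻¹)

/-- The quantum factorial `[m]_Q! = [1]_Q [2]_Q ⋯ [m]_Q`. -/
def qFact (Q : ℂ) (m : ℕ) : ℂ := ∏ t ∈ Finset.range m, qInt Q (t + 1)

/-- The quantum binomial coefficient `[m]_Q! / ([t]_Q! [m - t]_Q!)`, for `t ≤ m`. -/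
def qBinom (Q : ℂ) (m t : ℕ) : ℂ := qFact Q m / (qFact Q t * qFact Q (m - t))

/-- The left side of the `q`-Serre relation:
`∑_{t=0}^{r} (-1)^t [r choose t]_Q x^(r-t) y x^t`. -/
def qSerre {A : Type*} [Ring A] [Algebra ℂ A] (Q : ℂ) (r : ℕ) (x y : A) : A :=
  ∑ t ∈ Finset.range (r + 1), ((-1) ^ t * qBinom Q r t) • (x ^ (r - t) * y * x ^ t)

/-! ### The algebra `U_q sp_{2n}` -/

/-- Names of the generators of `U_q sp_{2n}`. -/
inductive Gen (n : ℕ) : Type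
  | K (i : Idx n) : Gen n
  | Kinv (i : Idx n) : Gen n
  | E (i : Idx n) : Gen n
  | F (i : Idx n) : Gen n

/-- The defining relations of `U_q sp_{2n}`, written for a family `g` of elements of any
algebra; `Rel q g x y` says that `x = y` is one of the relations. -/
inductive Rel {n : ℕ} (q : Set.Ioo (0 : ℝ) 1) {A : Type*} [Ring A] [Algebra ℂ A]
    (g : Gen n → A) : A → A → Prop
  | K_K (i j : Idx n) : Rel q g (g (.K i) * g (.K j)) (g (.K j) * g (.K i))
  | K_Kinv (i : Idx n) : Rel q g (g (.K i) * g (.Kinv i)) 1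
  | Kinv_K (i : Idx n) : Rel q g (g (.Kinv i) * g (.K i)) 1
  | K_E (i j : Idx n) : Rel q g (g (.K i) * g (.E j))
      (qC q ^ ((symm n i : ℤ) * cartan n i j) • (g (.E j) * g (.K i)))
  | K_F (i j : Idx n) : Rel q g (g (.K i) * g (.F j))
      (qC q ^ (-((symm n i : ℤ) * cartan n i j)) • (g (.F j) * g (.K i)))
  | E_F_same (i : Idx n) : Rel q g (g (.E i) * g (.F i) - g (.F i) * g (.E i))
      ((qC q ^ symm n i - (qC q ^ symm n i)⁻¹)⁻¹ • (g (.K i) - g (.Kinv i)))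
  | E_F_ne (i j : Idx n) (h : i ≠ j) :
      Rel q g (g (.E i) * g (.F j) - g (.F j) * g (.E i)) 0
  | serre_E (i j : Idx n) (h : i ≠ j) :
      Rel q g (qSerre (qC q ^ symm n i) (1 - cartan n i j).toNat (g (.E i)) (g (.E j))) 0
  | serre_F (i j : Idx n) (h : i ≠ j) :
      Rel q g (qSerre (qC q ^ symm n i) (1 - cartan n i j).toNat (g (.F i)) (g (.F j))) 0

/-- The algebra `U_q sp_{2n}` over `ℂ`, presented by generators and relations. -/
def Uq (n : ℕ) (q : Set.Ioo (0 : ℝ) 1) : Type :=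
  RingQuot (Rel q (FreeAlgebra.ι ℂ : Gen n → FreeAlgebra ℂ (Gen n)))

namespace Uq

variable {n : ℕ} {q : Set.Ioo (0 : ℝ) 1}

instance : Ring (Uq n q) := inferInstanceAs (Ring (RingQuot _))
instance : Algebra ℂ (Uq n q) := inferInstanceAs (Algebra ℂ (RingQuot _))

/-- The generators of `U_q sp_{2n}`. -/
def gen (q : Set.Ioo (0 : ℝ) 1) (x : Gen n) : Uq n q :=
  RingQuot.mkAlgHom ℂ (Rel q (FreeAlgebra.ι ℂ)) (FreeAlgebra.ι ℂ x)

/-- The generator `K_i`. -/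
def K (q : Set.Ioo (0 : ℝ) 1) (i : Idx n) : Uq n q := gen q (.K i)
/-- The generator `K_i⁻¹`. -/
def Kinv (q : Set.Ioo (0 : ℝ) 1) (i : Idx n) : Uq n q := gen q (.Kinv i)
/-- The generator `E_i`. -/
def E (q : Set.Ioo (0 : ℝ) 1) (i : Idx n) : Uq n q := gen q (.E i)
/-- The generator `F_i`. -/
def F (q : Set.Ioo (0 : ℝ) 1) (i : Idx n) : Uq n q := gen q (.F i)

end Uq

theorem map_qSerre {A B : Type*} [Ring A] [Algebra ℂ A] [Ring B] [Algebra ℂ B]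
    (f : A →ₐ[ℂ] B) (Q : ℂ) (r : ℕ) (x y : A) :
    f (qSerre Q r x y) = qSerre Q r (f x) (f y) := by
  simp [qSerre, map_sum]

theorem Rel.map {n : ℕ} {q : Set.Ioo (0 : ℝ) 1} {A B : Type*} [Ring A] [Algebra ℂ A]
    [Ring B] [Algebra ℂ B] (f : A →ₐ[ℂ] B) {g : Gen n → A} {x y : A} (h : Rel q g x y) :
    Rel q (fun a => f (g a)) (f x) (f y) := by
  cases h with
  | K_K i j => simpa using Rel.K_K (q := q) (g := fun a => f (g a)) i j
  | K_Kinv i => simpa using Rel.K_Kinv (q := q) (g := fun a => f (g a)) i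
  | Kinv_K i => simpa using Rel.Kinv_K (q := q) (g := fun a => f (g a)) i
  | K_E i j => simpa using Rel.K_E (q := q) (g := fun a => f (g a)) i j
  | K_F i j => simpa using Rel.K_F (q := q) (g := fun a => f (g a)) i j
  | E_F_same i => simpa using Rel.E_F_same (q := q) (g := fun a => f (g a)) i
  | E_F_ne i j h => simpa using Rel.E_F_ne (q := q) (g := fun a => f (g a)) i j h
  | serre_E i j h =>
    simpa [map_qSerre] using Rel.serre_E (q := q) (g := fun a => f (g a)) i j h
  | serre_F i j h =>
    simpa [map_qSerre] using Rel.serre_F (q := q) (g := fun a => f (g a)) i j h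

namespace Uq

variable {n : ℕ} {q : Set.Ioo (0 : ℝ) 1}

theorem rel {x y : Uq n q} (h : Rel q (gen q) x y) : x = y := by
  have key : ∀ {a b : FreeAlgebra ℂ (Gen n)}, Rel q (FreeAlgebra.ι ℂ) a b →
      RingQuot.mkAlgHom ℂ (Rel q (FreeAlgebra.ι ℂ)) a
        = RingQuot.mkAlgHom ℂ (Rel q (FreeAlgebra.ι ℂ)) b := fun h => RingQuot.mkAlgHom_rel ℂ h
  cases h with
  | K_K i j => simpa using! key (Rel.K_K i j)
  | K_Kinv i => simpa using! key (Rel.K_Kinv i)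
  | Kinv_K i => simpa using! key (Rel.Kinv_K i)
  | K_E i j => simpa using! key (Rel.K_E i j)
  | K_F i j => simpa using! key (Rel.K_F i j)
  | E_F_same i => simpa using! key (Rel.E_F_same i)
  | E_F_ne i j h => simpa using! key (Rel.E_F_ne i j h)
  | serre_E i j h => simpa [map_qSerre] using! key (Rel.serre_E i j h)
  | serre_F i j h => simpa [map_qSerre] using! key (Rel.serre_F i j h)

/-- The universal property of `U_q sp_{2n}`. -/
def lift {A : Type*} [Ring A] [Algebra ℂ A] (g : Gen n → A)
    (hg : ∀ x y, Rel q g x y → x = y) : Uq n q →ₐ[ℂ] A :=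
  RingQuot.liftAlgHom ℂ ⟨FreeAlgebra.lift ℂ g, fun x y h => hg _ _ (by
    simpa using Rel.map (FreeAlgebra.lift ℂ g) h)⟩

theorem lift_gen {A : Type*} [Ring A] [Algebra ℂ A] (g : Gen n → A)
    (hg : ∀ x y, Rel q g x y → x = y) (x : Gen n) : lift g hg (gen q x) = g x := by
  unfold lift gen
  erw [RingQuot.liftAlgHom_mkAlgHom_apply]
  simp

theorem algHom_ext {A : Type*} [Ring A] [Algebra ℂ A] {f g : Uq n q →ₐ[ℂ] A}
    (h : ∀ x, f (gen q x) = g (gen q x)) : f = g := by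
  refine RingQuot.ringQuot_ext' ℂ f g (FreeAlgebra.hom_ext ?_)
  funext x
  exact h x

theorem induction {p : Uq n q → Prop} (hc : ∀ c : ℂ, p (algebraMap ℂ _ c))
    (hg : ∀ x, p (gen q x)) (hadd : ∀ a b, p a → p b → p (a + b))
    (hmul : ∀ a b, p a → p b → p (a * b)) (u : Uq n q) : p u := by
  obtain ⟨a, rfl⟩ := RingQuot.mkAlgHom_surjective ℂ (Rel q (FreeAlgebra.ι ℂ)) u
  induction a using FreeAlgebra.induction with
  | grade0 c => simpa using! hc c
  | grade1 x => exact hg x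
  | mul a b ha hb => simpa using! hmul _ _ ha hb
  | add a b ha hb => simpa using! hadd _ _ ha hb

end Uq


/-! ### Compatibility of the Serre relations with the comultiplication and the antipode -/

theorem qInt_one {Q : ℂ} (h : Q - Q⁻¹ ≠ 0) : qInt Q 1 = 1 := by
  simp [qInt, h]

theorem qInt_two {Q : ℂ} (h : Q - Q⁻¹ ≠ 0) : qInt Q 2 = Q + Q⁻¹ := by
  rw [qInt, div_eq_iff h]; ring

theorem qInt_three {Q : ℂ} (h0 : Q ≠ 0) (h : Q - Q⁻¹ ≠ 0) : qInt Q 3 = Q ^ 2 + 1 + (Q⁻¹) ^ 2 := by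
  rw [qInt, div_eq_iff h]; field_simp; ring

theorem qInt_inv (Q : ℂ) (m : ℕ) : qInt Q⁻¹ m = qInt Q m := by
  rw [qInt, qInt, inv_inv, ← neg_sub, ← neg_sub Q, neg_div_neg_eq]

theorem qSerre_inv {A : Type*} [Ring A] [Algebra ℂ A] (Q : ℂ) (r : ℕ) (x y : A) :
    qSerre Q⁻¹ r x y = qSerre Q r x y := by
  simp [qSerre, qBinom, qFact, qInt_inv]

/-- `Q` is not one of the few roots of unity that make small quantum integers vanish. -/
structure Generic (Q : ℂ) : Prop where
  ne_zero : Q ≠ 0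
  h1 : Q - Q⁻¹ ≠ 0
  h2 : Q + Q⁻¹ ≠ 0
  h3 : Q ^ 2 + 1 + (Q⁻¹) ^ 2 ≠ 0

theorem generic_pow (q : Set.Ioo (0 : ℝ) 1) {d : ℕ} (hd : d ≠ 0) : Generic (qC q ^ d) := by
  obtain ⟨q, h0, h1⟩ := q
  have hx0 : 0 < q ^ d := pow_pos h0 d
  have hx1 : q ^ d < 1 := pow_lt_one₀ h0.le h1 hd
  generalize hx : q ^ d = x at hx0 hx1
  have e : qC ⟨q, h0, h1⟩ ^ d = (x : ℂ) := by simp [qC, ← hx]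
  rw [e]
  have hi : 1 < x⁻¹ := (one_lt_inv₀ hx0).2 hx1
  refine ⟨by exact_mod_cast hx0.ne', ?_, ?_, ?_⟩
  · have : x - x⁻¹ ≠ 0 := by linarith
    exact_mod_cast this
  · have : x + x⁻¹ ≠ 0 := by positivity
    exact_mod_cast this
  · have : x ^ 2 + 1 + (x⁻¹) ^ 2 ≠ 0 := by positivity
    exact_mod_cast this

theorem Generic.inv {Q : ℂ} (h : Generic Q) : Generic Q⁻¹ := by
  obtain ⟨h0, h1, h2, h3⟩ := h
  refine ⟨inv_ne_zero h0, ?_, ?_, ?_⟩ <;> rw [inv_inv]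
  · rw [← neg_sub]; exact neg_ne_zero.2 h1
  · rwa [add_comm]
  · intro h; apply h3; rw [← h]; ring

section Serre

variable {A : Type*} [Ring A] [Algebra ℂ A] {Q : ℂ}

theorem qSerre_one (hQ : Generic Q) (x y : A) : qSerre Q 1 x y = x * y - y * x := by
  simp [qSerre, Finset.sum_range_succ, qBinom, qFact, qInt_one hQ.h1]
  abel

theorem qSerre_two (hQ : Generic Q) (x y : A) :
    qSerre Q 2 x y = x * (x * y) - (Q + Q⁻¹) • (x * (y * x)) + y * (x * x) := by
  simp [qSerre, Finset.sum_range_succ, Finset.prod_range_succ, qBinom, qFact, qInt_one hQ.h1,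
    qInt_two hQ.h1, hQ.h2, pow_two, mul_assoc]
  module

theorem qSerre_three (hQ : Generic Q) (x y : A) :
    qSerre Q 3 x y = x * (x * (x * y)) - (Q ^ 2 + 1 + (Q⁻¹) ^ 2) • (x * (x * (y * x)))
      + (Q ^ 2 + 1 + (Q⁻¹) ^ 2) • (x * (y * (x * x))) - y * (x * (x * x)) := by
  have h2 := hQ.h2
  have h3 := hQ.h3
  have e : ∀ m, qFact Q (m + 1) = qFact Q m * qInt Q (m + 1) := fun m =>
    Finset.prod_range_succ _ _
  have e0 : qFact Q 0 = 1 := Finset.prod_range_zero _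
  have e1 : qFact Q 1 = 1 := by rw [e, e0, zero_add, qInt_one hQ.h1, one_mul]
  have e2 : qFact Q 2 = Q + Q⁻¹ := by rw [e, e1, one_add_one_eq_two, qInt_two hQ.h1, one_mul]
  have e3 : qFact Q 3 = (Q + Q⁻¹) * (Q ^ 2 + 1 + (Q⁻¹) ^ 2) := by
    rw [e, e2, two_add_one_eq_three, qInt_three hQ.ne_zero hQ.h1]
  have b0 : qBinom Q 3 0 = 1 := by
    rw [qBinom, Nat.sub_zero, e0, one_mul, e3]; exact div_self (mul_ne_zero h2 h3)
  have b3 : qBinom Q 3 3 = 1 := by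
    rw [qBinom, Nat.sub_self, e0, mul_one, e3]; exact div_self (mul_ne_zero h2 h3)
  have b1 : qBinom Q 3 1 = Q ^ 2 + 1 + (Q⁻¹) ^ 2 := by
    rw [qBinom, e1, one_mul, e3, e2, mul_div_cancel_left₀ _ h2]
  have b2 : qBinom Q 3 2 = Q ^ 2 + 1 + (Q⁻¹) ^ 2 := by
    rw [qBinom, e1, mul_one, e3, e2, mul_div_cancel_left₀ _ h2]
  simp only [qSerre, Finset.sum_range_succ, Finset.sum_range_zero, b0, b1, b2, b3]
  norm_num [pow_succ, mul_assoc]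
  module

theorem qSerre_add (hQ : Generic Q) {r : ℕ} (hr : r = 1 ∨ r = 2 ∨ r = 3) {c : ℂ}
    (hc : c = Q ^ (1 - r : ℤ)) {a b x y : A} (hba : b * a = (Q ^ 2) • (a * b))
    (hbx : b * x = c • (x * b)) (hya : y * a = c • (a * y))
    (hax : qSerre Q r a x = 0) (hby : qSerre Q r b y = 0) :
    qSerre Q r (a + b) (x + y) = 0 := by
  have h0 := hQ.ne_zero
  have hba' : ∀ w, b * (a * w) = (Q ^ 2) • (a * (b * w)) := fun w => by
    rw [← mul_assoc, hba, smul_mul_assoc, mul_assoc]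
  have hbx' : ∀ w, b * (x * w) = c • (x * (b * w)) := fun w => by
    rw [← mul_assoc, hbx, smul_mul_assoc, mul_assoc]
  have hya' : ∀ w, y * (a * w) = c • (a * (y * w)) := fun w => by
    rw [← mul_assoc, hya, smul_mul_assoc, mul_assoc]
  rcases hr with rfl | rfl | rfl
  · have hc' : c = 1 := by simpa using hc
    subst hc'
    rw [qSerre_one hQ] at *
    simp only [mul_add, add_mul, hbx, hya] at *
    rw [← add_zero (0 : A)]
    nth_rewrite 1 [← hax]
    rw [← hby, one_smul, one_smul]
    abel
  · have hc' : c = Q⁻¹ := by rw [hc]; norm_num [zpow_neg]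
    subst hc'
    rw [qSerre_two hQ] at *
    rw [← add_zero (0 : A)]
    nth_rewrite 1 [← hax]
    rw [← hby]
    simp only [mul_add, add_mul, mul_assoc, hbx, hya, hba, hbx', hya', hba', smul_mul_assoc, mul_smul_comm,
      smul_add, smul_smul]
    match_scalars <;> field_simp <;> ring
  · have hc' : c = Q⁻¹ ^ 2 := by rw [hc]; norm_num [zpow_neg]
    subst hc'
    rw [qSerre_three hQ] at *
    rw [← add_zero (0 : A)]
    nth_rewrite 1 [← hax]
    rw [← hby]
    simp only [mul_add, add_mul, mul_assoc, hbx, hya, hba, hbx', hya', hba', smul_mul_assoc, mul_smul_comm,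
      smul_add, smul_smul]
    match_scalars <;> field_simp <;> ring

/-- The Serre relation for `k⁻¹ x`-type elements in the opposite algebra. -/
theorem qSerre_op (hQ : Generic Q) {r : ℕ} (hr : r = 1 ∨ r = 2 ∨ r = 3) {c : ℂ}
    {k l x y : A} (hkl : l * k = k * l) (hxk : x * k = (Q ^ 2) • (k * x))
    (hxl : x * l = c • (l * x)) (hyk : y * k = c • (k * y)) (hs : qSerre Q r x y = 0) :
    qSerre Q r (MulOpposite.op (-(k * x))) (MulOpposite.op (-(l * y))) = 0 := by
  have h0 := hQ.ne_zero
  have hkl' : ∀ w, l * (k * w) = k * (l * w) := fun w => by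
    rw [← mul_assoc, hkl, mul_assoc]
  have hxk' : ∀ w, x * (k * w) = (Q ^ 2) • (k * (x * w)) := fun w => by
    rw [← mul_assoc, hxk, smul_mul_assoc, mul_assoc]
  have hxl' : ∀ w, x * (l * w) = c • (l * (x * w)) := fun w => by
    rw [← mul_assoc, hxl, smul_mul_assoc, mul_assoc]
  have hyk' : ∀ w, y * (k * w) = c • (k * (y * w)) := fun w => by
    rw [← mul_assoc, hyk, smul_mul_assoc, mul_assoc]
  rcases hr with rfl | rfl | rfl
  · rw [qSerre_one hQ] at *
    apply MulOpposite.unop_injective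
    simp only [MulOpposite.unop_sub, MulOpposite.unop_mul, MulOpposite.unop_op, MulOpposite.unop_zero]
    simp only [neg_mul_neg, mul_assoc, hkl', hxl', hyk']
    have := congrArg (fun w => (-c) • (k * (l * w))) hs
    simp only [mul_zero, smul_zero, mul_sub] at this
    rw [← this]
    simp only [mul_assoc, hkl', mul_smul_comm]
    module
  · rw [qSerre_two hQ] at *
    apply MulOpposite.unop_injective
    simp only [MulOpposite.unop_sub, MulOpposite.unop_add, MulOpposite.unop_smul,
      MulOpposite.unop_mul, MulOpposite.unop_op, MulOpposite.unop_zero]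
    have := congrArg (fun w => (-(c ^ 2 * Q ^ 2)) • (k * (k * (l * w)))) hs
    simp only [mul_zero, smul_zero, mul_sub, mul_add, mul_smul_comm] at this
    rw [← this]
    simp only [neg_mul, mul_neg, neg_neg, mul_assoc, hkl', hxl', hyk', hxk', mul_smul_comm, smul_mul_assoc, smul_smul,
      smul_neg, smul_add, smul_sub]
    module
  · rw [qSerre_three hQ] at *
    apply MulOpposite.unop_injective
    simp only [MulOpposite.unop_sub, MulOpposite.unop_add, MulOpposite.unop_smul,
      MulOpposite.unop_mul, MulOpposite.unop_op, MulOpposite.unop_zero]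
    have := congrArg (fun w => (-(c ^ 3 * Q ^ 6)) • (k * (k * (k * (l * w))))) hs
    simp only [mul_zero, smul_zero, mul_sub, mul_add, mul_smul_comm] at this
    rw [← this]
    simp only [neg_mul, mul_neg, neg_neg, mul_assoc, hkl', hxl', hyk', hxk', mul_smul_comm, smul_mul_assoc, smul_smul,
      smul_neg, smul_add, smul_sub]
    module

end Serre


theorem cartan_cases {n : ℕ} {i j : Idx n} (h : i ≠ j) :
    ∃ r : ℕ, (1 - cartan n i j).toNat = r ∧ cartan n i j = 1 - r ∧ (r = 1 ∨ r = 2 ∨ r = 3) := by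
  have h' : (i : ℕ) ≠ j := fun e => h (Subtype.ext e)
  refine ⟨(1 - cartan n i j).toNat, rfl, ?_⟩
  rw [cartan, if_neg h']
  split_ifs <;> simp

theorem cartan_self (n i : ℕ) : cartan n i i = 2 := if_pos rfl

theorem symm_ne_zero (n i : ℕ) : symm n i ≠ 0 := by
  unfold symm; split_ifs <;> norm_num

namespace Uq

variable {n : ℕ} {q : Set.Ioo (0 : ℝ) 1}

/-! ### The defining relations -/

theorem K_mul_K (i j : Idx n) : K q i * K q j = K q j * K q i := rel (.K_K i j)
theorem K_mul_Kinv (i : Idx n) : K q i * Kinv q i = 1 := rel (.K_Kinv i)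
theorem Kinv_mul_K (i : Idx n) : Kinv q i * K q i = 1 := rel (.Kinv_K i)
theorem K_mul_E (i j : Idx n) : K q i * E q j =
    qC q ^ ((symm n i : ℤ) * cartan n i j) • (E q j * K q i) := rel (.K_E i j)
theorem K_mul_F (i j : Idx n) : K q i * F q j =
    qC q ^ (-((symm n i : ℤ) * cartan n i j)) • (F q j * K q i) := rel (.K_F i j)
theorem E_mul_F_same (i : Idx n) : E q i * F q i - F q i * E q i =
    (qC q ^ symm n i - (qC q ^ symm n i)⁻¹)⁻¹ • (K q i - Kinv q i) := rel (.E_F_same i)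
theorem E_mul_F_ne {i j : Idx n} (h : i ≠ j) : E q i * F q j - F q j * E q i = 0 :=
  rel (.E_F_ne i j h)
theorem serre_E {i j : Idx n} (h : i ≠ j) :
    qSerre (qC q ^ symm n i) (1 - cartan n i j).toNat (E q i) (E q j) = 0 :=
  rel (.serre_E i j h)
theorem serre_F {i j : Idx n} (h : i ≠ j) :
    qSerre (qC q ^ symm n i) (1 - cartan n i j).toNat (F q i) (F q j) = 0 :=
  rel (.serre_F i j h)

theorem comm_inv {A : Type*} [Ring A] [Algebra ℂ A] {k k' x : A} {c : ℂ}
    (h1 : k * k' = 1) (h2 : k' * k = 1) (h : k * x = c • (x * k)) :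
    x * k' = c • (k' * x) := by
  have : k' * (k * x) * k' = k' * (c • (x * k)) * k' := by rw [h]
  rw [← mul_assoc, h2, one_mul] at this
  rw [this, mul_smul_comm, smul_mul_assoc, mul_assoc, mul_assoc, h1, mul_one]

theorem E_mul_Kinv (i j : Idx n) : E q j * Kinv q i =
    qC q ^ ((symm n i : ℤ) * cartan n i j) • (Kinv q i * E q j) :=
  comm_inv (K_mul_Kinv i) (Kinv_mul_K i) (K_mul_E i j)

theorem F_mul_Kinv (i j : Idx n) : F q j * Kinv q i =
    qC q ^ (-((symm n i : ℤ) * cartan n i j)) • (Kinv q i * F q j) :=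
  comm_inv (K_mul_Kinv i) (Kinv_mul_K i) (K_mul_F i j)

theorem F_mul_K (i j : Idx n) : F q j * K q i =
    qC q ^ ((symm n i : ℤ) * cartan n i j) • (K q i * F q j) := by
  rw [K_mul_F, smul_smul, ← zpow_add₀ (qC_ne_zero q), add_neg_cancel, zpow_zero, one_smul]

theorem Kinv_mul_E (i j : Idx n) : Kinv q i * E q j =
    qC q ^ (-((symm n i : ℤ) * cartan n i j)) • (E q j * Kinv q i) := by
  rw [E_mul_Kinv, smul_smul, ← zpow_add₀ (qC_ne_zero q), neg_add_cancel, zpow_zero, one_smul]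

theorem E_mul_K (i j : Idx n) : E q j * K q i =
    qC q ^ (-((symm n i : ℤ) * cartan n i j)) • (K q i * E q j) := by
  rw [K_mul_E, smul_smul, ← zpow_add₀ (qC_ne_zero q), neg_add_cancel, zpow_zero, one_smul]

theorem Kinv_mul_F (i j : Idx n) : Kinv q i * F q j =
    qC q ^ ((symm n i : ℤ) * cartan n i j) • (F q j * Kinv q i) := by
  rw [F_mul_Kinv, smul_smul, ← zpow_add₀ (qC_ne_zero q), add_neg_cancel, zpow_zero, one_smul]

theorem K_mul_Kinv_comm (i j : Idx n) : K q i * Kinv q j = Kinv q j * K q i := by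
  simpa using comm_inv (c := 1) (x := K q i) (K_mul_Kinv j) (Kinv_mul_K j)
    (by rw [one_smul]; exact K_mul_K (q := q) j i)

theorem Kinv_mul_Kinv (i j : Idx n) : Kinv q i * Kinv q j = Kinv q j * Kinv q i := by
  simpa using comm_inv (c := 1) (x := Kinv q i) (K_mul_Kinv j) (Kinv_mul_K j)
    (by rw [one_smul]; exact K_mul_Kinv_comm (q := q) j i)

/-! ### The Hopf algebra structure -/

open Algebra.TensorProduct in
/-- The comultiplication on generators: `Δ(K_i) = K_i ⊗ K_i`, `Δ(E_i) = E_i ⊗ 1 + K_i ⊗ E_i`,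
`Δ(F_i) = F_i ⊗ K_i⁻¹ + 1 ⊗ F_i`. -/
def comulGen (q : Set.Ioo (0 : ℝ) 1) : Gen n → Uq n q ⊗[ℂ] Uq n q
  | .K i => K q i ⊗ₜ K q i
  | .Kinv i => Kinv q i ⊗ₜ Kinv q i
  | .E i => E q i ⊗ₜ 1 + K q i ⊗ₜ E q i
  | .F i => F q i ⊗ₜ Kinv q i + 1 ⊗ₜ F q i

theorem qSerre_tmul_one {A : Type*} [Ring A] [Algebra ℂ A] (Q : ℂ) (r : ℕ) (x y : A) :
    qSerre Q r (x ⊗ₜ[ℂ] (1 : A)) (y ⊗ₜ[ℂ] (1 : A)) = qSerre Q r x y ⊗ₜ[ℂ] (1 : A) :=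
  (map_qSerre (Algebra.TensorProduct.includeLeft : A →ₐ[ℂ] A ⊗[ℂ] A) Q r x y).symm

theorem qSerre_one_tmul {A : Type*} [Ring A] [Algebra ℂ A] (Q : ℂ) (r : ℕ) (x y : A) :
    qSerre Q r ((1 : A) ⊗ₜ[ℂ] x) ((1 : A) ⊗ₜ[ℂ] y) = (1 : A) ⊗ₜ[ℂ] qSerre Q r x y :=
  (map_qSerre (Algebra.TensorProduct.includeRight : A →ₐ[ℂ] A ⊗[ℂ] A) Q r x y).symm

/-- Multiplying by commuting group-like elements does not affect the Serre relation. -/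
theorem qSerre_mul {A : Type*} [Ring A] [Algebra ℂ A] {Q : ℂ} {r : ℕ}
    {k l x y : A} (hkl : Commute k l) (hkx : Commute k x) (hky : Commute k y)
    (hlx : Commute l x) (h : qSerre Q r x y = 0) :
    qSerre Q r (k * x) (l * y) = 0 := by
  have : qSerre Q r (k * x) (l * y) = k ^ r * l * qSerre Q r x y := by
    simp only [qSerre, Finset.mul_sum]
    refine Finset.sum_congr rfl fun t ht => ?_
    have ht' : t ≤ r := Nat.lt_succ_iff.1 (Finset.mem_range.1 ht)
    rw [hkx.mul_pow, hkx.mul_pow, mul_smul_comm]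
    congr 1
    have e : k ^ r = k ^ (r - t) * k ^ t := by rw [← pow_add, Nat.sub_add_cancel ht']
    have e1 : Commute (k ^ t) (l * x ^ (r - t) * y) :=
      ((hkl.pow_left t).mul_right (hkx.pow_pow t _)).mul_right (hky.pow_left t)
    have e2 : Commute (x ^ (r - t)) l := (hlx.symm.pow_left _)
    calc k ^ (r - t) * x ^ (r - t) * (l * y) * (k ^ t * x ^ t)
        = k ^ (r - t) * ((x ^ (r - t) * l) * y * k ^ t) * x ^ t := by simp only [mul_assoc]
      _ = k ^ (r - t) * (l * x ^ (r - t) * y * k ^ t) * x ^ t := by rw [e2.eq]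
      _ = k ^ (r - t) * (k ^ t * (l * x ^ (r - t) * y)) * x ^ t := by rw [e1.eq]
      _ = k ^ r * l * (x ^ (r - t) * y * x ^ t) := by rw [e]; simp only [mul_assoc]
  rw [this, h, mul_zero]

theorem qpow_self (i : Idx n) : qC q ^ ((symm n i : ℤ) * cartan n i i) = (qC q ^ symm n i) ^ 2 := by
  rw [cartan_self, zpow_mul, zpow_natCast, zpow_ofNat]

theorem comulGen_rel (x y : Uq n q ⊗[ℂ] Uq n q) (h : Rel q (comulGen q) x y) : x = y := by
  cases h with
  | K_K i j => simp [comulGen, K_mul_K i j]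
  | K_Kinv i => simp [comulGen, K_mul_Kinv, Algebra.TensorProduct.one_def]
  | Kinv_K i => simp [comulGen, Kinv_mul_K, Algebra.TensorProduct.one_def]
  | K_E i j =>
    simp [comulGen, mul_add, add_mul, K_mul_E i j, K_mul_K i j, TensorProduct.tmul_smul,
      TensorProduct.smul_tmul']
  | K_F i j =>
    simp [comulGen, mul_add, add_mul, K_mul_F i j, K_mul_Kinv_comm i j, TensorProduct.tmul_smul,
      TensorProduct.smul_tmul']
  | E_F_same i =>
    have h1 := congrArg (fun w => w ⊗ₜ[ℂ] Kinv q i) (E_mul_F_same (q := q) i)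
    have h2 := congrArg (fun w => K q i ⊗ₜ[ℂ] w) (E_mul_F_same (q := q) i)
    simp only [TensorProduct.sub_tmul, TensorProduct.tmul_sub, TensorProduct.tmul_smul,
      ← TensorProduct.smul_tmul'] at h1 h2
    have h3 : (K q i * F q i) ⊗ₜ[ℂ] (E q i * Kinv q i)
        = (F q i * K q i) ⊗ₜ[ℂ] (Kinv q i * E q i) := by
      rw [F_mul_K, E_mul_Kinv]
      simp only [TensorProduct.tmul_smul, TensorProduct.smul_tmul']
    simp only [comulGen, mul_add, add_mul, Algebra.TensorProduct.tmul_mul_tmul, one_mul, mul_one,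
      h3]
    linear_combination (norm := module) h1 + h2
  | E_F_ne i j h =>
    have h1 := congrArg (fun w => w ⊗ₜ[ℂ] Kinv q j) (E_mul_F_ne (q := q) h)
    have h2 := congrArg (fun w => K q i ⊗ₜ[ℂ] w) (E_mul_F_ne (q := q) h)
    simp only [TensorProduct.sub_tmul, TensorProduct.tmul_sub, TensorProduct.zero_tmul,
      TensorProduct.tmul_zero] at h1 h2
    have h3 : (K q i * F q j) ⊗ₜ[ℂ] (E q i * Kinv q j)
        = (F q j * K q i) ⊗ₜ[ℂ] (Kinv q j * E q i) := by
      rw [F_mul_K, E_mul_Kinv, symm_mul_cartan]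
      simp only [TensorProduct.tmul_smul, TensorProduct.smul_tmul']
    simp only [comulGen, mul_add, add_mul, Algebra.TensorProduct.tmul_mul_tmul, one_mul, mul_one,
      h3]
    rw [sub_eq_zero] at h1 h2
    rw [h1, h2]
    abel
  | serre_E i j h =>
    obtain ⟨r, hr, ha, hr3⟩ := cartan_cases h
    have hs := serre_E (q := q) h
    have hQ := generic_pow q (symm_ne_zero n i)
    have hc : qC q ^ ((symm n i : ℤ) * cartan n i j) = (qC q ^ symm n i) ^ (1 - r : ℤ) := by
      rw [zpow_mul, zpow_natCast, ha]
    rw [hr] at hs ⊢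
    refine qSerre_add hQ hr3 hc ?_ ?_ ?_ ?_ ?_
    · simp [K_mul_E, qpow_self, TensorProduct.smul_tmul']
    · simp [K_mul_E i j, TensorProduct.smul_tmul']
    · simp [K_mul_E j i, TensorProduct.smul_tmul', symm_mul_cartan n i j]
    · rw [qSerre_tmul_one, hs, TensorProduct.zero_tmul]
    · have := qSerre_mul (k := K q i ⊗ₜ[ℂ] (1 : Uq n q)) (l := K q j ⊗ₜ[ℂ] (1 : Uq n q))
        (x := (1 : Uq n q) ⊗ₜ[ℂ] E q i) (y := (1 : Uq n q) ⊗ₜ[ℂ] E q j)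
        (Q := qC q ^ symm n i) (r := r)
        (by simp [commute_iff_eq, K_mul_K i j]) (by simp [commute_iff_eq])
        (by simp [commute_iff_eq]) (by simp [commute_iff_eq])
        (by rw [qSerre_one_tmul, hs, TensorProduct.tmul_zero])
      simpa using this
  | serre_F i j h =>
    obtain ⟨r, hr, ha, hr3⟩ := cartan_cases h
    have hs := serre_F (q := q) h
    have hQ := generic_pow q (symm_ne_zero n i)
    have hc : qC q ^ (-((symm n i : ℤ) * cartan n i j)) = (qC q ^ symm n i)⁻¹ ^ (1 - r : ℤ) := by
      rw [zpow_neg, zpow_mul, zpow_natCast, ha, inv_zpow]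
    rw [hr, ← qSerre_inv] at hs ⊢
    refine qSerre_add hQ.inv hr3 hc ?_ ?_ ?_ ?_ ?_
    · simp [F_mul_Kinv, zpow_neg, qpow_self, TensorProduct.smul_tmul']
    · simp [F_mul_Kinv j i, TensorProduct.smul_tmul', symm_mul_cartan n i j]
    · simp [F_mul_Kinv i j, TensorProduct.smul_tmul']
    · have := qSerre_mul (x := F q i ⊗ₜ[ℂ] (1 : Uq n q)) (y := F q j ⊗ₜ[ℂ] (1 : Uq n q))
        (k := (1 : Uq n q) ⊗ₜ[ℂ] Kinv q i) (l := (1 : Uq n q) ⊗ₜ[ℂ] Kinv q j)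
        (Q := (qC q ^ symm n i)⁻¹) (r := r)
        (by simp [commute_iff_eq, Kinv_mul_Kinv i j]) (by simp [commute_iff_eq])
        (by simp [commute_iff_eq]) (by simp [commute_iff_eq])
        (by rw [qSerre_tmul_one, hs, TensorProduct.zero_tmul])
      simpa using this
    · rw [qSerre_one_tmul, hs, TensorProduct.tmul_zero]

theorem qSerre_smul {A : Type*} [Ring A] [Algebra ℂ A] (Q : ℂ) (r : ℕ) (a b : ℂ) (x y : A) :
    qSerre Q r (a • x) (b • y) = (a ^ r * b) • qSerre Q r x y := by
  simp only [qSerre, Finset.smul_sum]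
  refine Finset.sum_congr rfl fun t ht => ?_
  have ht' : t ≤ r := Nat.lt_succ_iff.1 (Finset.mem_range.1 ht)
  have e : a ^ r = a ^ (r - t) * a ^ t := by rw [← pow_add, Nat.sub_add_cancel ht']
  simp only [smul_pow, smul_mul_assoc, mul_smul_comm, smul_smul, e]
  congr 1
  ring

/-- The counit on generators. -/
def counitGen : Gen n → ℂ
  | .K _ => 1
  | .Kinv _ => 1
  | .E _ => 0
  | .F _ => 0

theorem qSerre_zero_right {A : Type*} [Ring A] [Algebra ℂ A] (Q : ℂ) (r : ℕ) (x : A) :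
    qSerre Q r x 0 = 0 := by simp [qSerre]

theorem counitGen_rel (x y : ℂ) (h : Rel q (counitGen : Gen n → ℂ) x y) : x = y := by
  cases h <;> simp [counitGen, qSerre_zero_right]

/-- The comultiplication. -/
def comul : Uq n q →ₐ[ℂ] Uq n q ⊗[ℂ] Uq n q := lift (comulGen q) comulGen_rel

/-- The counit. -/
def counit : Uq n q →ₐ[ℂ] ℂ := lift counitGen counitGen_rel

theorem comul_gen (x : Gen n) : comul (gen q x) = comulGen q x := lift_gen _ _ x
theorem counit_gen (x : Gen n) : counit (gen q x) = counitGen x := lift_gen _ _ x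

theorem comul_K (i : Idx n) : comul (K q i) = K q i ⊗ₜ K q i := comul_gen _
theorem comul_Kinv (i : Idx n) : comul (Kinv q i) = Kinv q i ⊗ₜ Kinv q i := comul_gen _
theorem comul_E (i : Idx n) : comul (E q i) = E q i ⊗ₜ 1 + K q i ⊗ₜ E q i := comul_gen _
theorem comul_F (i : Idx n) : comul (F q i) = F q i ⊗ₜ Kinv q i + 1 ⊗ₜ F q i := comul_gen _
theorem counit_K (i : Idx n) : counit (K q i) = 1 := counit_gen _
theorem counit_Kinv (i : Idx n) : counit (Kinv q i) = 1 := counit_gen _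
theorem counit_E (i : Idx n) : counit (E q i) = 0 := counit_gen _
theorem counit_F (i : Idx n) : counit (F q i) = 0 := counit_gen _

instance : Bialgebra ℂ (Uq n q) :=
  Bialgebra.ofAlgHom comul counit
    (by
      refine algHom_ext fun x => ?_
      cases x with
      | K i =>
        change (Algebra.TensorProduct.assoc ℂ ℂ ℂ (Uq n q) (Uq n q) (Uq n q)).toAlgHom
          (Algebra.TensorProduct.map comul (.id ℂ (Uq n q)) (comul (K q i))) =
          Algebra.TensorProduct.map (.id ℂ (Uq n q)) comul (comul (K q i))
        simp [comul_K]
      | Kinv i =>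
        change (Algebra.TensorProduct.assoc ℂ ℂ ℂ (Uq n q) (Uq n q) (Uq n q)).toAlgHom
          (Algebra.TensorProduct.map comul (.id ℂ (Uq n q)) (comul (Kinv q i))) =
          Algebra.TensorProduct.map (.id ℂ (Uq n q)) comul (comul (Kinv q i))
        simp [comul_Kinv]
      | E i =>
        change (Algebra.TensorProduct.assoc ℂ ℂ ℂ (Uq n q) (Uq n q) (Uq n q)).toAlgHom
          (Algebra.TensorProduct.map comul (.id ℂ (Uq n q)) (comul (E q i))) =
          Algebra.TensorProduct.map (.id ℂ (Uq n q)) comul (comul (E q i))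
        simp [comul_E, comul_K, TensorProduct.add_tmul, TensorProduct.tmul_add,
          Algebra.TensorProduct.one_def, add_assoc]
      | F i =>
        change (Algebra.TensorProduct.assoc ℂ ℂ ℂ (Uq n q) (Uq n q) (Uq n q)).toAlgHom
          (Algebra.TensorProduct.map comul (.id ℂ (Uq n q)) (comul (F q i))) =
          Algebra.TensorProduct.map (.id ℂ (Uq n q)) comul (comul (F q i))
        simp [comul_F, comul_Kinv, TensorProduct.add_tmul, TensorProduct.tmul_add,
          Algebra.TensorProduct.one_def, add_assoc])
    (by
      refine algHom_ext fun x => ?_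
      cases x with
      | K i =>
        change Algebra.TensorProduct.map counit (.id ℂ (Uq n q)) (comul (K q i)) = 1 ⊗ₜ K q i
        simp [comul_K, counit_K]
      | Kinv i =>
        change Algebra.TensorProduct.map counit (.id ℂ (Uq n q)) (comul (Kinv q i)) = 1 ⊗ₜ Kinv q i
        simp [comul_Kinv, counit_Kinv]
      | E i =>
        change Algebra.TensorProduct.map counit (.id ℂ (Uq n q)) (comul (E q i)) = 1 ⊗ₜ E q i
        simp [comul_E, counit_K, counit_E]
      | F i =>
        change Algebra.TensorProduct.map counit (.id ℂ (Uq n q)) (comul (F q i)) = 1 ⊗ₜ F q i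
        simp [comul_F, counit_F])
    (by
      refine algHom_ext fun x => ?_
      cases x with
      | K i =>
        change Algebra.TensorProduct.map (.id ℂ (Uq n q)) counit (comul (K q i)) = K q i ⊗ₜ 1
        simp [comul_K, counit_K]
      | Kinv i =>
        change Algebra.TensorProduct.map (.id ℂ (Uq n q)) counit (comul (Kinv q i)) = Kinv q i ⊗ₜ 1
        simp [comul_Kinv, counit_Kinv]
      | E i =>
        change Algebra.TensorProduct.map (.id ℂ (Uq n q)) counit (comul (E q i)) = E q i ⊗ₜ 1
        simp [comul_E, counit_E]
      | F i =>
        change Algebra.TensorProduct.map (.id ℂ (Uq n q)) counit (comul (F q i)) = F q i ⊗ₜ 1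
        simp [comul_F, counit_F, counit_Kinv])

open MulOpposite in
/-- The antipode on generators, as a map to the opposite algebra: `S(K_i) = K_i⁻¹`,
`S(E_i) = -K_i⁻¹ E_i`, `S(F_i) = -F_i K_i`. -/
def antipodeGen (q : Set.Ioo (0 : ℝ) 1) : Gen n → (Uq n q)ᵐᵒᵖ
  | .K i => op (Kinv q i)
  | .Kinv i => op (K q i)
  | .E i => op (-(Kinv q i * E q i))
  | .F i => op (-(F q i * K q i))

open MulOpposite in
theorem antipodeGen_rel (x y : (Uq n q)ᵐᵒᵖ) (h : Rel q (antipodeGen q) x y) : x = y := by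
  cases h with
  | K_K i j =>
    apply unop_injective
    simp [antipodeGen, Kinv_mul_Kinv i j]
  | K_Kinv i =>
    apply unop_injective
    simp [antipodeGen, K_mul_Kinv]
  | Kinv_K i =>
    apply unop_injective
    simp [antipodeGen, Kinv_mul_K]
  | K_E i j =>
    apply unop_injective
    simp only [antipodeGen, unop_mul, unop_op, unop_smul, neg_mul, mul_neg, mul_assoc]
    rw [E_mul_Kinv, mul_smul_comm, ← mul_assoc, Kinv_mul_Kinv j i, mul_assoc, smul_neg]
  | K_F i j =>
    have e : Kinv q i * K q j = K q j * Kinv q i := (K_mul_Kinv_comm j i).symm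
    apply unop_injective
    simp only [antipodeGen, unop_mul, unop_op, unop_smul, neg_mul, mul_neg]
    rw [mul_assoc, ← e, ← mul_assoc, F_mul_Kinv, smul_mul_assoc, smul_neg, mul_assoc]
  | E_F_same i =>
    apply unop_injective
    simp only [antipodeGen, unop_mul, unop_op, unop_smul, unop_sub, neg_mul_neg]
    have e1 : F q i * K q i * (Kinv q i * E q i) = F q i * E q i := by
      rw [mul_assoc, ← mul_assoc (K q i), K_mul_Kinv, one_mul]
    have e2 : Kinv q i * E q i * (F q i * K q i) = E q i * F q i := by
      rw [F_mul_K, mul_smul_comm, mul_assoc, ← mul_assoc (E q i), E_mul_K, smul_mul_assoc,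
        mul_smul_comm, smul_smul, ← zpow_add₀ (qC_ne_zero q), add_neg_cancel, zpow_zero, one_smul,
        mul_assoc, ← mul_assoc, Kinv_mul_K, one_mul]
    rw [e1, e2, ← neg_sub, E_mul_F_same, ← smul_neg, neg_sub]
  | E_F_ne i j h =>
    apply unop_injective
    simp only [antipodeGen, unop_mul, unop_op, unop_sub, neg_mul_neg, unop_zero]
    have e : K q j * Kinv q i = Kinv q i * K q j := K_mul_Kinv_comm j i
    have e1 : F q j * K q j * (Kinv q i * E q i) =
        F q j * (Kinv q i * (K q j * E q i)) := by
      rw [mul_assoc, ← mul_assoc (K q j), e, mul_assoc]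
    rw [e1, K_mul_E, mul_smul_comm, mul_smul_comm, ← mul_assoc, F_mul_Kinv, smul_mul_assoc,
      smul_smul, symm_mul_cartan, ← zpow_add₀ (qC_ne_zero q), add_neg_cancel, zpow_zero, one_smul]
    have h1 := E_mul_F_ne (q := q) h
    rw [sub_eq_zero] at h1
    rw [sub_eq_zero, mul_assoc, mul_assoc, ← mul_assoc (F q j), ← h1, mul_assoc]
  | serre_E i j h =>
    obtain ⟨r, hr, ha, hr3⟩ := cartan_cases h
    have hs := serre_E (q := q) h
    have hQ := generic_pow q (symm_ne_zero n i)
    rw [hr] at hs ⊢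
    refine qSerre_op hQ hr3 (c := qC q ^ ((symm n i : ℤ) * cartan n i j))
      (Kinv_mul_Kinv j i) ?_ ?_ ?_ hs
    · rw [E_mul_Kinv, qpow_self]
    · rw [E_mul_Kinv, symm_mul_cartan]
    · rw [E_mul_Kinv]
  | serre_F i j h =>
    obtain ⟨r, hr, ha, hr3⟩ := cartan_cases h
    have hs := serre_F (q := q) h
    have hQ := generic_pow q (symm_ne_zero n i)
    rw [hr] at hs ⊢
    have key := qSerre_op hQ hr3 (c := qC q ^ ((symm n i : ℤ) * cartan n i j))
      (k := K q i) (l := K q j) (x := F q i) (y := F q j)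
      (K_mul_K j i) (by rw [F_mul_K, qpow_self]) (by rw [F_mul_K, symm_mul_cartan])
      (by rw [F_mul_K]) hs
    have e : ∀ m : Idx n, op (-(F q m * K q m)) =
        (qC q ^ symm n m) ^ 2 • op (-(K q m * F q m)) := fun m => by
      rw [F_mul_K, qpow_self, ← op_smul, smul_neg]
    simp only [antipodeGen]
    rw [e i, e j, qSerre_smul, key, smul_zero]

end Uq


namespace Uq

variable {n : ℕ} {q : Set.Ioo (0 : ℝ) 1}

/-- The antipode as an algebra homomorphism to the opposite algebra. -/
def antipodeOp : Uq n q →ₐ[ℂ] (Uq n q)ᵐᵒᵖ := lift (antipodeGen q) antipodeGen_rel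

/-- The antipode. -/
def antipode : Uq n q →ₗ[ℂ] Uq n q :=
  (MulOpposite.opLinearEquiv ℂ).symm.toLinearMap ∘ₗ antipodeOp.toLinearMap

theorem antipode_apply (u : Uq n q) : antipode u = (antipodeOp u).unop := rfl

theorem antipode_mul (u v : Uq n q) : antipode (u * v) = antipode v * antipode u := by
  simp [antipode_apply]

theorem antipode_one : antipode (1 : Uq n q) = 1 := by
  simp [antipode_apply]

theorem antipode_K (i : Idx n) : antipode (K q i) = Kinv q i :=
  congrArg MulOpposite.unop (lift_gen (antipodeGen q) antipodeGen_rel (.K i))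
theorem antipode_Kinv (i : Idx n) : antipode (Kinv q i) = K q i :=
  congrArg MulOpposite.unop (lift_gen (antipodeGen q) antipodeGen_rel (.Kinv i))
theorem antipode_E (i : Idx n) : antipode (E q i) = -(Kinv q i * E q i) :=
  congrArg MulOpposite.unop (lift_gen (antipodeGen q) antipodeGen_rel (.E i))
theorem antipode_F (i : Idx n) : antipode (F q i) = -(F q i * K q i) :=
  congrArg MulOpposite.unop (lift_gen (antipodeGen q) antipodeGen_rel (.F i))

theorem antipode_left (u : Uq n q) :
    LinearMap.mul' ℂ (Uq n q) (antipode.rTensor (Uq n q) (comul u))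
      = algebraMap ℂ (Uq n q) (counit u) := by
  induction u using induction with
  | hc c => simp [Algebra.algebraMap_eq_smul_one, Algebra.TensorProduct.one_def, antipode_one]
  | hg x =>
    cases x with
    | K i =>
      change LinearMap.mul' ℂ (Uq n q) (antipode.rTensor (Uq n q) (comul (K q i)))
        = algebraMap ℂ (Uq n q) (counit (K q i))
      simp [comul_K, counit_K, antipode_K, Kinv_mul_K]
    | Kinv i =>
      change LinearMap.mul' ℂ (Uq n q) (antipode.rTensor (Uq n q) (comul (Kinv q i)))
        = algebraMap ℂ (Uq n q) (counit (Kinv q i))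
      simp [comul_Kinv, counit_Kinv, antipode_Kinv, K_mul_Kinv]
    | E i =>
      change LinearMap.mul' ℂ (Uq n q) (antipode.rTensor (Uq n q) (comul (E q i)))
        = algebraMap ℂ (Uq n q) (counit (E q i))
      simp [comul_E, counit_E, antipode_K, antipode_E]
    | F i =>
      change LinearMap.mul' ℂ (Uq n q) (antipode.rTensor (Uq n q) (comul (F q i)))
        = algebraMap ℂ (Uq n q) (counit (F q i))
      simp [comul_F, counit_F, antipode_F, antipode_one, mul_assoc, K_mul_Kinv]
  | hadd a b ha hb => simp only [map_add, ha, hb]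
  | hmul a b ha hb =>
    have key : ∀ X Y : Uq n q ⊗[ℂ] Uq n q, ∀ c : ℂ,
        LinearMap.mul' ℂ (Uq n q) (antipode.rTensor (Uq n q) X) = algebraMap ℂ (Uq n q) c →
        LinearMap.mul' ℂ (Uq n q) (antipode.rTensor (Uq n q) (X * Y)) =
          c • LinearMap.mul' ℂ (Uq n q) (antipode.rTensor (Uq n q) Y) := by
      intro X Y c hX
      have gen : ∀ (v w : Uq n q) (X : Uq n q ⊗[ℂ] Uq n q),
          LinearMap.mul' ℂ (Uq n q) (antipode.rTensor (Uq n q) (X * v ⊗ₜ w)) =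
          antipode v * LinearMap.mul' ℂ (Uq n q) (antipode.rTensor (Uq n q) X) * w := by
        intro v w X
        induction X using TensorProduct.induction_on with
        | zero => simp
        | tmul x y => simp [antipode_mul, mul_assoc]
        | add x y hx hy => simp only [add_mul, map_add, hx, hy, mul_add]
      induction Y using TensorProduct.induction_on with
      | zero => simp
      | tmul v w => rw [gen, hX]; simp [Algebra.algebraMap_eq_smul_one]
      | add x y hx hy => simp only [mul_add, map_add, hx, hy, smul_add]
    rw [map_mul, key _ _ _ ha, hb, map_mul, map_mul, Algebra.smul_def]

theorem antipode_right (u : Uq n q) :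
    LinearMap.mul' ℂ (Uq n q) (antipode.lTensor (Uq n q) (comul u))
      = algebraMap ℂ (Uq n q) (counit u) := by
  induction u using induction with
  | hc c => simp [Algebra.algebraMap_eq_smul_one, Algebra.TensorProduct.one_def, antipode_one]
  | hg x =>
    cases x with
    | K i =>
      change LinearMap.mul' ℂ (Uq n q) (antipode.lTensor (Uq n q) (comul (K q i)))
        = algebraMap ℂ (Uq n q) (counit (K q i))
      simp [comul_K, counit_K, antipode_K, K_mul_Kinv]
    | Kinv i =>
      change LinearMap.mul' ℂ (Uq n q) (antipode.lTensor (Uq n q) (comul (Kinv q i)))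
        = algebraMap ℂ (Uq n q) (counit (Kinv q i))
      simp [comul_Kinv, counit_Kinv, antipode_Kinv, Kinv_mul_K]
    | E i =>
      change LinearMap.mul' ℂ (Uq n q) (antipode.lTensor (Uq n q) (comul (E q i)))
        = algebraMap ℂ (Uq n q) (counit (E q i))
      simp [comul_E, counit_E, antipode_E, antipode_one, ← mul_assoc, K_mul_Kinv]
    | F i =>
      change LinearMap.mul' ℂ (Uq n q) (antipode.lTensor (Uq n q) (comul (F q i)))
        = algebraMap ℂ (Uq n q) (counit (F q i))
      simp [comul_F, counit_F, antipode_F, antipode_Kinv]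
  | hadd a b ha hb => simp only [map_add, ha, hb]
  | hmul a b ha hb =>
    have key : ∀ X Y : Uq n q ⊗[ℂ] Uq n q, ∀ c : ℂ,
        LinearMap.mul' ℂ (Uq n q) (antipode.lTensor (Uq n q) Y) = algebraMap ℂ (Uq n q) c →
        LinearMap.mul' ℂ (Uq n q) (antipode.lTensor (Uq n q) (X * Y)) =
          c • LinearMap.mul' ℂ (Uq n q) (antipode.lTensor (Uq n q) X) := by
      intro X Y c hY
      have gen : ∀ (v w : Uq n q) (Y : Uq n q ⊗[ℂ] Uq n q),
          LinearMap.mul' ℂ (Uq n q) (antipode.lTensor (Uq n q) (v ⊗ₜ w * Y)) =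
          v * LinearMap.mul' ℂ (Uq n q) (antipode.lTensor (Uq n q) Y) * antipode w := by
        intro v w Y
        induction Y using TensorProduct.induction_on with
        | zero => simp
        | tmul x y => simp [antipode_mul, mul_assoc]
        | add x y hx hy => simp only [add_mul, map_add, hx, hy, mul_add]
      induction X using TensorProduct.induction_on with
      | zero => simp
      | tmul v w => rw [gen, hY]; simp [Algebra.algebraMap_eq_smul_one]
      | add x y hx hy => simp only [add_mul, map_add, hx, hy, smul_add]
    rw [map_mul, key _ _ _ hb, ha, map_mul, map_mul, Algebra.smul_def, Algebra.commutes]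

instance : HopfAlgebra ℂ (Uq n q) where
  antipode := antipode
  mul_antipode_rTensor_comul := LinearMap.ext antipode_left
  mul_antipode_lTensor_comul := LinearMap.ext antipode_right

end Uq

/-! ### Module algebras -/

section ModuleAlgebra

variable {R H A : Type*} [CommRing R] [Ring H] [HopfAlgebra R H] [Ring A] [Algebra R A]

/-- The action of a Hopf algebra `H` on `A ⊗ A` that is induced by an action `ρ` of `H` on `A`:
`h` acts by `∑ ρ(h₁) ⊗ ρ(h₂)`, where `Δ(h) = ∑ h₁ ⊗ h₂`. -/
def tensorAction (ρ : H →ₐ[R] Module.End R A) (h : H) : Module.End R (A ⊗[R] A) :=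
  TensorProduct.homTensorHomMap (RingHom.id R) A A A A
    (TensorProduct.map ρ.toLinearMap ρ.toLinearMap (Coalgebra.comul (R := R) h))

/-- The `H`-module structure `ρ` on the algebra `A` makes `A` an `H`-module algebra: the
multiplication `A ⊗ A → A` is a morphism of `H`-modules and the unit of `A` is invariant. -/
structure IsModuleAlgebra (ρ : H →ₐ[R] Module.End R A) : Prop where
  mul_equivariant : ∀ h : H,
    ρ h ∘ₗ LinearMap.mul' R A = LinearMap.mul' R A ∘ₗ tensorAction ρ h
  one_invariant : ∀ h : H, ρ h 1 = Coalgebra.counit (R := R) h • (1 : A)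

end ModuleAlgebra

/-! ### The algebra `ℂ[𝔭⁻]_q` -/

/-- Names `(i, j)`, `1 ≤ j ≤ i ≤ n`, of the generators of `ℂ[𝔭⁻]_q`. -/
abbrev ZIdx (n : ℕ) : Type := {p : ℕ × ℕ // 1 ≤ p.2 ∧ p.2 ≤ p.1 ∧ p.1 ≤ n}

/-- The generator `z_{ij}` of the free algebra, for `1 ≤ j ≤ i ≤ n`. (For other indices, which
are never used, the value is `0`.) -/
def zFree (n i j : ℕ) : FreeAlgebra ℂ (ZIdx n) :=
  if h : 1 ≤ j ∧ j ≤ i ∧ i ≤ n then FreeAlgebra.ι ℂ ⟨(i, j), h⟩ else 0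

/-- The defining relations of `ℂ[𝔭⁻]_q`, in which `1 ≤ j ≤ i ≤ n` and `1 ≤ l ≤ k ≤ n`. -/
inductive ZRel (n : ℕ) (q : Set.Ioo (0 : ℝ) 1) :
    FreeAlgebra ℂ (ZIdx n) → FreeAlgebra ℂ (ZIdx n) → Prop
  | r1 (i j k l : ℕ) (hj : 1 ≤ j) (hl : 1 ≤ l) (hi : i ≤ n) (hk : k ≤ n)
      (h : i = j ∧ j = l ∧ l < k) :
      ZRel n q (zFree n i j * zFree n k l) (qC q ^ 2 • (zFree n k l * zFree n i j))
  | r2 (i j k l : ℕ) (hj : 1 ≤ j) (hl : 1 ≤ l) (hi : i ≤ n) (hk : k ≤ n)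
      (h : j < i ∧ i = k ∧ k = l) :
      ZRel n q (zFree n i j * zFree n k l) (qC q ^ 2 • (zFree n k l * zFree n i j))
  | r3 (i j k l : ℕ) (hj : 1 ≤ j) (hl : 1 ≤ l) (hi : i ≤ n) (hk : k ≤ n)
      (h : j < l ∧ l < i ∧ i = k) :
      ZRel n q (zFree n i j * zFree n k l) (qC q • (zFree n k l * zFree n i j))
  | r4 (i j k l : ℕ) (hj : 1 ≤ j) (hl : 1 ≤ l) (hi : i ≤ n) (hk : k ≤ n)
      (h : j = l ∧ l < i ∧ i < k) :
      ZRel n q (zFree n i j * zFree n k l) (qC q • (zFree n k l * zFree n i j))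
  | r5 (i j k l : ℕ) (hj : 1 ≤ j) (hl : 1 ≤ l) (hi : i ≤ n) (hk : k ≤ n)
      (h : j < l ∧ l ≤ k ∧ k < i) :
      ZRel n q (zFree n k l * zFree n i j) (zFree n i j * zFree n k l)
  | r6 (i j k l : ℕ) (hj : 1 ≤ j) (hl : 1 ≤ l) (hi : i ≤ n) (hk : k ≤ n)
      (h : i = j ∧ j < k ∧ k = l) :
      ZRel n q (zFree n i j * zFree n k l) (zFree n k l * zFree n i j
        + (qC q * (qC q ^ 2 - qC q ^ (-2 : ℤ))) • (zFree n l j * zFree n k i))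
  | r7 (i j k l : ℕ) (hj : 1 ≤ j) (hl : 1 ≤ l) (hi : i ≤ n) (hk : k ≤ n)
      (h : i = j ∧ j < l ∧ l < k) :
      ZRel n q (zFree n i j * zFree n k l) (zFree n k l * zFree n i j
        + (qC q ^ 2 - qC q ^ (-2 : ℤ)) • (zFree n l j * zFree n k i))
  | r8 (i j k l : ℕ) (hj : 1 ≤ j) (hl : 1 ≤ l) (hi : i ≤ n) (hk : k ≤ n)
      (h : j < i ∧ i < k ∧ k = l) :
      ZRel n q (zFree n i j * zFree n k l) (zFree n k l * zFree n i j
        + (qC q ^ 2 - qC q ^ (-2 : ℤ)) • (zFree n l j * zFree n k i))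
  | r9 (i j k l : ℕ) (hj : 1 ≤ j) (hl : 1 ≤ l) (hi : i ≤ n) (hk : k ≤ n)
      (h : j < i ∧ i < l ∧ l < k) :
      ZRel n q (zFree n i j * zFree n k l) (zFree n k l * zFree n i j
        + (qC q - (qC q)⁻¹) • (qC q • (zFree n l i * zFree n k j) + zFree n k i * zFree n l j))
  | r10 (i j k l : ℕ) (hj : 1 ≤ j) (hl : 1 ≤ l) (hi : i ≤ n) (hk : k ≤ n)
      (h : j < l ∧ l < i ∧ i < k) :
      ZRel n q (zFree n i j * zFree n k l) (zFree n k l * zFree n i j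
        + (qC q - (qC q)⁻¹) • (zFree n i l * zFree n k j))
  | r11 (i j k l : ℕ) (hj : 1 ≤ j) (hl : 1 ≤ l) (hi : i ≤ n) (hk : k ≤ n)
      (h : j < i ∧ i = l ∧ l < k) :
      ZRel n q (zFree n i j * zFree n k l) (qC q • (zFree n k l * zFree n i j)
        + (qC q - (qC q)⁻¹) • (zFree n i l * zFree n k j))

/-- The algebra `ℂ[𝔭⁻]_q` of holomorphic polynomials on the quantum space of symmetric
`n × n` matrices. -/
def Cp (n : ℕ) (q : Set.Ioo (0 : ℝ) 1) : Type := RingQuot (ZRel n q)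

namespace Cp

variable {n : ℕ} {q : Set.Ioo (0 : ℝ) 1}

instance : Ring (Cp n q) := inferInstanceAs (Ring (RingQuot _))
instance : Algebra ℂ (Cp n q) := inferInstanceAs (Algebra ℂ (RingQuot _))

end Cp

/-- The generator `z_{ij}` of `ℂ[𝔭⁻]_q`, for `1 ≤ j ≤ i ≤ n`. -/
def z (n : ℕ) (q : Set.Ioo (0 : ℝ) 1) (i j : ℕ) : Cp n q :=
  RingQuot.mkAlgHom ℂ (ZRel n q) (zFree n i j)

/-! ### The action on the generators -/

section Formulas

variable (n : ℕ) (q : Set.Ioo (0 : ℝ) 1)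

/-- The complex number `q^{1/2}` (the positive square root). -/
def qHalf : ℂ := ((Real.sqrt q : ℝ) : ℂ)

/-- `K_k z_{ij}` for `k < n`. -/
def actK (k i j : ℕ) : Cp n q :=
  if i = j ∧ j = k then qC q ^ 2 • z n q i j
  else if i = j ∧ j = k + 1 then qC q ^ (-2 : ℤ) • z n q i j
  else if (i = k ∧ k > j) ∨ (i - 1 > k ∧ k = j) then qC q • z n q i j
  else if (i - 1 = k ∧ k > j) ∨ (i > k + 1 ∧ k + 1 = j) then (qC q)⁻¹ • z n q i j
  else z n q i j

/-- `E_k z_{ij}` for `k < n`. -/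
def actE (k i j : ℕ) : Cp n q :=
  (qHalf q)⁻¹ •
    if i = j ∧ j = k + 1 then (qC q + (qC q)⁻¹) • z n q i (j - 1)
    else if i = k + 1 ∧ k + 1 > j then z n q (i - 1) j
    else if i > k + 1 ∧ k + 1 = j then z n q i (j - 1)
    else 0

/-- `F_k z_{ij}` for `k < n`. -/
def actF (k i j : ℕ) : Cp n q :=
  qHalf q •
    if i = j ∧ j = k then (qC q + (qC q)⁻¹) • z n q (i + 1) j
    else if i = k ∧ k > j then z n q (i + 1) j
    else if i > k ∧ k = j then z n q i (j + 1)
    else 0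

/-- `K_n z_{ij}`. -/
def actKn (i j : ℕ) : Cp n q :=
  if i = j ∧ j = n then qC q ^ 4 • z n q i j
  else if i = n ∧ n > j then qC q ^ 2 • z n q i j
  else z n q i j

/-- `F_n z_{ij}`. -/
def actFn (i j : ℕ) : Cp n q :=
  if i = j ∧ j = n then qC q • (1 : Cp n q) else 0

/-- `E_n z_{ij}`. -/
def actEn (i j : ℕ) : Cp n q :=
  -(if i = n ∧ n ≥ j then qC q • (z n q n n * z n q i j) else z n q n i * z n q n j)

end Formulas

end QSp

end

/-! Uniqueness is formal. In a module algebra `K_k` acts by an algebra endomorphism, `K_k⁻¹` by its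
inverse, and `E_k`, `F_k` by skew derivations twisted by these. All of them are determined by their
values on the generators `z_{ij}`. Existence needs two things: the prescribed values must extend to
`ℂ[𝔭⁻]_q`, and the resulting operators must satisfy the relations of `U_q sp_{2n}`.

Extension. Put `z_{ji} = q z_{ij}` for `j < i`. Then `z_{ab}` is the image of `x_a ⊗ x_b` in the
quantum symmetric square of the vector representation `V`. If `B_i` is the Hecke braiding of the
tensor positions `i` and `i + 1`, the defining relations are equivalent to `(B₃ + q⁻¹) (B₁ - q) B₂
(z ⊗ z) = 0` (`IsQSymm.of_quad`, `IsQSymm.quad`). A skew derivation `D (u v) = α(u) D(v) + D(u)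
β(v)` amounts to a homomorphism into upper triangular `2 × 2` matrices with diagonal `(α, β)`, so it
exists once a family of such matrices satisfies the relations. For `E_k` and `F_k` with `k < n` this
follows because the braiding commutes with the coproducts of the operators on `V`
(`IsQSymm.skewMat_left`, `IsQSymm.skewMat_right`). For `F_n` the relations are checked one by one
(`IsQSymm.skewMat_top`). For `E_n` nothing has to be extended: it is the inner skew derivation `u ↦
(z_{nn} u - K_n(u) z_{nn}) / (q (q² - q⁻²))`.

Relations. The commutator of `E_i` and `F_j`, and the Serre expressions, are again skew derivations,
because the mixed terms cancel (`IsSkewL.commutator`, `IsSkewL.qSerre`, `IsSkewR.qSerre`). So it is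
enough to test them on the `z_{ab}`. For `i, j < n` the same product rule, applied to the pairing
`x_a ⊗ x_b ↦ z_{ab}`, moves the test to `V`, where `E_i` and `F_i` are multiples of matrix units.
The Serre relations with `F_n` hold because `F_n` sends every `z_{ab}` to a scalar. The relations
with `E_n` come from its inner form: it is a difference of a left and a twisted right multiplication
by `z_{nn}`, and the Serre relations express that `z_{nn}`, `E_{n-1} z_{nn}`, `E_{n-1}² z_{nn}` is a
string ending in `0`, and that its first two members `q`-commute (`qSerre_three_string`,
`qSerre_two_string`). -/

noncomputable section

set_option linter.unusedSimpArgs false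

namespace QSp

/-! ### Quantum symmetric families -/

section Quadratic

variable {B : Type*} [Ring B] [Algebra ℂ B]

/-- The defining relations of `ℂ[𝔭⁻]_q` for a family that is indexed by all pairs of natural
numbers and is `q`-symmetric. -/
structure IsQSymm (Q : ℂ) (Z : ℕ → ℕ → B) : Prop where
  symm : ∀ {i j}, j < i → Z j i = Q • Z i j
  r1 : ∀ {i k}, i < k → Z i i * Z k i = Q ^ 2 • (Z k i * Z i i)
  r2 : ∀ {i j}, j < i → Z i j * Z i i = Q ^ 2 • (Z i i * Z i j)
  r3 : ∀ {i j l}, j < l → l < i → Z i j * Z i l = Q • (Z i l * Z i j)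
  r4 : ∀ {i j k}, j < i → i < k → Z i j * Z k j = Q • (Z k j * Z i j)
  r5 : ∀ {i j k l}, j < l → l ≤ k → k < i → Z k l * Z i j = Z i j * Z k l
  r6 : ∀ {i k}, i < k → Z i i * Z k k = Z k k * Z i i
    + (Q * (Q ^ 2 - Q⁻¹ ^ 2)) • (Z k i * Z k i)
  r7 : ∀ {i k l}, i < l → l < k → Z i i * Z k l = Z k l * Z i i
    + (Q ^ 2 - Q⁻¹ ^ 2) • (Z l i * Z k i)
  r8 : ∀ {i j k}, j < i → i < k → Z i j * Z k k = Z k k * Z i j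
    + (Q ^ 2 - Q⁻¹ ^ 2) • (Z k j * Z k i)
  r9 : ∀ {i j k l}, j < i → i < l → l < k → Z i j * Z k l = Z k l * Z i j
    + (Q - Q⁻¹) • (Q • (Z l i * Z k j) + Z k i * Z l j)
  r10 : ∀ {i j k l}, j < l → l < i → i < k → Z i j * Z k l = Z k l * Z i j
    + (Q - Q⁻¹) • (Z i l * Z k j)
  r11 : ∀ {i j k}, j < i → i < k → Z i j * Z k i = Q • (Z k i * Z i j)
    + (Q - Q⁻¹) • (Z i i * Z k j)

variable {M : Type*} [AddCommGroup M] [Module ℂ M]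

/-- The Hecke braiding, acting on families indexed by two natural numbers. -/
def braid (Q : ℂ) (f : ℕ → ℕ → M) (a b : ℕ) : M :=
  if a = b then Q • f a b else if a < b then f b a + (Q - Q⁻¹) • f a b else f b a

theorem braid_self (Q : ℂ) (f : ℕ → ℕ → M) (a : ℕ) : braid Q f a a = Q • f a a := if_pos rfl

theorem braid_lt (Q : ℂ) (f : ℕ → ℕ → M) {a b : ℕ} (h : a < b) :
    braid Q f a b = f b a + (Q - Q⁻¹) • f a b := by
  rw [braid, if_neg h.ne, if_pos h]

theorem braid_gt (Q : ℂ) (f : ℕ → ℕ → M) {a b : ℕ} (h : b < a) : braid Q f a b = f b a := by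
  rw [braid, if_neg h.ne', if_neg h.not_gt]

/-- The braiding of the first two indices. -/
def braid₁ (Q : ℂ) (f : ℕ → ℕ → ℕ → ℕ → M) (a b c d : ℕ) : M :=
  braid Q (fun a b => f a b c d) a b

/-- The braiding of the two indices in the middle. -/
def braid₂ (Q : ℂ) (f : ℕ → ℕ → ℕ → ℕ → M) (a b c d : ℕ) : M :=
  braid Q (fun b c => f a b c d) b c

/-- The braiding of the last two indices. -/
def braid₃ (Q : ℂ) (f : ℕ → ℕ → ℕ → ℕ → M) (a b c d : ℕ) : M :=
  braid Q (fun c d => f a b c d) c d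

/-- The braided form of the quadratic relations. -/
def quad (Q : ℂ) (f : ℕ → ℕ → ℕ → ℕ → M) : ℕ → ℕ → ℕ → ℕ → M :=
  -- The braiding satisfies `(B - Q) (B + Q⁻¹) = 0`. Hence `B₁ - Q` extracts the antisymmetric part
  -- in the first two indices and `B₃ + Q⁻¹` the symmetric part in the last two; the relations say
  -- that this component of `B₂ (Z ⊗ Z)` is zero.
  let w := braid₁ Q (braid₂ Q f) - Q • braid₂ Q f
  braid₃ Q w + Q⁻¹ • w

/-- The products of two members of a family. -/
def prodFam (Z : ℕ → ℕ → B) (a b c d : ℕ) : B := Z a b * Z c d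

/-- By the Hecke relation, exchanging `a < b` multiplies the value of `quad` by `-Q`, exchanging `c
< d` multiplies it by `Q⁻¹`, and the values with `a = b` vanish. So ordered indices suffice. -/
theorem quad_eq_zero {Q : ℂ} (hQ : Q ≠ 0) {f : ℕ → ℕ → ℕ → ℕ → M}
    (h : ∀ a b c d, a < b → c ≤ d → quad Q f a b c d = 0) : quad Q f = 0 := by
  have h' : ∀ a b c d, a < b → quad Q f a b c d = 0 := by
    intro a b c d hab
    rcases le_or_gt c d with hcd | hcd
    · exact h a b c d hab hcd
    · have := h a b d c hab hcd.le
      simp only [quad, Pi.add_apply, Pi.smul_apply, braid₃, braid_lt _ _ hcd, braid_gt _ _ hcd]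
        at this ⊢
      rw [← smul_zero Q⁻¹, ← this]
      match_scalars <;> field_simp <;> ring
  funext a b c d
  rcases lt_trichotomy a b with hab | rfl | hab
  · exact h' a b c d hab
  · simp [quad, braid₃, braid₁, braid, Pi.add_apply]
  · have := h' b a c d hab
    simp only [quad, Pi.add_apply, Pi.sub_apply, Pi.smul_apply, braid₃, braid₁, braid_lt _ _ hab,
      braid_gt _ _ hab] at this ⊢
    rw [Pi.zero_apply, Pi.zero_apply, Pi.zero_apply, Pi.zero_apply, ← smul_zero (-Q), ← this]
    rcases lt_trichotomy c d with hcd | rfl | hcd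
    · simp only [braid_lt _ _ hcd]
      match_scalars <;> field_simp <;> ring
    · simp only [braid_self]
      match_scalars <;> field_simp <;> ring
    · simp only [braid_gt _ _ hcd]
      match_scalars <;> field_simp <;> ring

theorem quad_lt_lt (Q : ℂ) (f : ℕ → ℕ → ℕ → ℕ → M) {a b c d : ℕ} (hab : a < b) (hcd : c < d) :
    quad Q f a b c d = (braid₂ Q f b a d c + (Q - Q⁻¹ - Q) • braid₂ Q f a b d c)
      + Q • (braid₂ Q f b a c d + (Q - Q⁻¹ - Q) • braid₂ Q f a b c d) := by
  simp only [quad, Pi.add_apply, Pi.sub_apply, Pi.smul_apply, braid₃, braid₁, braid_lt _ _ hab,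
      braid_lt _ _ hcd]
  module

/-- On equal indices the symmetrizer is the scalar `Q + Q⁻¹`, which can be cancelled for generic
`Q`. -/
theorem quad_lt_self {Q : ℂ} (f : ℕ → ℕ → ℕ → ℕ → M) {a b c : ℕ} (hab : a < b) :
    quad Q f a b c c = (Q + Q⁻¹) • (braid₂ Q f b a c c + (Q - Q⁻¹ - Q) • braid₂ Q f a b c c) := by
  simp only [quad, Pi.add_apply, Pi.sub_apply, Pi.smul_apply, braid₃, braid₁, braid_lt _ _ hab,
      braid_self]
  module

/-- Each relation is either one value of `quad` or obtained from two of them by elimination. The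
order of derivation matters, since the later relations use the earlier ones to reorder products. -/
theorem IsQSymm.of_quad {Q : ℂ} (hQ : Generic Q) {Z : ℕ → ℕ → B}
    (hs : ∀ {i j}, j < i → Z j i = Q • Z i j) (h : quad Q (prodFam Z) = 0) : IsQSymm Q Z := by
  have h0 := hQ.ne_zero
  have h2 := hQ.h2
  have h2' : Q ^ 2 + 1 ≠ 0 := by
    intro e
    apply h2
    field_simp
    simpa using e
  have e1 : ∀ {a b c d : ℕ}, a < b → c < d →
      (braid₂ Q (prodFam Z) b a d c + (Q - Q⁻¹ - Q) • braid₂ Q (prodFam Z) a b d c)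
      + Q • (braid₂ Q (prodFam Z) b a c d + (Q - Q⁻¹ - Q) • braid₂ Q (prodFam Z) a b c d) = 0 :=
    fun hab hcd => by rw [← quad_lt_lt Q _ hab hcd, h]; rfl
  have e2 : ∀ {a b c : ℕ}, a < b →
      braid₂ Q (prodFam Z) b a c c + (Q - Q⁻¹ - Q) • braid₂ Q (prodFam Z) a b c c = 0 :=
    fun {a b c} hab => by
      have := quad_lt_self (Q := Q) (prodFam Z) (c := c) hab
      rw [h] at this
      exact (smul_eq_zero.1 this.symm).resolve_left h2
  have q1 : ∀ {i k}, i < k → Z i i * Z k i = Q ^ 2 • (Z k i * Z i i) := fun {i k} h => by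
    have := e2 (c := i) h
    simp (disch := omega) only [braid₂, prodFam, braid_self, braid_lt, braid_gt, hs, smul_mul_assoc,
      mul_smul_comm] at this
    linear_combination (norm := (match_scalars <;> field_simp <;> ring)) (-Q) • this
  have q2 : ∀ {i j}, j < i → Z i j * Z i i = Q ^ 2 • (Z i i * Z i j) := fun {i j} h => by
    have := e2 (c := i) h
    simp (disch := omega) only [braid₂, prodFam, braid_self, braid_lt, braid_gt, hs, smul_mul_assoc,
      mul_smul_comm] at this
    linear_combination (norm := (match_scalars <;> field_simp <;> ring)) (-Q) • this
  have q3 : ∀ {i j l}, j < l → l < i → Z i j * Z i l = Q • (Z i l * Z i j) := fun {i j l} h h' => by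
    have := e2 (c := i) h
    simp (disch := omega) only [braid₂, prodFam, braid_self, braid_lt, braid_gt, hs, smul_mul_assoc,
      mul_smul_comm] at this
    linear_combination (norm := (match_scalars <;> field_simp <;> ring)) (-Q⁻¹) • this
  have q4 : ∀ {i j k}, j < i → i < k → Z i j * Z k j = Q • (Z k j * Z i j) := fun {i j k} h h' => by
    have := e2 (c := j) h'
    simp (disch := omega) only [braid₂, prodFam, braid_self, braid_lt, braid_gt, hs, smul_mul_assoc,
      mul_smul_comm] at this
    linear_combination (norm := (match_scalars <;> field_simp <;> ring)) (-Q) • this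
  have q6 : ∀ {i k}, i < k → Z i i * Z k k = Z k k * Z i i
      + (Q * (Q ^ 2 - Q⁻¹ ^ 2)) • (Z k i * Z k i) := fun {i k} h => by
    have := e1 h h
    simp (disch := omega) only [braid₂, prodFam, braid_self, braid_lt, braid_gt, hs, smul_mul_assoc,
      mul_smul_comm] at this
    linear_combination (norm := (match_scalars <;> field_simp <;> ring)) (-1 : ℂ) • this
  have q7 : ∀ {i k l}, i < l → l < k → Z i i * Z k l = Z k l * Z i i
      + (Q ^ 2 - Q⁻¹ ^ 2) • (Z l i * Z k i) := fun {i k l} h h' => by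
    have := e1 h (h.trans h')
    have h4 := q4 h h'
    simp (disch := omega) only [braid₂, prodFam, braid_self, braid_lt, braid_gt, hs, smul_mul_assoc,
      mul_smul_comm] at this
    linear_combination (norm := (match_scalars <;> field_simp <;> ring))
      (-Q⁻¹) • this + Q⁻¹ ^ 2 • h4
  have q8 : ∀ {i j k}, j < i → i < k → Z i j * Z k k = Z k k * Z i j
      + (Q ^ 2 - Q⁻¹ ^ 2) • (Z k j * Z k i) := fun {i j k} h h' => by
    have := e1 h' (h.trans h')
    have h4 := q3 h h'
    simp (disch := omega) only [braid₂, prodFam, braid_self, braid_lt, braid_gt, hs, smul_mul_assoc,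
      mul_smul_comm] at this
    linear_combination (norm := (match_scalars <;> field_simp <;> ring))
      (-1 : ℂ) • this + Q⁻¹ ^ 2 • h4
  have q5s : ∀ {i j k}, j < k → k < i → Z k k * Z i j = Z i j * Z k k := fun {i j k} h h' => by
    -- The indices `(j, k, k, i)` and `(k, i, j, k)` give two equations in the same four products.
    -- Eliminating the products of `Z k j` and `Z i k` leaves `Q ^ 2 + 1` times a commutator, which
    -- is why `Q ^ 2 + 1 ≠ 0` is needed. The case `l < k` below works in the same way.
    have A := e1 h h'
    have C := e1 h' h
    simp (disch := omega) only [braid₂, prodFam, braid_self, braid_lt, braid_gt, hs, smul_mul_assoc,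
      mul_smul_comm] at A C
    linear_combination (norm := (match_scalars <;> field_simp <;> ring))
      (Q ^ 2 + 1)⁻¹ • (A - Q • C)
  have q11 : ∀ {i j k}, j < i → i < k → Z i j * Z k i = Q • (Z k i * Z i j)
      + (Q - Q⁻¹) • (Z i i * Z k j) := fun {i j k} h h' => by
    have C := e1 h' h
    have h5 := q5s h h'
    simp (disch := omega) only [braid₂, prodFam, braid_self, braid_lt, braid_gt, hs, smul_mul_assoc,
      mul_smul_comm] at C
    linear_combination (norm := (match_scalars <;> field_simp <;> ring))
      (-1 : ℂ) • C - Q • h5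
  have q5 : ∀ {i j k l}, j < l → l < k → k < i → Z k l * Z i j = Z i j * Z k l :=
      fun {i j k l} h h' h'' => by
    have A := e1 h h''
    have D := e1 h'' h
    simp (disch := omega) only [braid₂, prodFam, braid_self, braid_lt, braid_gt, hs, smul_mul_assoc,
      mul_smul_comm] at A D
    linear_combination (norm := (match_scalars <;> field_simp <;> ring))
      (Q * (Q ^ 2 + 1))⁻¹ • (A - Q ^ 2 • D)
  have q10 : ∀ {i j k l}, j < l → l < i → i < k → Z i j * Z k l = Z k l * Z i j
      + (Q - Q⁻¹) • (Z i l * Z k j) := fun {i j k l} h h' h'' => by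
    have D := e1 h'' h
    have h5 := q5 h h' h''
    simp (disch := omega) only [braid₂, prodFam, braid_self, braid_lt, braid_gt, hs, smul_mul_assoc,
      mul_smul_comm] at D
    linear_combination (norm := (match_scalars <;> field_simp <;> ring))
      (-1 : ℂ) • D - Q • h5
  have q9 : ∀ {i j k l}, j < i → i < l → l < k → Z i j * Z k l = Z k l * Z i j
      + (Q - Q⁻¹) • (Q • (Z l i * Z k j) + Z k i * Z l j) := fun {i j k l} h h' h'' => by
    have C := e1 h' (h.trans (h'.trans h''))
    have h10 := q10 h h' h''
    simp (disch := omega) only [braid₂, prodFam, braid_self, braid_lt, braid_gt, hs, smul_mul_assoc,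
      mul_smul_comm] at C
    linear_combination (norm := (match_scalars <;> field_simp <;> ring))
      (-Q⁻¹) • C + Q • h10
  exact ⟨hs, q1, q2, q3, q4, fun h h' h'' => h'.lt_or_eq.elim (fun h' => q5 h h' h'')
    (by rintro rfl; exact q5s h h''), q6, q7, q8, q9, q10, q11⟩

/-- In each possible relative order of `a, b, c, d` the relations bring all products to a normal
order, and the coefficients then cancel. -/
theorem IsQSymm.quad {Q : ℂ} (hQ : Generic Q) {Z : ℕ → ℕ → B} (hZ : IsQSymm Q Z) :
    quad Q (prodFam Z) = 0 := by
  have h0 := hQ.ne_zero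
  -- the scalar keeps `simp` from treating the relation as a permutation
  have r5 : ∀ {i j k l}, j < l → l ≤ k → k < i → Z k l * Z i j = (1 : ℂ) • (Z i j * Z k l) :=
    fun h h' h'' => by rw [one_smul, hZ.r5 h h' h'']
  refine quad_eq_zero h0 fun a b c d hab hcd => ?_
  rcases hcd.lt_or_eq with hcd | rfl
  · rw [quad_lt_lt _ _ hab hcd]
    rcases lt_trichotomy a c with h1 | h1 | h1 <;> rcases lt_trichotomy b d with h2 | h2 | h2 <;>
    rcases lt_trichotomy a d with h3 | h3 | h3 <;> rcases lt_trichotomy b c with h4 | h4 | h4 <;>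
    first
    | (exfalso; omega)
    | (subst_vars
       simp (disch := omega) only [braid₂, prodFam, braid_self, braid_lt, braid_gt, hZ.symm,
        smul_mul_assoc, mul_smul_comm, hZ.r1, hZ.r2, hZ.r3, hZ.r4, r5, hZ.r6, hZ.r7, hZ.r8,
        hZ.r9, hZ.r10, hZ.r11]
       match_scalars <;> field_simp <;> ring)
  · rw [quad_lt_self _ hab]
    rcases lt_trichotomy a c with h1 | h1 | h1 <;> rcases lt_trichotomy b c with h2 | h2 | h2 <;>
    first
    | (exfalso; omega)
    | (subst_vars
       simp (disch := omega) only [braid₂, prodFam, braid_self, braid_lt, braid_gt, hZ.symm,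
        smul_mul_assoc, mul_smul_comm, hZ.r1, hZ.r2, hZ.r3, hZ.r4, r5, hZ.r6, hZ.r7, hZ.r8,
        hZ.r9, hZ.r10, hZ.r11]
       match_scalars <;> field_simp <;> ring)

end Quadratic

/-! ### Coproducts of lowering and raising operators -/

section Shift

variable {M : Type*} [AddCommGroup M] [Module ℂ M]

/-- The action of `x ⊗ 1 + κ ⊗ x` on families indexed by two natural numbers, where `x` sends the
index `s` to `t` and kills the others. -/
def shiftL (s t : ℕ) (κ : ℕ → ℂ) (f : ℕ → ℕ → M) (a b : ℕ) : M :=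
  (if a = s then f t b else 0) + κ a • (if b = s then f a t else 0)

/-- The action of `x ⊗ κ + 1 ⊗ x` on families indexed by two natural numbers, where `x` sends the
index `s` to `t` and kills the others. -/
def shiftR (s t : ℕ) (κ : ℕ → ℂ) (f : ℕ → ℕ → M) (a b : ℕ) : M :=
  κ b • (if a = s then f t b else 0) + (if b = s then f a t else 0)

/-- The analogue of `shiftL` for four indices. -/
def shiftL₄ (s t : ℕ) (κ : ℕ → ℂ) (f : ℕ → ℕ → ℕ → ℕ → M) (a b c d : ℕ) : M :=
  shiftL s t κ (fun a b => f a b c d) a b + (κ a * κ b) • shiftL s t κ (fun c d => f a b c d) c d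

/-- The analogue of `shiftR` for four indices. -/
def shiftR₄ (s t : ℕ) (κ : ℕ → ℂ) (f : ℕ → ℕ → ℕ → ℕ → M) (a b c d : ℕ) : M :=
  (κ c * κ d) • shiftR s t κ (fun a b => f a b c d) a b + shiftR s t κ (fun c d => f a b c d) c d

/-- `κ` consists of the eigenvalues of `K_k` on the vector representation, where the shift moves
`s` to `t`. -/
structure IsWeight (Q : ℂ) (s t : ℕ) (κ : ℕ → ℂ) : Prop where
  source : κ s = Q⁻¹
  target : κ t = Q
  other : ∀ a, a ≠ s → a ≠ t → κ a = 1

/-- This is the statement that the `R`-matrix commutes with the coproduct of a generator. As `s` and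
`t` are neighbours, any third index lies on the same side of both, so the order of the indices is
respected and finitely many cases remain. -/
theorem braid_shiftL {Q : ℂ} (hQ : Q ≠ 0) {s t : ℕ} {κ : ℕ → ℂ} (hκ : IsWeight Q s t κ)
    (hst : s = t + 1) (f : ℕ → ℕ → M) : braid Q (shiftL s t κ f) = shiftL s t κ (braid Q f) := by
  funext a b
  by_cases a1 : a = s <;> by_cases a2 : a = t <;> by_cases b1 : b = s <;> by_cases b2 : b = t <;>
  rcases lt_trichotomy a b with h | h | h <;>
  first
  | (exfalso; omega)
  | (subst_vars
     simp (disch := omega) only [shiftL, if_pos, if_neg, if_true, if_false, braid_self, braid_lt, braid_gt, hκ.source,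
       hκ.target, hκ.other]
     all_goals (match_scalars <;> field_simp <;> ring))

theorem braid_shiftR {Q : ℂ} (hQ : Q ≠ 0) {s t : ℕ} {κ : ℕ → ℂ} (hκ : IsWeight Q s t κ)
    (hst : t = s + 1) (f : ℕ → ℕ → M) : braid Q (shiftR s t κ f) = shiftR s t κ (braid Q f) := by
  funext a b
  by_cases a1 : a = s <;> by_cases a2 : a = t <;> by_cases b1 : b = s <;> by_cases b2 : b = t <;>
  rcases lt_trichotomy a b with h | h | h <;>
  first
  | (exfalso; omega)
  | (subst_vars
     simp (disch := omega) only [shiftR, if_pos, if_neg, if_true, if_false, braid_self, braid_lt, braid_gt, hκ.source,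
       hκ.target, hκ.other]
     all_goals (match_scalars <;> field_simp <;> ring))

theorem braid_smul_of_symm (Q : ℂ) {w : ℕ → ℕ → ℂ} (hw : ∀ a b, w a b = w b a) (f : ℕ → ℕ → M) :
    braid Q (fun a b => w a b • f a b) = fun a b => w a b • braid Q f a b := by
  funext a b
  simp only [braid, hw b a]
  split_ifs <;> module

theorem braid_map {N : Type*} [AddCommGroup N] [Module ℂ N] (Q : ℂ) (φ : M →ₗ[ℂ] N)
    (f : ℕ → ℕ → M) : braid Q (fun a b => φ (f a b)) = fun a b => φ (braid Q f a b) := by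
  funext a b
  simp only [braid]
  split_ifs <;> simp

section L

variable {Q : ℂ} {s t : ℕ} {κ : ℕ → ℂ}

/-- The shifts of `a` and `b` are the case of two indices. Those of `c` and `d` carry the factor `κ
a * κ b`, which is symmetric in the braided indices. -/
theorem braid₁_shiftL₄ (h : ∀ f : ℕ → ℕ → M, braid Q (shiftL s t κ f) = shiftL s t κ (braid Q f))
    (f : ℕ → ℕ → ℕ → ℕ → M) : braid₁ Q (shiftL₄ s t κ f) = shiftL₄ s t κ (braid₁ Q f) := by
  funext a b c d
  have e := congrFun (congrFun (h (fun a b => f a b c d)) a) b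
  by_cases hc : c = s <;> by_cases hd : d = s <;> rcases lt_trichotomy a b with h | h | h <;>
    (try subst h) <;>
    simp (disch := omega) only [braid₁, shiftL₄, shiftL, braid_self, braid_lt, braid_gt, hc, hd, if_true, if_false] at e ⊢ <;>
    linear_combination (norm := module) e

theorem braid₃_shiftL₄ (h : ∀ f : ℕ → ℕ → M, braid Q (shiftL s t κ f) = shiftL s t κ (braid Q f))
    (f : ℕ → ℕ → ℕ → ℕ → M) : braid₃ Q (shiftL₄ s t κ f) = shiftL₄ s t κ (braid₃ Q f) := by
  funext a b c d
  have e := congrArg (((κ a * κ b)) • ·) (congrFun (congrFun (h (fun c d => f a b c d)) c) d)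
  by_cases ha : a = s <;> by_cases hb : b = s <;> rcases lt_trichotomy c d with h | h | h <;>
    (try subst h) <;>
    simp (disch := omega) only [braid₃, shiftL₄, shiftL, braid_self, braid_lt, braid_gt, ha, hb, if_true, if_false] at e ⊢ <;>
    linear_combination (norm := module) e

/-- The shift of `a` has no factor, and that of `d` has the factor `κ a * κ b * κ c`, symmetric in
`b` and `c`. The shifts of `b` and `c` together are `κ a` times the case of two indices. -/
theorem braid₂_shiftL₄ (h : ∀ f : ℕ → ℕ → M, braid Q (shiftL s t κ f) = shiftL s t κ (braid Q f))
    (f : ℕ → ℕ → ℕ → ℕ → M) : braid₂ Q (shiftL₄ s t κ f) = shiftL₄ s t κ (braid₂ Q f) := by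
  funext a b c d
  have e := congrArg ((κ a) • ·) (congrFun (congrFun (h (fun b c => f a b c d)) b) c)
  by_cases ha : a = s <;> by_cases hd : d = s <;> rcases lt_trichotomy b c with h | h | h <;>
    (try subst h) <;>
    simp (disch := omega) only [braid₂, shiftL₄, shiftL, braid_self, braid_lt, braid_gt, ha, hd, if_true, if_false] at e ⊢ <;>
    linear_combination (norm := module) e

theorem quad_shiftL₄ (h : ∀ f : ℕ → ℕ → M, braid Q (shiftL s t κ f) = shiftL s t κ (braid Q f))
    (f : ℕ → ℕ → ℕ → ℕ → M) : quad Q (shiftL₄ s t κ f) = shiftL₄ s t κ (quad Q f) := by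
  have lin : ∀ (c : ℂ) (f g : ℕ → ℕ → ℕ → ℕ → M),
      shiftL₄ s t κ (f + c • g) = shiftL₄ s t κ f + c • shiftL₄ s t κ g := by
    intro c f g
    funext a b c d
    simp only [shiftL₄, shiftL, Pi.add_apply, Pi.smul_apply]
    split_ifs <;> module
  simp only [quad, sub_eq_add_neg, ← neg_smul, braid₂_shiftL₄ h, braid₁_shiftL₄ h, ← lin,
    braid₃_shiftL₄ h]

end L

section R

variable {Q : ℂ} {s t : ℕ} {κ : ℕ → ℂ}

theorem braid₁_shiftR₄ (h : ∀ f : ℕ → ℕ → M, braid Q (shiftR s t κ f) = shiftR s t κ (braid Q f))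
    (f : ℕ → ℕ → ℕ → ℕ → M) : braid₁ Q (shiftR₄ s t κ f) = shiftR₄ s t κ (braid₁ Q f) := by
  funext a b c d
  have e := congrArg (((κ c * κ d)) • ·) (congrFun (congrFun (h (fun a b => f a b c d)) a) b)
  by_cases hc : c = s <;> by_cases hd : d = s <;> rcases lt_trichotomy a b with h | h | h <;>
    (try subst h) <;>
    simp (disch := omega) only [braid₁, shiftR₄, shiftR, braid_self, braid_lt, braid_gt, hc, hd, if_true, if_false] at e ⊢ <;>
    linear_combination (norm := module) e

theorem braid₃_shiftR₄ (h : ∀ f : ℕ → ℕ → M, braid Q (shiftR s t κ f) = shiftR s t κ (braid Q f))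
    (f : ℕ → ℕ → ℕ → ℕ → M) : braid₃ Q (shiftR₄ s t κ f) = shiftR₄ s t κ (braid₃ Q f) := by
  funext a b c d
  have e := congrFun (congrFun (h (fun c d => f a b c d)) c) d
  by_cases ha : a = s <;> by_cases hb : b = s <;> rcases lt_trichotomy c d with h | h | h <;>
    (try subst h) <;>
    simp (disch := omega) only [braid₃, shiftR₄, shiftR, braid_self, braid_lt, braid_gt, ha, hb, if_true, if_false] at e ⊢ <;>
    linear_combination (norm := module) e

theorem braid₂_shiftR₄ (h : ∀ f : ℕ → ℕ → M, braid Q (shiftR s t κ f) = shiftR s t κ (braid Q f))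
    (f : ℕ → ℕ → ℕ → ℕ → M) : braid₂ Q (shiftR₄ s t κ f) = shiftR₄ s t κ (braid₂ Q f) := by
  funext a b c d
  have e := congrArg ((κ d) • ·) (congrFun (congrFun (h (fun b c => f a b c d)) b) c)
  by_cases ha : a = s <;> by_cases hd : d = s <;> rcases lt_trichotomy b c with h | h | h <;>
    (try subst h) <;>
    simp (disch := omega) only [braid₂, shiftR₄, shiftR, braid_self, braid_lt, braid_gt, ha, hd, if_true, if_false] at e ⊢ <;>
    linear_combination (norm := module) e

theorem quad_shiftR₄ (h : ∀ f : ℕ → ℕ → M, braid Q (shiftR s t κ f) = shiftR s t κ (braid Q f))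
    (f : ℕ → ℕ → ℕ → ℕ → M) : quad Q (shiftR₄ s t κ f) = shiftR₄ s t κ (quad Q f) := by
  have lin : ∀ (c : ℂ) (f g : ℕ → ℕ → ℕ → ℕ → M),
      shiftR₄ s t κ (f + c • g) = shiftR₄ s t κ f + c • shiftR₄ s t κ g := by
    intro c f g
    funext a b c d
    simp only [shiftR₄, shiftR, Pi.add_apply, Pi.smul_apply]
    split_ifs <;> module
  simp only [quad, sub_eq_add_neg, ← neg_smul, braid₂_shiftR₄ h, braid₁_shiftR₄ h, ← lin,
    braid₃_shiftR₄ h]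

end R

/-- The weight of a monomial is symmetric in its four indices, so it passes through each of the
three braidings. -/
theorem quad_weight (Q : ℂ) (κ : ℕ → ℂ) (f : ℕ → ℕ → ℕ → ℕ → M) :
    quad Q (fun a b c d => (κ a * κ b * (κ c * κ d)) • f a b c d)
      = fun a b c d => (κ a * κ b * (κ c * κ d)) • quad Q f a b c d := by
  have h1 : ∀ f : ℕ → ℕ → ℕ → ℕ → M, braid₁ Q (fun a b c d => (κ a * κ b * (κ c * κ d)) • f a b c d)
      = fun a b c d => (κ a * κ b * (κ c * κ d)) • braid₁ Q f a b c d := fun f => by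
    funext a b c d
    exact congrFun (congrFun (braid_smul_of_symm Q (w := fun a b => κ a * κ b * (κ c * κ d))
      (fun a b => by ring) _) a) b
  have h2 : ∀ f : ℕ → ℕ → ℕ → ℕ → M, braid₂ Q (fun a b c d => (κ a * κ b * (κ c * κ d)) • f a b c d)
      = fun a b c d => (κ a * κ b * (κ c * κ d)) • braid₂ Q f a b c d := fun f => by
    funext a b c d
    exact congrFun (congrFun (braid_smul_of_symm Q (w := fun b c => κ a * κ b * (κ c * κ d))
      (fun a b => by ring) _) b) c
  have h3 : ∀ f : ℕ → ℕ → ℕ → ℕ → M, braid₃ Q (fun a b c d => (κ a * κ b * (κ c * κ d)) • f a b c d)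
      = fun a b c d => (κ a * κ b * (κ c * κ d)) • braid₃ Q f a b c d := fun f => by
    funext a b c d
    exact congrFun (congrFun (braid_smul_of_symm Q (w := fun c d => κ a * κ b * (κ c * κ d))
      (fun a b => by ring) _) c) d
  have lin : ∀ (r : ℂ) (f g : ℕ → ℕ → ℕ → ℕ → M),
      (fun a b c d => (κ a * κ b * (κ c * κ d)) • f a b c d) +
        r • (fun a b c d => (κ a * κ b * (κ c * κ d)) • g a b c d) =
      fun a b c d => (κ a * κ b * (κ c * κ d)) • (f + r • g) a b c d := by
    intro r f g
    funext a b c d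
    simp only [Pi.add_apply, Pi.smul_apply]
    module
  simp only [quad, sub_eq_add_neg, ← neg_smul, h2, h1, lin, h3]

theorem quad_map {N : Type*} [AddCommGroup N] [Module ℂ N] (Q : ℂ) (φ : M →ₗ[ℂ] N)
    (f : ℕ → ℕ → ℕ → ℕ → M) :
    quad Q (fun a b c d => φ (f a b c d)) = fun a b c d => φ (quad Q f a b c d) := by
  have h1 : ∀ f : ℕ → ℕ → ℕ → ℕ → M, braid₁ Q (fun a b c d => φ (f a b c d))
      = fun a b c d => φ (braid₁ Q f a b c d) := fun f => by
    funext a b c d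
    exact congrFun (congrFun (braid_map Q φ _) a) b
  have h2 : ∀ f : ℕ → ℕ → ℕ → ℕ → M, braid₂ Q (fun a b c d => φ (f a b c d))
      = fun a b c d => φ (braid₂ Q f a b c d) := fun f => by
    funext a b c d
    exact congrFun (congrFun (braid_map Q φ _) b) c
  have h3 : ∀ f : ℕ → ℕ → ℕ → ℕ → M, braid₃ Q (fun a b c d => φ (f a b c d))
      = fun a b c d => φ (braid₃ Q f a b c d) := fun f => by
    funext a b c d
    exact congrFun (congrFun (braid_map Q φ _) c) d
  have lin : ∀ (r : ℂ) (f g : ℕ → ℕ → ℕ → ℕ → M),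
      (fun a b c d => φ (f a b c d)) + r • (fun a b c d => φ (g a b c d)) =
      fun a b c d => φ ((f + r • g) a b c d) := by
    intro r f g
    funext a b c d
    simp
  simp only [quad, sub_eq_add_neg, ← neg_smul, h2, h1, lin, h3]

end Shift

theorem generic_qC (q : Set.Ioo (0 : ℝ) 1) : Generic (qC q) := by
  simpa using generic_pow q one_ne_zero

/-! ### Skew derivations as families of triangular matrices -/

section Quadratic

variable {B : Type*} [Ring B] [Algebra ℂ B] {Q : ℂ} {Z : ℕ → ℕ → B}

/-- The `q`-symmetry of a family is the eigenvalue equation for `Q`. In this form it is inherited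
under every operation that commutes with the braiding, such as `shiftL` and `shiftR`. -/
theorem IsQSymm.braid_eq (hQ : Q ≠ 0) (hZ : IsQSymm Q Z) : braid Q Z = Q • Z := by
  funext a b
  rcases lt_trichotomy a b with h | rfl | h
  · rw [braid_lt _ _ h, Pi.smul_apply, Pi.smul_apply, hZ.symm h]
    match_scalars
    field_simp
    ring
  · exact braid_self _ _ _
  · rw [braid_gt _ _ h, Pi.smul_apply, Pi.smul_apply, hZ.symm h]

theorem symm_of_braid_eq {M : Type*} [AddCommGroup M] [Module ℂ M] {f : ℕ → ℕ → M}
    (hf : braid Q f = Q • f) {i j : ℕ} (h : j < i) : f j i = Q • f i j := by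
  rw [← braid_gt Q f h, hf]
  rfl

theorem IsQSymm.weight (hQ : Generic Q) (hZ : IsQSymm Q Z) (κ : ℕ → ℂ) :
    IsQSymm Q (fun a b => (κ a * κ b) • Z a b) := by
  refine .of_quad hQ (fun h => ?_) ?_
  · rw [hZ.symm h]
    module
  · have e : prodFam (fun a b => (κ a * κ b) • Z a b)
        = fun a b c d => (κ a * κ b * (κ c * κ d)) • prodFam Z a b c d := by
      funext a b c d
      simp only [prodFam, smul_mul_smul_comm]
    rw [e, quad_weight, hZ.quad hQ]
    funext a b c d
    simp

/-- The matrices that encode a skew derivation. -/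
def skewMat {A : Type*} [Ring A] (x d y : A) : Matrix (Fin 2) (Fin 2) A := !![x, d; 0, y]

theorem skewMat_mul {A : Type*} [Ring A] (x d y x' d' y' : A) :
    skewMat x d y * skewMat x' d' y' = skewMat (x * x') (x * d' + d * y') (y * y') := by
  ext i j
  fin_cases i <;> fin_cases j <;> simp [skewMat, Matrix.mul_apply]

theorem skewMat_add {A : Type*} [Ring A] (x d y x' d' y' : A) :
    skewMat x d y + skewMat x' d' y' = skewMat (x + x') (d + d') (y + y') := by
  ext i j
  fin_cases i <;> fin_cases j <;> simp [skewMat]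

theorem smul_skewMat {A : Type*} [Ring A] [Algebra ℂ A] (c : ℂ) (x d y : A) :
    c • skewMat x d y = skewMat (c • x) (c • d) (c • y) := by
  ext i j
  fin_cases i <;> fin_cases j <;> simp [skewMat]

/-- `skewMat` as a linear map. -/
def skewMatHom (A : Type*) [Ring A] [Algebra ℂ A] : A × A × A →ₗ[ℂ] Matrix (Fin 2) (Fin 2) A where
  toFun p := skewMat p.1 p.2.1 p.2.2
  map_add' _ _ := (skewMat_add _ _ _ _ _ _).symm
  map_smul' _ _ := (smul_skewMat _ _ _ _).symm

/-- The three entries are the projections of a triple, and `quad` commutes with linear maps. -/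
theorem quad_skewMat (f g h : ℕ → ℕ → ℕ → ℕ → B) (hf : quad Q f = 0) (hg : quad Q g = 0)
    (hh : quad Q h = 0) :
    quad Q (fun a b c d => skewMat (f a b c d) (g a b c d) (h a b c d)) = 0 := by
  have e := quad_map Q (skewMatHom B) (fun a b c d => (f a b c d, g a b c d, h a b c d))
  have e1 := quad_map Q (LinearMap.fst ℂ B (B × B))
    (fun a b c d => (f a b c d, g a b c d, h a b c d))
  have e2 := quad_map Q (LinearMap.fst ℂ B B ∘ₗ LinearMap.snd ℂ B (B × B))
    (fun a b c d => (f a b c d, g a b c d, h a b c d))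
  have e3 := quad_map Q (LinearMap.snd ℂ B B ∘ₗ LinearMap.snd ℂ B (B × B))
    (fun a b c d => (f a b c d, g a b c d, h a b c d))
  have e0 : quad Q (fun a b c d => (f a b c d, g a b c d, h a b c d)) = 0 := by
    funext a b c d
    have e1 := congrFun (congrFun (congrFun (congrFun e1 a) b) c) d
    have e2 := congrFun (congrFun (congrFun (congrFun e2 a) b) c) d
    have e3 := congrFun (congrFun (congrFun (congrFun e3 a) b) c) d
    refine Prod.ext (e1.symm.trans ?_) (Prod.ext (e2.symm.trans ?_) (e3.symm.trans ?_))
    · exact congrFun (congrFun (congrFun (congrFun hf a) b) c) d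
    · exact congrFun (congrFun (congrFun (congrFun hg a) b) c) d
    · exact congrFun (congrFun (congrFun (congrFun hh a) b) c) d
  refine e.trans ?_
  rw [e0]
  funext a b c d
  exact map_zero _

/-- The upper right entry of a product of two of these matrices is the coproduct `shiftL₄` applied
to `prodFam Z`. Since the coproduct commutes with `quad`, the vanishing of `quad` for `Z` carries
over to this entry; the diagonal entries are `Z` and its weighted version. -/
theorem IsQSymm.skewMat_left (hQ : Generic Q) (hZ : IsQSymm Q Z) {s t : ℕ} {κ : ℕ → ℂ}
    (hκ : IsWeight Q s t κ) (hst : s = t + 1) :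
    IsQSymm Q (fun a b => skewMat ((κ a * κ b) • Z a b) (shiftL s t κ Z a b) (Z a b)) := by
  have hw := hZ.weight hQ κ
  have hbr : ∀ f : ℕ → ℕ → B, braid Q (shiftL s t κ f) = shiftL s t κ (braid Q f) :=
    braid_shiftL hQ.ne_zero hκ hst
  have hs : braid Q (shiftL s t κ Z) = Q • shiftL s t κ Z := by
    rw [hbr, hZ.braid_eq hQ.ne_zero]
    funext a b
    simp only [shiftL, Pi.smul_apply]
    split_ifs <;> module
  refine .of_quad hQ (fun h => ?_) ?_
  · rw [hw.symm h, symm_of_braid_eq hs h, smul_skewMat, hZ.symm h]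
  · have e : prodFam (fun a b => skewMat ((κ a * κ b) • Z a b) (shiftL s t κ Z a b) (Z a b)) =
        fun a b c d => skewMat (prodFam (fun a b => (κ a * κ b) • Z a b) a b c d)
          (shiftL₄ s t κ (prodFam Z) a b c d) (prodFam Z a b c d) := by
      funext a b c d
      simp only [prodFam, skewMat_mul, shiftL₄, shiftL]
      congr 1
      split_ifs <;> simp only [mul_add, add_mul, smul_mul_assoc, mul_smul_comm, mul_zero, zero_mul]
        <;> module
    rw [e]
    refine quad_skewMat _ _ _ (hw.quad hQ) ?_ (hZ.quad hQ)
    rw [quad_shiftL₄ hbr, hZ.quad hQ]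
    funext a b c d
    simp [shiftL₄, shiftL]

theorem IsQSymm.skewMat_right (hQ : Generic Q) (hZ : IsQSymm Q Z) {s t : ℕ} {κ : ℕ → ℂ}
    (hκ : IsWeight Q s t κ) (hst : t = s + 1) :
    IsQSymm Q (fun a b => skewMat (Z a b) (shiftR s t κ Z a b) ((κ a * κ b) • Z a b)) := by
  have hw := hZ.weight hQ κ
  have hbr : ∀ f : ℕ → ℕ → B, braid Q (shiftR s t κ f) = shiftR s t κ (braid Q f) :=
    braid_shiftR hQ.ne_zero hκ hst
  have hs : braid Q (shiftR s t κ Z) = Q • shiftR s t κ Z := by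
    rw [hbr, hZ.braid_eq hQ.ne_zero]
    funext a b
    simp only [shiftR, Pi.smul_apply]
    split_ifs <;> module
  refine .of_quad hQ (fun h => ?_) ?_
  · rw [hw.symm h, symm_of_braid_eq hs h, smul_skewMat, hZ.symm h]
  · have e : prodFam (fun a b => skewMat (Z a b) (shiftR s t κ Z a b) ((κ a * κ b) • Z a b)) =
        fun a b c d => skewMat (prodFam Z a b c d) (shiftR₄ s t κ (prodFam Z) a b c d)
          (prodFam (fun a b => (κ a * κ b) • Z a b) a b c d) := by
      funext a b c d
      simp only [prodFam, skewMat_mul, shiftR₄, shiftR]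
      congr 1
      split_ifs <;> simp only [mul_add, add_mul, smul_mul_assoc, mul_smul_comm, mul_zero, zero_mul]
        <;> module
    rw [e]
    refine quad_skewMat _ _ _ (hZ.quad hQ) ?_ (hw.quad hQ)
    rw [quad_shiftR₄ hbr, hZ.quad hQ]
    funext a b c d
    simp [shiftR₄, shiftR]

/-- A skew derivation that maps `Z n n` to a scalar and kills the other members of the family. -/
theorem IsQSymm.skewMat_top (hQ : Generic Q) (hZ : IsQSymm Q Z) {n : ℕ}
    (htop : ∀ a b, n < a → Z a b = 0) (c : ℂ) {κ : ℕ → ℂ} (h1 : κ n = Q⁻¹ ^ 2)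
    (h2 : ∀ a, a ≠ n → κ a = 1) :
    IsQSymm Q (fun a b => skewMat (Z a b) (if a = n ∧ b = n then c • (1 : B) else 0)
      ((κ a * κ b) • Z a b)) := by
  have hw := hZ.weight hQ κ
  have h0 := hQ.ne_zero
  -- In every relation the diagonal entries are settled by `hZ` and `hw`. The upper right entry can
  -- be nonzero only where `Z n n` is a factor; there the power of `Q` in the relation is matched by
  -- the weight of the other factor.
  constructor
  · intro i j h
    simp only [skewMat_mul, smul_skewMat, skewMat_add]
    rw [hw.symm h, hZ.symm h]
    congr 1
    rcases lt_trichotomy i n with ht | ht | ht <;> (try subst ht) <;>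
    simp (disch := omega) only [htop, if_neg, if_pos, and_self, if_true, h1, h2, mul_zero, zero_mul, add_zero,
      zero_add, smul_zero, mul_smul_comm, smul_mul_assoc, mul_one, one_mul]
  · intro i k h
    simp only [skewMat_mul, smul_skewMat, skewMat_add]
    rw [hZ.r1 h, hw.r1 h]
    congr 1
    rcases lt_trichotomy k n with ht | ht | ht <;> (try subst ht) <;>
    simp (disch := omega) only [htop, if_neg, if_pos, and_self, if_true, h1, h2, mul_zero, zero_mul, add_zero,
      zero_add, smul_zero, mul_smul_comm, smul_mul_assoc, mul_one, one_mul]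
  · intro i j h
    simp only [skewMat_mul, smul_skewMat, skewMat_add]
    rw [hZ.r2 h, hw.r2 h]
    congr 1
    rcases lt_trichotomy i n with ht | ht | ht <;> (try subst ht) <;>
    simp (disch := omega) only [htop, if_neg, if_pos, and_self, if_true, h1, h2, mul_zero, zero_mul, add_zero,
      zero_add, smul_zero, mul_smul_comm, smul_mul_assoc, mul_one, one_mul]
    all_goals (match_scalars <;> field_simp)
  · intro i j l h h'
    simp only [skewMat_mul, smul_skewMat, skewMat_add]
    rw [hZ.r3 h h', hw.r3 h h']
    congr 1
    rcases lt_trichotomy i n with ht | ht | ht <;> (try subst ht) <;>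
    simp (disch := omega) only [htop, if_neg, if_pos, and_self, if_true, h1, h2, mul_zero, zero_mul, add_zero,
      zero_add, smul_zero, mul_smul_comm, smul_mul_assoc, mul_one, one_mul]
  · intro i j k h h'
    simp only [skewMat_mul, smul_skewMat, skewMat_add]
    rw [hZ.r4 h h', hw.r4 h h']
    congr 1
    rcases lt_trichotomy k n with ht | ht | ht <;> (try subst ht) <;>
    simp (disch := omega) only [htop, if_neg, if_pos, and_self, if_true, h1, h2, mul_zero, zero_mul, add_zero,
      zero_add, smul_zero, mul_smul_comm, smul_mul_assoc, mul_one, one_mul]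
  · intro i j k l h h' h''
    simp only [skewMat_mul, smul_skewMat, skewMat_add]
    rw [hZ.r5 h h' h'', hw.r5 h h' h'']
    congr 1
    rcases lt_trichotomy i n with ht | ht | ht <;> (try subst ht) <;>
    simp (disch := omega) only [htop, if_neg, if_pos, and_self, if_true, h1, h2, mul_zero, zero_mul, add_zero,
      zero_add, smul_zero, mul_smul_comm, smul_mul_assoc, mul_one, one_mul]
  · intro i k h
    simp only [skewMat_mul, smul_skewMat, skewMat_add]
    rw [hZ.r6 h, hw.r6 h]
    congr 1
    rcases lt_trichotomy k n with ht | ht | ht <;> (try subst ht) <;>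
    simp (disch := omega) only [htop, if_neg, if_pos, and_self, if_true, h1, h2, mul_zero, zero_mul, add_zero,
      zero_add, smul_zero, mul_smul_comm, smul_mul_assoc, mul_one, one_mul]
    all_goals (match_scalars <;> field_simp)
  · intro i k l h h'
    simp only [skewMat_mul, smul_skewMat, skewMat_add]
    rw [hZ.r7 h h', hw.r7 h h']
    congr 1
    rcases lt_trichotomy k n with ht | ht | ht <;> (try subst ht) <;>
    simp (disch := omega) only [htop, if_neg, if_pos, and_self, if_true, h1, h2, mul_zero, zero_mul, add_zero,
      zero_add, smul_zero, mul_smul_comm, smul_mul_assoc, mul_one, one_mul]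
  · intro i j k h h'
    simp only [skewMat_mul, smul_skewMat, skewMat_add]
    rw [hZ.r8 h h', hw.r8 h h']
    congr 1
    rcases lt_trichotomy k n with ht | ht | ht <;> (try subst ht) <;>
    simp (disch := omega) only [htop, if_neg, if_pos, and_self, if_true, h1, h2, mul_zero, zero_mul, add_zero,
      zero_add, smul_zero, mul_smul_comm, smul_mul_assoc, mul_one, one_mul]
    all_goals (match_scalars <;> field_simp)
  · intro i j k l h h' h''
    simp only [skewMat_mul, smul_skewMat, skewMat_add]
    rw [hZ.r9 h h' h'', hw.r9 h h' h'']
    congr 1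
    rcases lt_trichotomy k n with ht | ht | ht <;> (try subst ht) <;>
    simp (disch := omega) only [htop, if_neg, if_pos, and_self, if_true, h1, h2, mul_zero, zero_mul, add_zero,
      zero_add, smul_zero, mul_smul_comm, smul_mul_assoc, mul_one, one_mul]
  · intro i j k l h h' h''
    simp only [skewMat_mul, smul_skewMat, skewMat_add]
    rw [hZ.r10 h h' h'', hw.r10 h h' h'']
    congr 1
    rcases lt_trichotomy k n with ht | ht | ht <;> (try subst ht) <;>
    simp (disch := omega) only [htop, if_neg, if_pos, and_self, if_true, h1, h2, mul_zero, zero_mul, add_zero,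
      zero_add, smul_zero, mul_smul_comm, smul_mul_assoc, mul_one, one_mul]
  · intro i j k h h'
    simp only [skewMat_mul, smul_skewMat, skewMat_add]
    rw [hZ.r11 h h', hw.r11 h h']
    congr 1
    rcases lt_trichotomy k n with ht | ht | ht <;> (try subst ht) <;>
    simp (disch := omega) only [htop, if_neg, if_pos, and_self, if_true, h1, h2, mul_zero, zero_mul, add_zero,
      zero_add, smul_zero, mul_smul_comm, smul_mul_assoc, mul_one, one_mul]

end Quadratic

/-! ### The algebra `ℂ[𝔭⁻]_q`: its universal property and its skew derivations -/

namespace Cp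

variable {n : ℕ} {q : Set.Ioo (0 : ℝ) 1}

theorem z_of_not {i j : ℕ} (h : ¬(1 ≤ j ∧ j ≤ i ∧ i ≤ n)) : z n q i j = 0 := by
  rw [z, zFree, dif_neg h]
  exact map_zero _

/-- The `q`-symmetric extension of the family of generators. -/
def zt (n : ℕ) (q : Set.Ioo (0 : ℝ) 1) (a b : ℕ) : Cp n q :=
  if b ≤ a then z n q a b else qC q • z n q b a

theorem zt_of_le {a b : ℕ} (h : b ≤ a) : zt n q a b = z n q a b := if_pos h

theorem zt_of_lt {a b : ℕ} (h : a < b) : zt n q a b = qC q • z n q b a := if_neg h.not_ge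

theorem zt_eq_zero {a b : ℕ} (h : a = 0 ∨ b = 0 ∨ n < a ∨ n < b) : zt n q a b = 0 := by
  rcases le_or_gt b a with h' | h'
  · rw [zt_of_le h', z_of_not (by omega)]
  · rw [zt_of_lt h', z_of_not (by omega), smul_zero]

theorem zrel {x y : FreeAlgebra ℂ (ZIdx n)} (h : ZRel n q x y) :
    RingQuot.mkAlgHom ℂ (ZRel n q) x = RingQuot.mkAlgHom ℂ (ZRel n q) y :=
  RingQuot.mkAlgHom_rel ℂ h

/-- For indices outside `1, …, n` the relations hold because each of their monomials contains a
generator with an index out of range, which is `0` by convention. -/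
theorem isQSymm_zt (n : ℕ) (q : Set.Ioo (0 : ℝ) 1) : IsQSymm (qC q) (zt n q) where
  symm h := by rw [zt_of_lt h, zt_of_le h.le]
  r1 {i k} h := by
    simp (disch := omega) only [zt_of_le]
    by_cases hr : 1 ≤ i ∧ k ≤ n
    · simpa [z] using! zrel (.r1 (q := q) i i k i hr.1 hr.1 (by omega) hr.2 ⟨rfl, rfl, h⟩)
    · rcases not_and_or.1 hr with hr | hr <;> simp (disch := omega) only [z_of_not] <;> simp
  r2 {i j} h := by
    simp (disch := omega) only [zt_of_le]
    by_cases hr : 1 ≤ j ∧ i ≤ n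
    · simpa [z] using! zrel (.r2 (q := q) i j i i hr.1 (by omega) (by omega) hr.2 ⟨h, rfl, rfl⟩)
    · rcases not_and_or.1 hr with hr | hr <;> simp (disch := omega) only [z_of_not] <;> simp
  r3 {i j l} h h' := by
    simp (disch := omega) only [zt_of_le]
    by_cases hr : 1 ≤ j ∧ i ≤ n
    · simpa [z] using! zrel (.r3 (q := q) i j i l hr.1 (by omega) (by omega) hr.2 ⟨h, h', rfl⟩)
    · rcases not_and_or.1 hr with hr | hr <;> simp (disch := omega) only [z_of_not] <;> simp
  r4 {i j k} h h' := by
    simp (disch := omega) only [zt_of_le]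
    by_cases hr : 1 ≤ j ∧ k ≤ n
    · simpa [z] using! zrel (.r4 (q := q) i j k j hr.1 (by omega) (by omega) hr.2 ⟨rfl, h, h'⟩)
    · rcases not_and_or.1 hr with hr | hr <;> simp (disch := omega) only [z_of_not] <;> simp
  r5 {i j k l} h h' h'' := by
    simp (disch := omega) only [zt_of_le]
    by_cases hr : 1 ≤ j ∧ i ≤ n
    · simpa [z] using! zrel (.r5 (q := q) i j k l hr.1 (by omega) hr.2 (by omega) ⟨h, h', h''⟩)
    · rcases not_and_or.1 hr with hr | hr <;>
        simp (disch := omega) only [z_of_not (i := i) (j := j)] <;> simp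
  r6 {i k} h := by
    simp (disch := omega) only [zt_of_le]
    by_cases hr : 1 ≤ i ∧ k ≤ n
    · simpa [z] using! zrel (.r6 (q := q) i i k k hr.1 (by omega) (by omega) hr.2 ⟨rfl, h, rfl⟩)
    · rcases not_and_or.1 hr with hr | hr <;> simp (disch := omega) only [z_of_not] <;> simp
  r7 {i k l} h h' := by
    simp (disch := omega) only [zt_of_le]
    by_cases hr : 1 ≤ i ∧ k ≤ n
    · simpa [z] using! zrel (.r7 (q := q) i i k l hr.1 (by omega) (by omega) hr.2 ⟨rfl, h, h'⟩)
    · rcases not_and_or.1 hr with hr | hr <;> simp (disch := omega) only [z_of_not] <;> simp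
  r8 {i j k} h h' := by
    simp (disch := omega) only [zt_of_le]
    by_cases hr : 1 ≤ j ∧ k ≤ n
    · simpa [z] using! zrel (.r8 (q := q) i j k k hr.1 (by omega) (by omega) hr.2 ⟨h, h', rfl⟩)
    · rcases not_and_or.1 hr with hr | hr <;> simp (disch := omega) only [z_of_not] <;> simp
  r9 {i j k l} h h' h'' := by
    simp (disch := omega) only [zt_of_le]
    by_cases hr : 1 ≤ j ∧ k ≤ n
    · simpa [z] using! zrel (.r9 (q := q) i j k l hr.1 (by omega) (by omega) hr.2 ⟨h, h', h''⟩)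
    · rcases not_and_or.1 hr with hr | hr <;> simp (disch := omega) only [z_of_not] <;> simp
  r10 {i j k l} h h' h'' := by
    simp (disch := omega) only [zt_of_le]
    by_cases hr : 1 ≤ j ∧ k ≤ n
    · simpa [z] using! zrel (.r10 (q := q) i j k l hr.1 (by omega) (by omega) hr.2 ⟨h, h', h''⟩)
    · rcases not_and_or.1 hr with hr | hr <;> simp (disch := omega) only [z_of_not] <;> simp
  r11 {i j k} h h' := by
    simp (disch := omega) only [zt_of_le]
    by_cases hr : 1 ≤ j ∧ k ≤ n
    · simpa [z] using! zrel (.r11 (q := q) i j k i hr.1 (by omega) (by omega) hr.2 ⟨h, rfl, h'⟩)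
    · rcases not_and_or.1 hr with hr | hr <;> simp (disch := omega) only [z_of_not] <;> simp

/-- A `q`-symmetric family in an algebra defines a homomorphism from `ℂ[𝔭⁻]_q`. -/
theorem exists_hom {B : Type*} [Ring B] [Algebra ℂ B] {Z : ℕ → ℕ → B} (hZ : IsQSymm (qC q) Z) :
    ∃ φ : Cp n q →ₐ[ℂ] B, ∀ i j, 1 ≤ j → j ≤ i → i ≤ n → φ (z n q i j) = Z i j := by
  let ψ : FreeAlgebra ℂ (ZIdx n) →ₐ[ℂ] B := FreeAlgebra.lift ℂ (fun p => Z p.1.1 p.1.2)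
  have hψ : ∀ i j, 1 ≤ j ∧ j ≤ i ∧ i ≤ n → ψ (zFree n i j) = Z i j := fun i j h => by
    rw [zFree, dif_pos h, FreeAlgebra.lift_ι_apply]
  have hrel : ∀ ⦃x y⦄, ZRel n q x y → ψ x = ψ y := by
    intro x y h
    cases h with
    | r1 i j k l hj hl hi hk h =>
      obtain ⟨rfl, rfl, h⟩ := h
      simp (disch := omega) only [map_mul, map_smul, hψ, hZ.r1 h]
    | r2 i j k l hj hl hi hk h =>
      obtain ⟨h, rfl, rfl⟩ := h
      simp (disch := omega) only [map_mul, map_smul, hψ, hZ.r2 h]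
    | r3 i j k l hj hl hi hk h =>
      obtain ⟨h, h', rfl⟩ := h
      simp (disch := omega) only [map_mul, map_smul, hψ, hZ.r3 h h']
    | r4 i j k l hj hl hi hk h =>
      obtain ⟨rfl, h, h'⟩ := h
      simp (disch := omega) only [map_mul, map_smul, hψ, hZ.r4 h h']
    | r5 i j k l hj hl hi hk h =>
      obtain ⟨h, h', h''⟩ := h
      simp (disch := omega) only [map_mul, map_smul, hψ]
      exact hZ.r5 h h' h''
    | r6 i j k l hj hl hi hk h =>
      obtain ⟨rfl, h, rfl⟩ := h
      simp (disch := omega) only [map_mul, map_add, map_smul, hψ, hZ.r6 h]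
      simp
    | r7 i j k l hj hl hi hk h =>
      obtain ⟨rfl, h, h'⟩ := h
      simp (disch := omega) only [map_mul, map_add, map_smul, hψ, hZ.r7 h h']
      simp
    | r8 i j k l hj hl hi hk h =>
      obtain ⟨h, h', rfl⟩ := h
      simp (disch := omega) only [map_mul, map_add, map_smul, hψ, hZ.r8 h h']
      simp
    | r9 i j k l hj hl hi hk h =>
      obtain ⟨h, h', h''⟩ := h
      simp (disch := omega) only [map_mul, map_add, map_smul, hψ, hZ.r9 h h' h'']
    | r10 i j k l hj hl hi hk h =>
      obtain ⟨h, h', h''⟩ := h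
      simp (disch := omega) only [map_mul, map_add, map_smul, hψ, hZ.r10 h h' h'']
    | r11 i j k l hj hl hi hk h =>
      obtain ⟨h, rfl, h'⟩ := h
      simp (disch := omega) only [map_mul, map_add, map_smul, hψ, hZ.r11 h h']
  refine ⟨RingQuot.liftAlgHom ℂ ⟨ψ, hrel⟩, fun i j h1 h2 h3 => ?_⟩
  rw [z]
  erw [RingQuot.liftAlgHom_mkAlgHom_apply]
  exact hψ i j ⟨h1, h2, h3⟩

theorem induction {p : Cp n q → Prop} (hc : ∀ c : ℂ, p (algebraMap ℂ _ c))
    (hz : ∀ i j, 1 ≤ j → j ≤ i → i ≤ n → p (z n q i j)) (hadd : ∀ a b, p a → p b → p (a + b))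
    (hmul : ∀ a b, p a → p b → p (a * b)) (u : Cp n q) : p u := by
  obtain ⟨a, rfl⟩ := RingQuot.mkAlgHom_surjective ℂ (ZRel n q) u
  induction a using FreeAlgebra.induction with
  | grade0 c => simpa using! hc c
  | grade1 x =>
    have e : FreeAlgebra.ι ℂ x = zFree n x.1.1 x.1.2 := by rw [zFree, dif_pos x.2]
    rw [e]
    exact hz _ _ x.2.1 x.2.2.1 x.2.2.2
  | mul a b ha hb => simpa using! hmul _ _ ha hb
  | add a b ha hb => simpa using! hadd _ _ ha hb

/-- Two skew derivations of the same type that agree on the generators coincide. -/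
theorem skewDer_ext {α β : Cp n q → Cp n q} {D D' : Cp n q →ₗ[ℂ] Cp n q}
    (hD : ∀ a b, D (a * b) = α a * D b + D a * β b)
    (hD' : ∀ a b, D' (a * b) = α a * D' b + D' a * β b) (h1 : D 1 = D' 1)
    (hz : ∀ i j, 1 ≤ j → j ≤ i → i ≤ n → D (z n q i j) = D' (z n q i j)) : D = D' := by
  ext u
  induction u using induction with
  | hc c => rw [Algebra.algebraMap_eq_smul_one, map_smul, map_smul, h1]
  | hz i j h h' h'' => exact hz i j h h' h''
  | hadd a b ha hb => rw [map_add, map_add, ha, hb]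
  | hmul a b ha hb => rw [hD, hD', ha, hb]

/-- The family `Z` defines a homomorphism `φ` into `2 × 2` matrices. Its image is upper triangular
with diagonal `(α, β)`, as this holds on the generators and is stable under sums and products. `D`
is the upper right entry of `φ`, and its product rule is matrix multiplication. -/
theorem exists_skewDer (α β : Cp n q →ₐ[ℂ] Cp n q) (e : ℕ → ℕ → Cp n q)
    {Z : ℕ → ℕ → Matrix (Fin 2) (Fin 2) (Cp n q)} (hZ : IsQSymm (qC q) Z)
    (h : ∀ i j, 1 ≤ j → j ≤ i → i ≤ n → Z i j = skewMat (α (z n q i j)) (e i j) (β (z n q i j))) :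
    ∃ D : Cp n q →ₗ[ℂ] Cp n q, (∀ a b, D (a * b) = α a * D b + D a * β b) ∧
      ∀ i j, 1 ≤ j → j ≤ i → i ≤ n → D (z n q i j) = e i j := by
  obtain ⟨φ, hφ⟩ := exists_hom (n := n) hZ
  have key : ∀ u, φ u = skewMat (α u) (φ u 0 1) (β u) := by
    intro u
    induction u using induction with
    | hc c =>
      rw [AlgHom.commutes, AlgHom.commutes, AlgHom.commutes]
      ext i j
      fin_cases i <;> fin_cases j <;> simp [skewMat, Matrix.algebraMap_matrix_apply]
    | hz i j h1 h2 h3 =>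
      rw [hφ i j h1 h2 h3, h i j h1 h2 h3]
      rfl
    | hadd a b ha hb =>
      rw [map_add, ha, hb, map_add, map_add, skewMat_add]
      rfl
    | hmul a b ha hb =>
      rw [map_mul, ha, hb, map_mul, map_mul, skewMat_mul]
      rfl
  refine ⟨Matrix.entryLinearMap ℂ (Cp n q) 0 1 ∘ₗ φ.toLinearMap, fun a b => ?_,
    fun i j h1 h2 h3 => ?_⟩
  · change φ (a * b) 0 1 = α a * φ b 0 1 + φ a 0 1 * β b
    rw [map_mul, key a, key b, skewMat_mul]
    rfl
  · change φ (z n q i j) 0 1 = e i j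
    rw [hφ i j h1 h2 h3, h i j h1 h2 h3]
    rfl

end Cp

/-! ### Serre expressions of skew derivations -/

section SerreAlgebra

variable {A : Type*} [Ring A] [Algebra ℂ A] {Q : ℂ}

/-- The hypotheses are the commutation rules between `E_i ⊗ 1` and `K_j ⊗ E_j`. Reordering every
mixed monomial by them gives coefficients that are alternating sums of quantum binomials, and these
vanish. Only `r ≤ 3` is needed, the Cartan entries off the diagonal being `0`, `-1`, `-2`. -/
theorem qSerre_add_eq (hQ : Generic Q) {r : ℕ} (hr : r = 1 ∨ r = 2 ∨ r = 3) {c : ℂ}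
    (hc : c = Q ^ (1 - r : ℤ)) {a b x y : A} (hba : b * a = (Q ^ 2) • (a * b))
    (hbx : b * x = c • (x * b)) (hya : y * a = c • (a * y)) :
    qSerre Q r (a + b) (x + y) = qSerre Q r a x + qSerre Q r b y := by
  have h0 := hQ.ne_zero
  have hba' : ∀ w, b * (a * w) = (Q ^ 2) • (a * (b * w)) := fun w => by
    rw [← mul_assoc, hba, smul_mul_assoc, mul_assoc]
  have hbx' : ∀ w, b * (x * w) = c • (x * (b * w)) := fun w => by
    rw [← mul_assoc, hbx, smul_mul_assoc, mul_assoc]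
  have hya' : ∀ w, y * (a * w) = c • (a * (y * w)) := fun w => by
    rw [← mul_assoc, hya, smul_mul_assoc, mul_assoc]
  rcases hr with rfl | rfl | rfl
  · have hc' : c = 1 := by simpa using hc
    subst hc'
    simp only [qSerre_one hQ, mul_add, add_mul, hbx, hya, one_smul]
    abel
  · have hc' : c = Q⁻¹ := by rw [hc]; norm_num [zpow_neg]
    subst hc'
    simp only [qSerre_two hQ, mul_add, add_mul, mul_assoc, hbx, hya, hba, hbx', hya', hba',
      mul_smul_comm, smul_add, smul_smul]
    match_scalars <;> field_simp <;> ring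
  · have hc' : c = Q⁻¹ ^ 2 := by rw [hc]; norm_num [zpow_neg]
    subst hc'
    simp only [qSerre_three hQ, mul_add, add_mul, mul_assoc, hbx, hya, hba, hbx', hya', hba',
      mul_smul_comm, smul_add, smul_smul]
    match_scalars <;> field_simp <;> ring

/-- As `k` and `l` commute, each monomial of the Serre expression has the same first tensor factor
`k ^ r * l`. -/
theorem qSerre_tmul_left (hQ : Generic Q) {r : ℕ} (hr : r = 1 ∨ r = 2 ∨ r = 3) {k l x y : A}
    (hkl : l * k = k * l) :
    qSerre Q r (k ⊗ₜ[ℂ] x) (l ⊗ₜ[ℂ] y) = (k ^ r * l) ⊗ₜ[ℂ] qSerre Q r x y := by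
  have hkl' : ∀ w, l * (k * w) = k * (l * w) := fun w => by rw [← mul_assoc, hkl, mul_assoc]
  rcases hr with rfl | rfl | rfl
  · simp only [qSerre_one hQ, Algebra.TensorProduct.tmul_mul_tmul, hkl, pow_one,
      TensorProduct.tmul_sub]
  · simp only [qSerre_two hQ, Algebra.TensorProduct.tmul_mul_tmul, hkl, hkl', pow_two, mul_assoc,
      TensorProduct.tmul_sub, TensorProduct.tmul_add, TensorProduct.tmul_smul]
  · simp only [qSerre_three hQ, Algebra.TensorProduct.tmul_mul_tmul, hkl, hkl', pow_succ, pow_zero,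
      one_mul, mul_assoc, TensorProduct.tmul_sub, TensorProduct.tmul_add, TensorProduct.tmul_smul]

theorem qSerre_tmul_right (hQ : Generic Q) {r : ℕ} (hr : r = 1 ∨ r = 2 ∨ r = 3) {k l x y : A}
    (hkl : l * k = k * l) :
    qSerre Q r (x ⊗ₜ[ℂ] k) (y ⊗ₜ[ℂ] l) = qSerre Q r x y ⊗ₜ[ℂ] (k ^ r * l) := by
  have hkl' : ∀ w, l * (k * w) = k * (l * w) := fun w => by rw [← mul_assoc, hkl, mul_assoc]
  rcases hr with rfl | rfl | rfl
  · simp only [qSerre_one hQ, Algebra.TensorProduct.tmul_mul_tmul, hkl, pow_one,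
      TensorProduct.sub_tmul]
  · simp only [qSerre_two hQ, Algebra.TensorProduct.tmul_mul_tmul, hkl, hkl', pow_two, mul_assoc,
      TensorProduct.sub_tmul, TensorProduct.add_tmul, ← TensorProduct.smul_tmul']
  · simp only [qSerre_three hQ, Algebra.TensorProduct.tmul_mul_tmul, hkl, hkl', pow_succ, pow_zero,
      one_mul, mul_assoc, TensorProduct.sub_tmul, TensorProduct.add_tmul,
      ← TensorProduct.smul_tmul']

theorem qSerre_sub_right (Q : ℂ) (r : ℕ) (x y y' : A) :
    qSerre Q r x (y - y') = qSerre Q r x y - qSerre Q r x y' := by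
  simp only [qSerre, mul_sub, sub_mul, smul_sub, Finset.sum_sub_distrib]

/-- The cubic Serre relation for a string `y₀, y₁, y₂` of iterated twisted commutators. -/
theorem qSerre_three_string (hQ : Generic Q) {a : ℂ} (ha : a = Q ^ 2 ∨ a = Q⁻¹ ^ 2)
    {x y₀ y₁ y₂ : A} (h0 : x * y₀ = a • (y₀ * x) + y₁) (h1 : x * y₁ = y₁ * x + y₂)
    (h2 : x * y₂ = a⁻¹ • (y₂ * x)) : qSerre Q 3 x y₀ = 0 := by
  have hQ0 := hQ.ne_zero
  have h0' : ∀ w, x * (y₀ * w) = a • (y₀ * (x * w)) + y₁ * w := fun w => by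
    rw [← mul_assoc, h0, add_mul, smul_mul_assoc, mul_assoc]
  have h1' : ∀ w, x * (y₁ * w) = y₁ * (x * w) + y₂ * w := fun w => by
    rw [← mul_assoc, h1, add_mul, mul_assoc]
  have h2' : ∀ w, x * (y₂ * w) = a⁻¹ • (y₂ * (x * w)) := fun w => by
    rw [← mul_assoc, h2, smul_mul_assoc, mul_assoc]
  -- With `L` and `R` the left and right multiplication by `x`, the cubic Serre expression is `(L -
  -- Q² R) (L - R) (L - Q⁻² R) y₀`, a product of commuting factors. By hypothesis they can be
  -- applied so as to send `y₀` to `y₁`, then `y₁` to `y₂`, then `y₂` to `0`.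
  rcases ha with rfl | rfl
  all_goals
    simp only [qSerre_three hQ, h0, h1, h2, h0', h1', h2', mul_add, mul_smul_comm, smul_add,
      smul_smul]
    match_scalars <;> field_simp <;> ring

/-- The quadratic Serre relation for a difference of two `q`-commuting operators. -/
theorem qSerre_two_string {p : ℂ} (hp : p ≠ 0) (hQ : Generic (p ^ 2)) {x l l' m m' : A}
    (h1 : x * l = p⁻¹ ^ 2 • (l * x) + l') (h2 : x * m = p ^ 2 • (m * x) + m')
    (h3 : m * l = p ^ 4 • (l * m)) (h4 : l' * l = p ^ 2 • (l * l'))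
    (h6 : m * l' = p ^ 2 • (l' * m)) (h7 : m' * m = p⁻¹ ^ 2 • (m * m')) :
    qSerre (p ^ 2) 2 (l - m) x = 0 := by
  have h1' : ∀ w, x * (l * w) = p⁻¹ ^ 2 • (l * (x * w)) + l' * w := fun w => by
    rw [← mul_assoc, h1, add_mul, smul_mul_assoc, mul_assoc]
  have h2' : ∀ w, x * (m * w) = p ^ 2 • (m * (x * w)) + m' * w := fun w => by
    rw [← mul_assoc, h2, add_mul, smul_mul_assoc, mul_assoc]
  have h3' : ∀ w, m * (l * w) = p ^ 4 • (l * (m * w)) := fun w => by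
    rw [← mul_assoc, h3, smul_mul_assoc, mul_assoc]
  -- The rules move `x` to the right and put `l` before `m`; the coefficient of each ordered
  -- monomial then cancels.
  simp only [qSerre_two hQ, h1, h2, h3, h4, h6, h7, h1', h2', h3', mul_add, mul_sub, sub_mul,
    mul_smul_comm, smul_add, smul_sub, smul_smul]
  match_scalars <;> field_simp <;> ring

end SerreAlgebra

/-! ### Product rules, and commutators and Serre expressions of skew derivations -/

section Skew

variable {A A' : Type*} [AddCommGroup A] [Module ℂ A] [AddCommGroup A'] [Module ℂ A']

/-- `x'` acts on products as `x ⊗ 1 + k ⊗ x`. -/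
def IsSkewL (m : A →ₗ[ℂ] A →ₗ[ℂ] A') (k x : Module.End ℂ A) (x' : Module.End ℂ A') : Prop :=
  ∀ u v, x' (m u v) = m (x u) v + m (k u) (x v)

/-- `x'` acts on products as `x ⊗ k + 1 ⊗ x`. -/
def IsSkewR (m : A →ₗ[ℂ] A →ₗ[ℂ] A') (k x : Module.End ℂ A) (x' : Module.End ℂ A') : Prop :=
  ∀ u v, x' (m u v) = m (x u) (k v) + m u (x v)

variable {m : A →ₗ[ℂ] A →ₗ[ℂ] A'}

theorem qSerre_intertwine (μ : A →ₗ[ℂ] A') {x y : Module.End ℂ A} {x' y' : Module.End ℂ A'}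
    (hx : ∀ t, x' (μ t) = μ (x t)) (hy : ∀ t, y' (μ t) = μ (y t)) (Q : ℂ) (r : ℕ) (t : A) :
    qSerre Q r x' y' (μ t) = μ (qSerre Q r x y t) := by
  have hp : ∀ (s : ℕ) t, (x' ^ s) (μ t) = μ ((x ^ s) t) := by
    intro s
    induction s with
    | zero => intro t; rfl
    | succ s ih => intro t; rw [pow_succ, pow_succ, Module.End.mul_apply, hx, ih]; rfl
  simp only [qSerre, LinearMap.sum_apply, map_sum, LinearMap.smul_apply, Module.End.mul_apply,
    map_smul, hp, hy]

/-- The action of `End A ⊗ End A` on `A ⊗ A`. -/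
def tensorEnd (A : Type*) [AddCommGroup A] [Module ℂ A] :
    Module.End ℂ A ⊗[ℂ] Module.End ℂ A →ₐ[ℂ] Module.End ℂ (A ⊗[ℂ] A) :=
  Module.endTensorEndAlgHom

theorem tensorEnd_tmul (x y : Module.End ℂ A) (u v : A) :
    tensorEnd A (x ⊗ₜ y) (u ⊗ₜ v) = x u ⊗ₜ y v := rfl

theorem qSerre_tensorEnd (Q : ℂ) (r : ℕ) (s t : Module.End ℂ A ⊗[ℂ] Module.End ℂ A) :
    qSerre Q r (tensorEnd A s) (tensorEnd A t) = tensorEnd A (qSerre Q r s t) := by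
  have := map_qSerre (B := Module.End ℂ (A ⊗[ℂ] A)) (tensorEnd A) Q r s t
  exact this.symm

theorem IsSkewL.tensorEnd {k x : Module.End ℂ A} {x' : Module.End ℂ A'} (h : IsSkewL m k x x')
    (t : A ⊗[ℂ] A) : x' (TensorProduct.lift m t) =
      TensorProduct.lift m (tensorEnd A (x ⊗ₜ 1 + k ⊗ₜ x) t) := by
  induction t using TensorProduct.induction_on with
  | zero => simp
  | tmul u v => simpa [tensorEnd_tmul] using h u v
  | add t t' ht ht' => rw [map_add, map_add, map_add, map_add, ht, ht']

theorem IsSkewR.tensorEnd {k x : Module.End ℂ A} {x' : Module.End ℂ A'} (h : IsSkewR m k x x')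
    (t : A ⊗[ℂ] A) : x' (TensorProduct.lift m t) =
      TensorProduct.lift m (tensorEnd A (x ⊗ₜ k + 1 ⊗ₜ x) t) := by
  induction t using TensorProduct.induction_on with
  | zero => simp
  | tmul u v => simpa [tensorEnd_tmul] using h u v
  | add t t' ht ht' => rw [map_add, map_add, map_add, map_add, ht, ht']

/-- On the tensor square, `x'` and `y'` are induced by `x ⊗ 1 + k ⊗ x` and `y ⊗ 1 + l ⊗ y`. By
`qSerre_add_eq` their Serre expression has no mixed terms, so it obeys a product rule again. Taken
with the multiplication of `ℂ[𝔭⁻]_q`, this reduces Serre relations to the generators; taken with the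
pairing, it reduces them further to the vector representation. -/
theorem IsSkewL.qSerre {Q : ℂ} (hQ : Generic Q) {r : ℕ} (hr : r = 1 ∨ r = 2 ∨ r = 3) {c : ℂ}
    (hc : c = Q ^ (1 - r : ℤ)) {k x l y : Module.End ℂ A} {x' y' : Module.End ℂ A'}
    (hx : IsSkewL m k x x') (hy : IsSkewL m l y y') (hkl : l * k = k * l)
    (hkx : k * x = (Q ^ 2) • (x * k)) (hky : k * y = c • (y * k)) (hlx : l * x = c • (x * l)) :
    IsSkewL m (k ^ r * l) (qSerre Q r x y) (qSerre Q r x' y') := by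
  intro u v
  have e := qSerre_intertwine (TensorProduct.lift m) hx.tensorEnd hy.tensorEnd Q r (u ⊗ₜ v)
  rw [qSerre_tensorEnd, qSerre_add_eq hQ hr hc, qSerre_tmul_left hQ hr hkl, Uq.qSerre_tmul_one] at e
  · simpa [tensorEnd_tmul] using e
  · simp [hkx, TensorProduct.smul_tmul']
  · simp [hky, TensorProduct.smul_tmul']
  · simp [hlx, TensorProduct.smul_tmul']

theorem IsSkewR.qSerre {Q : ℂ} (hQ : Generic Q) {r : ℕ} (hr : r = 1 ∨ r = 2 ∨ r = 3) {c : ℂ}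
    (hc : c = Q⁻¹ ^ (1 - r : ℤ)) {k x l y : Module.End ℂ A} {x' y' : Module.End ℂ A'}
    (hx : IsSkewR m k x x') (hy : IsSkewR m l y y') (hkl : l * k = k * l)
    (hxk : x * k = (Q⁻¹ ^ 2) • (k * x)) (hyk : y * k = c • (k * y)) (hxl : x * l = c • (l * x)) :
    IsSkewR m (k ^ r * l) (qSerre Q r x y) (qSerre Q r x' y') := by
  intro u v
  -- The commutation rules for the `F_i` involve the inverse parameter. This is harmless because the
  -- Serre expression is invariant under `Q ↦ Q⁻¹`.
  have e := qSerre_intertwine (TensorProduct.lift m) hx.tensorEnd hy.tensorEnd Q⁻¹ r (u ⊗ₜ v)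
  rw [qSerre_tensorEnd, qSerre_add_eq hQ.inv hr hc, qSerre_tmul_right hQ.inv hr hkl,
    Uq.qSerre_one_tmul, qSerre_inv, qSerre_inv] at e
  · simpa [tensorEnd_tmul] using e
  · simp [hxk, TensorProduct.tmul_smul]
  · simp [hxl, TensorProduct.tmul_smul]
  · simp [hyk, TensorProduct.tmul_smul]

/-- The commutator of skew derivations of opposite types. -/
theorem IsSkewL.commutator {k x l y : Module.End ℂ A} {x' y' : Module.End ℂ A'}
    (hx : IsSkewL m k x x') (hy : IsSkewR m l y y') {c : ℂ} (hyk : y * k = c • (k * y))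
    (hxl : x * l = c • (l * x)) (u v : A) :
    (x' * y' - y' * x') (m u v) =
      m ((x * y - y * x) u) (l v) + m (k u) ((x * y - y * x) v) := by
  -- The mixed terms of `x' y'` and `y' x'` that contain `k` and `l` both equal `c • m (k (y u)) (l
  -- (x v))`, so they cancel. The other mixed term, `m (x u) (y v)`, occurs in both products.
  have e1 : y (k u) = c • k (y u) := LinearMap.congr_fun hyk u
  have e2 : x (l v) = c • l (x v) := LinearMap.congr_fun hxl v
  simp only [LinearMap.sub_apply, Module.End.mul_apply, hx u v, hy u v, map_add, hx (y u) (l v),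
    hx u (y v), hy (x u) v, hy (k u) (x v), e1, e2, map_sub, map_smul, LinearMap.smul_apply]
  abel

end Skew

/-! ### The vector representation -/

/-- The space with basis `x_a`, `a ∈ ℕ`. -/
abbrev Vec : Type := ℕ →₀ ℂ

/-- The basis vectors. -/
def Vec.x (a : ℕ) : Vec := Finsupp.single a 1

/-- The operator that sends `x_s` to `x_t` and kills the other basis vectors. -/
def Vec.shift (s t : ℕ) : Module.End ℂ Vec :=
  Finsupp.linearCombination ℂ (fun a => if a = s then Vec.x t else 0)

/-- The diagonal operator with eigenvalues `κ`. -/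
def Vec.diag (κ : ℕ → ℂ) : Module.End ℂ Vec :=
  Finsupp.linearCombination ℂ (fun a => κ a • Vec.x a)

namespace Vec

theorem shift_x (s t a : ℕ) : shift s t (x a) = if a = s then x t else 0 := by
  simp [shift, x]

theorem diag_x (κ : ℕ → ℂ) (a : ℕ) : diag κ (x a) = κ a • x a := by
  simp [diag, x]

theorem ext {N : Type*} [AddCommGroup N] [Module ℂ N] {f g : Vec →ₗ[ℂ] N}
    (h : ∀ a, f (x a) = g (x a)) : f = g :=
  Finsupp.lhom_ext' fun a => LinearMap.ext_ring (h a)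

theorem ext₂ {N : Type*} [AddCommGroup N] [Module ℂ N] {f g : Vec →ₗ[ℂ] Vec →ₗ[ℂ] N}
    (h : ∀ a b, f (x a) (x b) = g (x a) (x b)) : f = g :=
  ext fun a => ext fun b => h a b

theorem shift_mul_shift (s t s' t' : ℕ) :
    shift s t * shift s' t' = if t' = s then shift s' t else 0 := by
  refine ext fun a => ?_
  rw [Module.End.mul_apply, shift_x]
  split_ifs with h1 h2 h2 <;> simp [shift_x, h1, h2]

theorem diag_mul_shift (κ : ℕ → ℂ) (s t : ℕ) : diag κ * shift s t = κ t • shift s t := by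
  refine ext fun a => ?_
  rw [Module.End.mul_apply, LinearMap.smul_apply, shift_x]
  split_ifs <;> simp [diag_x]

theorem shift_mul_diag (κ : ℕ → ℂ) (s t : ℕ) : shift s t * diag κ = κ s • shift s t := by
  refine ext fun a => ?_
  rw [Module.End.mul_apply, LinearMap.smul_apply, diag_x, map_smul, shift_x]
  split_ifs with h <;> simp [h]

theorem diag_mul_diag (κ κ' : ℕ → ℂ) : diag κ * diag κ' = diag κ' * diag κ := by
  refine ext fun a => ?_
  simp only [Module.End.mul_apply, diag_x, map_smul, smul_smul, mul_comm]

end Vec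

/-- The eigenvalue of `K_k` on the basis vector `x_a`. -/
def wt (n : ℕ) (q : Set.Ioo (0 : ℝ) 1) (k a : ℕ) : ℂ :=
  if k = n then (if a = n then qC q ^ 2 else 1)
  else if a = k then qC q else if a = k + 1 then (qC q)⁻¹ else 1

/-! ### Weights of the vector representation -/

section Wt

variable {n : ℕ} {q : Set.Ioo (0 : ℝ) 1}

theorem wt_ne_zero (k a : ℕ) : wt n q k a ≠ 0 := by
  have := qC_ne_zero q
  unfold wt
  split_ifs <;> simp [this]

theorem wt_isWeight {k : ℕ} (hk : k < n) : IsWeight (qC q) (k + 1) k (wt n q k) where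
  source := by simp [wt, hk.ne]
  target := by simp [wt, hk.ne]
  other a h h' := by simp [wt, hk.ne, h, h']

theorem wt_inv_isWeight {k : ℕ} (hk : k < n) :
    IsWeight (qC q) k (k + 1) (fun a => (wt n q k a)⁻¹) where
  source := by simp [wt, hk.ne]
  target := by simp [wt, hk.ne]
  other a h h' := by simp [wt, hk.ne, h, h']

/-- The weights of `x_j` and `x_{j+1}` differ by the simple root `α_j`, which therefore is the
weight of `E_j`. -/
theorem wt_shift (i j : Idx n) (hj : (j : ℕ) < n) :
    wt n q i j = qC q ^ ((symm n i : ℤ) * cartan n i j) * wt n q i (j + 1) := by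
  have h0 := qC_ne_zero q
  obtain ⟨i, hi⟩ := i
  obtain ⟨j, hj'⟩ := j
  simp only at hj ⊢
  unfold wt symm cartan
  split_ifs <;> first | (exfalso; omega) | (norm_num <;> field_simp)

/-- The weight of `z_{nn}` is the long simple root `α_n`. This gives `E_n` and `F_n` their weights.
-/
theorem wt_top (i : Idx n) :
    wt n q i n * wt n q i n = qC q ^ ((symm n i : ℤ) * cartan n i n) := by
  have h0 := qC_ne_zero q
  obtain ⟨i, hi⟩ := i
  simp only
  unfold wt symm cartan
  split_ifs <;> first | (exfalso; omega) | (norm_num <;> field_simp)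

end Wt

namespace Cp

variable {n : ℕ} {q : Set.Ioo (0 : ℝ) 1}

/-! ### The operators on `ℂ[𝔭⁻]_q` -/

theorem exists_diag (κ : ℕ → ℂ) : ∃ φ : Cp n q →ₐ[ℂ] Cp n q,
    ∀ a b, φ (zt n q a b) = (κ a * κ b) • zt n q a b := by
  obtain ⟨φ, hφ⟩ := exists_hom (n := n) ((isQSymm_zt n q).weight (generic_qC q) κ)
  have key : ∀ a b, b ≤ a → φ (zt n q a b) = (κ a * κ b) • zt n q a b := by
    intro a b h
    by_cases hr : 1 ≤ b ∧ a ≤ n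
    · rw [zt_of_le h, hφ a b hr.1 h hr.2, zt_of_le h]
    · rw [zt_eq_zero (by omega), map_zero, smul_zero]
  refine ⟨φ, fun a b => ?_⟩
  rcases le_or_gt b a with h | h
  · exact key a b h
  · rw [(isQSymm_zt n q).symm h, map_smul, key b a h.le, mul_comm, smul_comm]

/-- The automorphism of `ℂ[𝔭⁻]_q` that multiplies `z_{ab}` by `κ_a κ_b`. -/
def diag (n : ℕ) (q : Set.Ioo (0 : ℝ) 1) (κ : ℕ → ℂ) : Cp n q →ₐ[ℂ] Cp n q :=
  (exists_diag κ).choose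

theorem diag_zt (κ : ℕ → ℂ) (a b : ℕ) : diag n q κ (zt n q a b) = (κ a * κ b) • zt n q a b :=
  (exists_diag κ).choose_spec a b

theorem diag_z (κ : ℕ → ℂ) {a b : ℕ} (h : b ≤ a) :
    diag n q κ (z n q a b) = (κ a * κ b) • z n q a b := by
  rw [← zt_of_le h, diag_zt]

theorem algHom_ext {B : Type*} [Ring B] [Algebra ℂ B] {f g : Cp n q →ₐ[ℂ] B}
    (h : ∀ i j, 1 ≤ j → j ≤ i → i ≤ n → f (z n q i j) = g (z n q i j)) : f = g := by
  ext u
  induction u using induction with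
  | hc c => simp
  | hz i j h1 h2 h3 => exact h i j h1 h2 h3
  | hadd a b ha hb => rw [map_add, map_add, ha, hb]
  | hmul a b ha hb => rw [map_mul, map_mul, ha, hb]

theorem diag_comm (κ κ' : ℕ → ℂ) (u : Cp n q) :
    diag n q κ (diag n q κ' u) = diag n q κ' (diag n q κ u) := by
  refine DFunLike.congr_fun (f := (diag n q κ).comp (diag n q κ'))
    (g := (diag n q κ').comp (diag n q κ)) (algHom_ext fun i j _ h _ => ?_) u
  simp only [AlgHom.comp_apply, diag_z _ h, map_smul, smul_smul, mul_comm]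

theorem diag_diag_inv {κ κ' : ℕ → ℂ} (h : ∀ a, κ a * κ' a = 1) (u : Cp n q) :
    diag n q κ (diag n q κ' u) = u := by
  refine DFunLike.congr_fun (f := (diag n q κ).comp (diag n q κ'))
    (g := AlgHom.id ℂ _) (algHom_ext fun i j _ hij _ => ?_) u
  simp only [AlgHom.comp_apply, diag_z _ hij, map_smul, smul_smul, AlgHom.id_apply]
  rw [mul_mul_mul_comm, mul_comm (κ' i), mul_comm (κ' j), h, h, one_mul, one_smul]

/-- The bilinear map `x_a ⊗ x_b ↦ z_{ab}`. -/
def pairing (n : ℕ) (q : Set.Ioo (0 : ℝ) 1) : Vec →ₗ[ℂ] Vec →ₗ[ℂ] Cp n q :=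
  Finsupp.linearCombination ℂ (fun a => Finsupp.linearCombination ℂ (fun b => zt n q a b))

theorem pairing_x (a b : ℕ) : pairing n q (Vec.x a) (Vec.x b) = zt n q a b := by
  simp [pairing, Vec.x]

theorem isSkewL_pairing {κ : ℕ → ℂ} {s t : ℕ} {c : ℂ} {D : Module.End ℂ (Cp n q)}
    (h : ∀ a b, D (zt n q a b) = c • shiftL s t κ (zt n q) a b) :
    IsSkewL (pairing n q) (Vec.diag κ) (c • Vec.shift s t) D := by
  have e : (pairing n q).compr₂ D = (pairing n q).compl₁₂ (c • Vec.shift s t) LinearMap.id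
      + (pairing n q).compl₁₂ (Vec.diag κ) (c • Vec.shift s t) := by
    refine Vec.ext₂ fun a b => ?_
    simp only [LinearMap.compr₂_apply, LinearMap.add_apply, LinearMap.compl₁₂_apply,
      LinearMap.smul_apply, LinearMap.id_apply, Vec.shift_x, Vec.diag_x, pairing_x, h, shiftL]
    split_ifs <;> simp [pairing_x]
  exact fun u v => LinearMap.congr_fun₂ e u v

theorem isSkewR_pairing {κ : ℕ → ℂ} {s t : ℕ} {c : ℂ} {D : Module.End ℂ (Cp n q)}
    (h : ∀ a b, D (zt n q a b) = c • shiftR s t κ (zt n q) a b) :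
    IsSkewR (pairing n q) (Vec.diag κ) (c • Vec.shift s t) D := by
  have e : (pairing n q).compr₂ D = (pairing n q).compl₁₂ (c • Vec.shift s t) (Vec.diag κ)
      + (pairing n q).compl₁₂ LinearMap.id (c • Vec.shift s t) := by
    refine Vec.ext₂ fun a b => ?_
    simp only [LinearMap.compr₂_apply, LinearMap.add_apply, LinearMap.compl₁₂_apply,
      LinearMap.smul_apply, LinearMap.id_apply, Vec.shift_x, Vec.diag_x, pairing_x, h, shiftR]
    split_ifs <;> simp [pairing_x] <;> module
  exact fun u v => LinearMap.congr_fun₂ e u v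

theorem diag_pairing (κ : ℕ → ℂ) (u v : Vec) :
    diag n q κ (pairing n q u v) = pairing n q (Vec.diag κ u) (Vec.diag κ v) := by
  have e : (pairing n q).compr₂ (diag n q κ).toLinearMap
      = (pairing n q).compl₁₂ (Vec.diag κ) (Vec.diag κ) := by
    refine Vec.ext₂ fun a b => ?_
    simp only [LinearMap.compr₂_apply, LinearMap.compl₁₂_apply, Vec.diag_x, map_smul,
      LinearMap.smul_apply, pairing_x, AlgHom.toLinearMap_apply, diag_zt, smul_smul, mul_comm]
  exact LinearMap.congr_fun₂ e u v

/-- The action of `E_k` for `k < n`. -/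
theorem exists_raise {k : ℕ} (hk : 1 ≤ k) (hkn : k < n) : ∃ D : Module.End ℂ (Cp n q),
    IsSkewL (LinearMap.mul ℂ (Cp n q)) (diag n q (wt n q k)).toLinearMap D D ∧
    ∀ a b, D (zt n q a b) = (qHalf q)⁻¹ • shiftL (k + 1) k (wt n q k) (zt n q) a b := by
  have hQ := generic_qC q
  have hZ := isQSymm_zt n q
  have hκ := wt_isWeight (q := q) hkn
  obtain ⟨D, hD, hz⟩ := exists_skewDer (diag n q (wt n q k)) (AlgHom.id ℂ _)
    (fun a b => shiftL (k + 1) k (wt n q k) (zt n q) a b)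
    (hZ.skewMat_left hQ hκ rfl) (fun i j _ h _ => by rw [diag_z _ h, zt_of_le h]; rfl)
  -- The shifted family is again `q`-symmetric, so the formula for `D` extends from `b ≤ a` to all
  -- pairs of indices.
  have hs : braid (qC q) (shiftL (k + 1) k (wt n q k) (zt n q))
      = qC q • shiftL (k + 1) k (wt n q k) (zt n q) := by
    rw [braid_shiftL hQ.ne_zero hκ rfl, hZ.braid_eq hQ.ne_zero]
    funext a b
    simp only [shiftL, Pi.smul_apply]
    split_ifs <;> module
  have key : ∀ a b, b ≤ a → D (zt n q a b) = shiftL (k + 1) k (wt n q k) (zt n q) a b := by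
    intro a b h
    by_cases hr : 1 ≤ b ∧ a ≤ n
    · rw [zt_of_le h, hz a b hr.1 h hr.2]
    -- An index outside `1, …, n` is not `k + 1`, so the shift leaves it in place and all terms are
    -- `0`.
    · rw [zt_eq_zero (by omega), map_zero, shiftL]
      split_ifs <;> simp (disch := omega) [zt_eq_zero]
  refine ⟨(qHalf q)⁻¹ • D, fun u v => ?_, fun a b => ?_⟩
  · have := hD u v
    simp only [LinearMap.mul_apply', LinearMap.smul_apply, this, AlgHom.toLinearMap_apply,
      AlgHom.id_apply, smul_add, smul_mul_assoc, mul_smul_comm]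
    abel
  · rw [LinearMap.smul_apply]
    congr 1
    rcases le_or_gt b a with h | h
    · exact key a b h
    · rw [hZ.symm h, map_smul, key b a h.le, symm_of_braid_eq hs h]

/-- The action of `F_k` for `k < n`. -/
theorem exists_lower {k : ℕ} (hk : 1 ≤ k) (hkn : k < n) : ∃ D : Module.End ℂ (Cp n q),
    IsSkewR (LinearMap.mul ℂ (Cp n q)) (diag n q (fun a => (wt n q k a)⁻¹)).toLinearMap D D ∧
    ∀ a b, D (zt n q a b) = qHalf q • shiftR k (k + 1) (fun a => (wt n q k a)⁻¹) (zt n q) a b := by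
  have hQ := generic_qC q
  have hZ := isQSymm_zt n q
  have hκ := wt_inv_isWeight (q := q) hkn
  obtain ⟨D, hD, hz⟩ := exists_skewDer (AlgHom.id ℂ _) (diag n q (fun a => (wt n q k a)⁻¹))
    (fun a b => shiftR k (k + 1) (fun a => (wt n q k a)⁻¹) (zt n q) a b)
    (hZ.skewMat_right hQ hκ rfl) (fun i j _ h _ => by rw [diag_z _ h, zt_of_le h]; rfl)
  have hs : braid (qC q) (shiftR k (k + 1) (fun a => (wt n q k a)⁻¹) (zt n q))
      = qC q • shiftR k (k + 1) (fun a => (wt n q k a)⁻¹) (zt n q) := by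
    rw [braid_shiftR hQ.ne_zero hκ rfl, hZ.braid_eq hQ.ne_zero]
    funext a b
    simp only [shiftR, Pi.smul_apply]
    split_ifs <;> module
  have key : ∀ a b, b ≤ a →
      D (zt n q a b) = shiftR k (k + 1) (fun a => (wt n q k a)⁻¹) (zt n q) a b := by
    intro a b h
    by_cases hr : 1 ≤ b ∧ a ≤ n
    · rw [zt_of_le h, hz a b hr.1 h hr.2]
    · rw [zt_eq_zero (by omega), map_zero, shiftR]
      split_ifs <;> simp (disch := omega) [zt_eq_zero]
  refine ⟨qHalf q • D, fun u v => ?_, fun a b => ?_⟩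
  · have := hD u v
    simp only [LinearMap.mul_apply', LinearMap.smul_apply, this, AlgHom.toLinearMap_apply,
      AlgHom.id_apply, smul_add, smul_mul_assoc, mul_smul_comm]
    abel
  · rw [LinearMap.smul_apply]
    congr 1
    rcases le_or_gt b a with h | h
    · exact key a b h
    · rw [hZ.symm h, map_smul, key b a h.le, symm_of_braid_eq hs h]

/-- The action of `F_n`. -/
theorem exists_lower_top (hn : 1 ≤ n) (q : Set.Ioo (0 : ℝ) 1) : ∃ D : Module.End ℂ (Cp n q),
    IsSkewR (LinearMap.mul ℂ (Cp n q)) (diag n q (fun a => (wt n q n a)⁻¹)).toLinearMap D D ∧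
    ∀ a b, D (zt n q a b) = if a = n ∧ b = n then qC q • (1 : Cp n q) else 0 := by
  have hQ := generic_qC q
  have hZ := isQSymm_zt n q
  obtain ⟨D, hD, hz⟩ := exists_skewDer (AlgHom.id ℂ _) (diag n q (fun a => (wt n q n a)⁻¹))
    (fun a b => if a = n ∧ b = n then qC q • (1 : Cp n q) else 0)
    (hZ.skewMat_top hQ (n := n) (fun a b h => zt_eq_zero (by omega)) (qC q)
      (κ := fun a => (wt n q n a)⁻¹) (by simp [wt]) (fun a h => by simp [wt, h]))
    (fun i j _ h _ => by rw [diag_z _ h, zt_of_le h]; rfl)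
  have key : ∀ a b, b ≤ a → D (zt n q a b) = if a = n ∧ b = n then qC q • (1 : Cp n q) else 0 := by
    intro a b h
    by_cases hr : 1 ≤ b ∧ a ≤ n
    · rw [zt_of_le h, hz a b hr.1 h hr.2]
    · rw [zt_eq_zero (by omega), map_zero, if_neg (by omega)]
  refine ⟨D, fun u v => ?_, fun a b => ?_⟩
  · rw [LinearMap.mul_apply', hD u v, add_comm]
    rfl
  · rcases le_or_gt b a with h | h
    · exact key a b h
    · rw [hZ.symm h, map_smul, key b a h.le, if_neg (by omega), if_neg (by omega), smul_zero]

/-- The action of `E_n`: an inner skew derivation. -/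
def raiseTop (n : ℕ) (q : Set.Ioo (0 : ℝ) 1) : Module.End ℂ (Cp n q) :=
  -- For `i < n` the relations `r6` and `r8`, followed by `r3`, give `z_{ij} z_{nn} - z_{nn} z_{ij}
  -- = q (q² - q⁻²) z_{ni} z_{nj}`. The scalar normalizes this to the prescribed `E_n z_{ij} =
  -- -z_{ni} z_{nj}`.
  (qC q * (qC q ^ 2 - (qC q)⁻¹ ^ 2))⁻¹ •
    (LinearMap.mulLeft ℂ (z n q n n)
      - LinearMap.mulRight ℂ (z n q n n) * (diag n q (wt n q n)).toLinearMap)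

end Cp

theorem qHalf_ne_zero (q : Set.Ioo (0 : ℝ) 1) : qHalf q ≠ 0 := by
  have := (Real.sqrt_pos.2 q.2.1).ne'
  simpa [qHalf] using this

/-! ### The operators attached to the generators of `U_q sp_{2n}` -/

namespace Cp

variable {n : ℕ} {q : Set.Ioo (0 : ℝ) 1}

/-- The action of `K_i`. -/
def opK (q : Set.Ioo (0 : ℝ) 1) (i : Idx n) : Module.End ℂ (Cp n q) :=
  (diag n q (wt n q i)).toLinearMap

/-- The action of `K_i⁻¹`. -/
def opKinv (q : Set.Ioo (0 : ℝ) 1) (i : Idx n) : Module.End ℂ (Cp n q) :=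
  (diag n q (fun a => (wt n q i a)⁻¹)).toLinearMap

/-- The action of `E_i`. -/
def opE (q : Set.Ioo (0 : ℝ) 1) (i : Idx n) : Module.End ℂ (Cp n q) :=
  if h : (i : ℕ) < n then (exists_raise i.2.1 h).choose else raiseTop n q

/-- The action of `F_i`. -/
def opF (q : Set.Ioo (0 : ℝ) 1) (i : Idx n) : Module.End ℂ (Cp n q) :=
  if h : (i : ℕ) < n then (exists_lower i.2.1 h).choose
  else (exists_lower_top (i.2.1.trans i.2.2) q).choose

theorem eq_top {i : Idx n} (h : ¬(i : ℕ) < n) : (i : ℕ) = n := le_antisymm i.2.2 (not_lt.1 h)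

theorem opK_mul (i : Idx n) (u v : Cp n q) : opK q i (u * v) = opK q i u * opK q i v :=
  map_mul (diag n q (wt n q i)) u v

theorem opKinv_mul (i : Idx n) (u v : Cp n q) :
    opKinv q i (u * v) = opKinv q i u * opKinv q i v :=
  map_mul (diag n q (fun a => (wt n q i a)⁻¹)) u v

theorem opK_one (i : Idx n) : opK q i 1 = 1 := map_one (diag n q (wt n q i))

theorem opKinv_one (i : Idx n) : opKinv q i 1 = 1 := map_one (diag n q (fun a => (wt n q i a)⁻¹))

theorem opK_zt (i : Idx n) (a b : ℕ) :
    opK q i (zt n q a b) = (wt n q i a * wt n q i b) • zt n q a b := diag_zt _ _ _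

theorem opKinv_zt (i : Idx n) (a b : ℕ) :
    opKinv q i (zt n q a b) = ((wt n q i a)⁻¹ * (wt n q i b)⁻¹) • zt n q a b := diag_zt _ _ _

theorem opE_zt {i : Idx n} (h : (i : ℕ) < n) (a b : ℕ) : opE q i (zt n q a b) =
    (qHalf q)⁻¹ • shiftL (i + 1) i (wt n q i) (zt n q) a b := by
  rw [opE, dif_pos h]
  exact (exists_raise i.2.1 h).choose_spec.2 a b

theorem opF_zt {i : Idx n} (h : (i : ℕ) < n) (a b : ℕ) : opF q i (zt n q a b) =
    qHalf q • shiftR i (i + 1) (fun a => (wt n q i a)⁻¹) (zt n q) a b := by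
  rw [opF, dif_pos h]
  exact (exists_lower i.2.1 h).choose_spec.2 a b

theorem opF_top_zt {i : Idx n} (h : (i : ℕ) = n) (a b : ℕ) : opF q i (zt n q a b) =
    if a = n ∧ b = n then qC q • (1 : Cp n q) else 0 := by
  rw [opF, dif_neg h.not_lt]
  exact (exists_lower_top (i.2.1.trans i.2.2) q).choose_spec.2 a b

theorem opE_top {i : Idx n} (h : (i : ℕ) = n) (u : Cp n q) : opE q i u =
    (qC q * (qC q ^ 2 - (qC q)⁻¹ ^ 2))⁻¹ • (zt n q n n * u - opK q i u * zt n q n n) := by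
  rw [opE, dif_neg h.not_lt, zt_of_le le_rfl, opK, h]
  rfl

theorem isSkewL_opE (i : Idx n) :
    IsSkewL (LinearMap.mul ℂ (Cp n q)) (opK q i) (opE q i) (opE q i) := by
  by_cases h : (i : ℕ) < n
  · have := (exists_raise (q := q) i.2.1 h).choose_spec.1
    rwa [opE, dif_pos h]
  · intro u v
    simp only [LinearMap.mul_apply', opE_top (eq_top h), opK_mul, smul_mul_assoc, mul_smul_comm,
      ← smul_add, sub_mul, mul_sub, mul_assoc]
    congr 1
    abel

theorem isSkewR_opF (i : Idx n) :
    IsSkewR (LinearMap.mul ℂ (Cp n q)) (opKinv q i) (opF q i) (opF q i) := by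
  by_cases h : (i : ℕ) < n
  · have := (exists_lower (q := q) i.2.1 h).choose_spec.1
    rwa [opF, dif_pos h]
  · have := (exists_lower_top (i.2.1.trans i.2.2) q).choose_spec.1
    rw [opF, dif_neg h, opKinv]
    rwa [eq_top h]

theorem opE_mul (i : Idx n) (u v : Cp n q) :
    opE q i (u * v) = opE q i u * v + opK q i u * opE q i v := isSkewL_opE i u v

theorem opF_mul (i : Idx n) (u v : Cp n q) :
    opF q i (u * v) = opF q i u * opKinv q i v + u * opF q i v := isSkewR_opF i u v

theorem skewL_one {k x : Module.End ℂ (Cp n q)} (hk : k 1 = 1)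
    (hx : IsSkewL (LinearMap.mul ℂ (Cp n q)) k x x) : x 1 = 0 := by
  simpa [hk] using hx 1 1

theorem skewR_one {k x : Module.End ℂ (Cp n q)} (hk : k 1 = 1)
    (hx : IsSkewR (LinearMap.mul ℂ (Cp n q)) k x x) : x 1 = 0 := by
  simpa [hk] using hx 1 1

theorem opE_one (i : Idx n) : opE q i 1 = 0 := skewL_one (opK_one i) (isSkewL_opE i)

theorem opF_one (i : Idx n) : opF q i 1 = 0 := skewR_one (opKinv_one i) (isSkewR_opF i)

theorem skewL_eq_zero {k x : Module.End ℂ (Cp n q)} (hk : k 1 = 1)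
    (hx : IsSkewL (LinearMap.mul ℂ (Cp n q)) k x x) (hz : ∀ a b, x (zt n q a b) = 0) : x = 0 :=
  skewDer_ext (α := k) (β := id) (D' := 0)
    (fun a b => by rw [add_comm]; exact hx a b) (fun _ _ => by simp) (by simp [skewL_one hk hx])
    (fun i j _ h _ => by rw [← zt_of_le h, hz]; rfl)

theorem skewR_eq_zero {k x : Module.End ℂ (Cp n q)} (hk : k 1 = 1)
    (hx : IsSkewR (LinearMap.mul ℂ (Cp n q)) k x x) (hz : ∀ a b, x (zt n q a b) = 0) : x = 0 :=
  skewDer_ext (α := id) (β := k) (D' := 0)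
    (fun a b => by rw [add_comm]; exact hx a b) (fun _ _ => by simp) (by simp [skewR_one hk hx])
    (fun i j _ h _ => by rw [← zt_of_le h, hz]; rfl)

/-! ### The relations between the `K_i` and the other generators -/

theorem opK_comm (i j : Idx n) : opK q i * opK q j = opK q j * opK q i :=
  LinearMap.ext fun u => diag_comm _ _ u

theorem opKinv_comm (i j : Idx n) : opKinv q i * opKinv q j = opKinv q j * opKinv q i :=
  LinearMap.ext fun u => diag_comm _ _ u

theorem opK_opK (i j : Idx n) (u : Cp n q) : opK q i (opK q j u) = opK q j (opK q i u) :=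
  diag_comm _ _ u

theorem opK_opKinv (i j : Idx n) (u : Cp n q) : opK q i (opKinv q j u) = opKinv q j (opK q i u) :=
  diag_comm _ _ u

theorem opK_mul_opKinv (i : Idx n) : opK q i * opKinv q i = 1 :=
  LinearMap.ext fun u => diag_diag_inv (fun _ => mul_inv_cancel₀ (wt_ne_zero _ _)) u

theorem opKinv_mul_opK (i : Idx n) : opKinv q i * opK q i = 1 :=
  LinearMap.ext fun u => diag_diag_inv (fun _ => inv_mul_cancel₀ (wt_ne_zero _ _)) u

/-- The exponential of a Cartan entry. -/
def qCartan (q : Set.Ioo (0 : ℝ) 1) (i j : Idx n) : ℂ :=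
  qC q ^ ((symm n i : ℤ) * cartan n i j)

theorem qCartan_ne_zero (i j : Idx n) : qCartan q i j ≠ 0 := zpow_ne_zero _ (qC_ne_zero q)

theorem qCartan_comm (i j : Idx n) : qCartan q i j = qCartan q j i := by
  rw [qCartan, symm_mul_cartan, qCartan]

theorem wt_eq (i j : Idx n) (hj : (j : ℕ) < n) :
    wt n q i j = qCartan q i j * wt n q i (j + 1) := wt_shift i j hj

theorem wt_top_eq (i : Idx n) {j : Idx n} (hj : (j : ℕ) = n) :
    wt n q i n * wt n q i n = qCartan q i j := by
  rw [wt_top, qCartan, hj]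

/-- For `j < n` both sides are skew derivations of one type, and they are compared on the
generators. For `j = n` the inner formula and the weight of `z_{nn}` give the identity on all
elements. -/
theorem opK_mul_opE (i j : Idx n) :
    opK q i * opE q j = qCartan q i j • (opE q j * opK q i) := by
  by_cases h : (j : ℕ) < n
  · refine skewDer_ext (α := fun a => opK q i (opK q j a)) (β := opK q i) (fun a b => ?_) (fun a b => ?_) ?_
      (fun a b _ hab _ => ?_)
    · simp only [Module.End.mul_apply, opE_mul, map_add, opK_mul]
      abel
    · simp only [Module.End.mul_apply, LinearMap.smul_apply, opE_mul, map_add, opK_mul, smul_add,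
        smul_mul_assoc, mul_smul_comm, opK_opK j i]
      abel
    · simp [opE_one, opK_one]
    · simp only [← zt_of_le hab, Module.End.mul_apply, LinearMap.smul_apply, opE_zt h, opK_zt,
        map_smul, shiftL]
      have e := wt_eq (q := q) i j h
      split_ifs with h1 h2 h2 <;> simp only [map_add, map_smul, map_zero, opK_zt, h1, h2, e] <;>
        module
  · have h := eq_top h
    ext u
    simp only [Module.End.mul_apply, LinearMap.smul_apply, opE_top h, map_smul, map_sub, opK_mul,
      opK_zt, wt_top_eq i h, smul_mul_assoc, mul_smul_comm, opK_opK i j]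
    module

theorem opK_mul_opF (i j : Idx n) :
    opK q i * opF q j = (qCartan q i j)⁻¹ • (opF q j * opK q i) := by
  have h0 := qCartan_ne_zero (q := q) i j
  refine skewDer_ext (α := opK q i) (β := fun a => opK q i (opKinv q j a)) (fun a b => ?_) (fun a b => ?_) ?_
    (fun a b _ hab _ => ?_)
  · simp only [Module.End.mul_apply, opF_mul, map_add, opK_mul]
    abel
  · simp only [Module.End.mul_apply, LinearMap.smul_apply, opF_mul, map_add, opK_mul, smul_add,
      smul_mul_assoc, mul_smul_comm, opK_opKinv i j]
    abel
  · simp [opF_one, opK_one]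
  · by_cases h : (j : ℕ) < n
    · simp only [← zt_of_le hab, Module.End.mul_apply, LinearMap.smul_apply, opF_zt h, opK_zt,
        map_smul, shiftR]
      have e := wt_eq (q := q) i j h
      split_ifs with h1 h2 h2 <;> simp only [map_add, map_smul, map_zero, opK_zt, h1, h2, e] <;>
        match_scalars <;> field_simp
    · have h := eq_top h
      simp only [← zt_of_le hab, Module.End.mul_apply, LinearMap.smul_apply, opF_top_zt h, opK_zt,
        map_smul]
      split_ifs with h1
      · simp only [h1, map_smul, opK_one, wt_top_eq i h]
        match_scalars
        field_simp
      · simp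

theorem opE_mul_opKinv (i j : Idx n) :
    opE q j * opKinv q i = qCartan q i j • (opKinv q i * opE q j) :=
  Uq.comm_inv (opK_mul_opKinv i) (opKinv_mul_opK i) (opK_mul_opE i j)

theorem opF_mul_opKinv (i j : Idx n) :
    opF q j * opKinv q i = (qCartan q i j)⁻¹ • (opKinv q i * opF q j) :=
  Uq.comm_inv (opK_mul_opKinv i) (opKinv_mul_opK i) (opK_mul_opF i j)

theorem opF_mul_opK (i j : Idx n) :
    opF q j * opK q i = qCartan q i j • (opK q i * opF q j) := by
  rw [opK_mul_opF, smul_smul, mul_inv_cancel₀ (qCartan_ne_zero i j), one_smul]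

/-! ### The vector representation -/

/-- The action of `K_i` on the vector representation. -/
def vecK (q : Set.Ioo (0 : ℝ) 1) (i : Idx n) : Module.End ℂ Vec := Vec.diag (wt n q i)

/-- The action of `K_i⁻¹` on the vector representation. -/
def vecKinv (q : Set.Ioo (0 : ℝ) 1) (i : Idx n) : Module.End ℂ Vec :=
  Vec.diag (fun a => (wt n q i a)⁻¹)

/-- The action of `E_i`, `i < n`, on the vector representation. -/
def vecE (q : Set.Ioo (0 : ℝ) 1) (i : Idx n) : Module.End ℂ Vec :=
  (qHalf q)⁻¹ • Vec.shift (i + 1) i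

/-- The action of `F_i`, `i < n`, on the vector representation. -/
def vecF (q : Set.Ioo (0 : ℝ) 1) (i : Idx n) : Module.End ℂ Vec :=
  qHalf q • Vec.shift i (i + 1)

theorem isSkewL_vecE {i : Idx n} (h : (i : ℕ) < n) :
    IsSkewL (pairing n q) (vecK q i) (vecE q i) (opE q i) := isSkewL_pairing (opE_zt h)

theorem isSkewR_vecF {i : Idx n} (h : (i : ℕ) < n) :
    IsSkewR (pairing n q) (vecKinv q i) (vecF q i) (opF q i) := isSkewR_pairing (opF_zt h)

theorem vecK_mul_vecE (i : Idx n) {j : Idx n} (h : (j : ℕ) < n) :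
    vecK q i * vecE q j = qCartan q i j • (vecE q j * vecK q i) := by
  simp only [vecK, vecE, mul_smul_comm, smul_mul_assoc, Vec.diag_mul_shift, Vec.shift_mul_diag,
    wt_eq i j h]
  module

theorem vecF_mul_vecK (i : Idx n) {j : Idx n} (h : (j : ℕ) < n) :
    vecF q j * vecK q i = qCartan q i j • (vecK q i * vecF q j) := by
  simp only [vecK, vecF, mul_smul_comm, smul_mul_assoc, Vec.diag_mul_shift, Vec.shift_mul_diag,
    wt_eq i j h]
  module

theorem vecE_mul_vecKinv (i : Idx n) {j : Idx n} (h : (j : ℕ) < n) :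
    vecE q j * vecKinv q i = qCartan q i j • (vecKinv q i * vecE q j) := by
  have h0 := qCartan_ne_zero (q := q) i j
  have h1 := wt_ne_zero (n := n) (q := q) i (j + 1)
  simp only [vecKinv, vecE, mul_smul_comm, smul_mul_assoc, Vec.diag_mul_shift, Vec.shift_mul_diag,
    wt_eq i j h]
  match_scalars
  field_simp

theorem vecF_mul_vecKinv (i : Idx n) {j : Idx n} (h : (j : ℕ) < n) :
    vecF q j * vecKinv q i = (qCartan q i j)⁻¹ • (vecKinv q i * vecF q j) := by
  have h0 := qCartan_ne_zero (q := q) i j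
  have h1 := wt_ne_zero (n := n) (q := q) i (j + 1)
  simp only [vecKinv, vecF, mul_smul_comm, smul_mul_assoc, Vec.diag_mul_shift, Vec.shift_mul_diag,
    wt_eq i j h]
  match_scalars
  field_simp

theorem vec_commutator_ne {i j : Idx n} (h : i ≠ j) :
    vecE q i * vecF q j - vecF q j * vecE q i = 0 := by
  have h' : (i : ℕ) ≠ j := fun e => h (Subtype.ext e)
  refine sub_eq_zero_of_eq (G := Module.End ℂ Vec) ?_
  simp only [vecE, vecF, smul_mul_smul_comm, Vec.shift_mul_shift]
  rw [if_neg (by omega), if_neg (by omega), smul_zero, smul_zero]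

theorem vec_commutator_self {i : Idx n} (h : (i : ℕ) < n) :
    vecE q i * vecF q i - vecF q i * vecE q i =
      (qC q - (qC q)⁻¹)⁻¹ • (vecK q i - vecKinv q i) := by
  have h0 := qHalf_ne_zero q
  have h1 := (generic_qC q).h1
  simp only [vecE, vecF, smul_mul_smul_comm, Vec.shift_mul_shift, if_true]
  -- The normalizations `q^{-1/2}` of `E_i` and `q^{1/2}` of `F_i` cancel. What remains is `1` on
  -- `x_i`, `-1` on `x_{i+1}` and `0` on the other basis vectors.
  rw [inv_mul_cancel₀ h0, mul_inv_cancel₀ h0, one_smul, one_smul]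
  refine Vec.ext fun a => ?_
  simp only [LinearMap.sub_apply, LinearMap.smul_apply, Vec.shift_x, vecK, vecKinv, Vec.diag_x, wt,
    if_neg h.ne]
  by_cases ha : a = i
  · subst ha
    simp only [if_true, if_neg (Nat.succ_ne_self _).symm, ← sub_smul, smul_smul,
      inv_mul_cancel₀ h1, sub_zero, one_smul]
  · by_cases hb : a = i + 1
    · subst hb
      simp only [if_true, if_neg (Nat.succ_ne_self _), ← sub_smul, smul_smul, zero_sub, inv_inv]
      rw [← neg_sub (qC q), mul_neg, inv_mul_cancel₀ h1, neg_one_smul]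
    · simp [ha, hb]

/-! ### The commutators of `E_i` and `F_j` -/

/-- `F_n z_{ab}` is a scalar, which `E_i` kills. Conversely, `E_i` replaces an index by `i < n`, so
`E_i z_{ab}` has no `z_{nn}` for `F_n` to act on. -/
theorem opE_opF_top_zt {i j : Idx n} (hi : (i : ℕ) < n) (hj : (j : ℕ) = n) (a b : ℕ) :
    (opE q i * opF q j - opF q j * opE q i) (zt n q a b) = 0 := by
  simp only [LinearMap.sub_apply, Module.End.mul_apply, opF_top_zt hj, opE_zt hi, shiftL]
  have e1 : opE q i (if a = n ∧ b = n then qC q • (1 : Cp n q) else 0) = 0 := by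
    split_ifs <;> simp [opE_one]
  rw [e1]
  split_ifs <;> simp (disch := omega) only [map_smul, map_add, map_zero, opF_top_zt hj, if_neg] <;>
    simp

/-- When the product rule of `F_j` is applied to the inner formula, the terms in which `F_j` acts on
`u` cancel, and only `F_j z_{nn}` is left. This is `0` for `j < n` and the scalar `q` for `j = n`.
-/
theorem opE_top_opF {i : Idx n} (hi : (i : ℕ) = n) (j : Idx n) (u : Cp n q) :
    (opE q i * opF q j - opF q j * opE q i) u = (qC q * (qC q ^ 2 - (qC q)⁻¹ ^ 2))⁻¹ •
      (opK q i u * opF q j (zt n q n n) - opF q j (zt n q n n) * opKinv q j u) := by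
  have e : opF q j (opK q i u) = qCartan q i j • opK q i (opF q j u) :=
    LinearMap.congr_fun (opF_mul_opK i j) u
  have h0 := qCartan_ne_zero (q := q) j i
  have e2 : (wt n q j n)⁻¹ * (wt n q j n)⁻¹ = (qCartan q j i)⁻¹ := by
    rw [← mul_inv, wt_top_eq j hi]
  simp only [LinearMap.sub_apply, Module.End.mul_apply, opE_top hi, map_smul, map_sub, opF_mul, e,
    opKinv_zt, e2, qCartan_comm i j, smul_mul_assoc, mul_smul_comm, smul_smul,
    inv_mul_cancel₀ h0, mul_inv_cancel₀ h0, one_smul, ← smul_sub]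
  congr 1
  abel

theorem commutator_skew (i j : Idx n) (u v : Cp n q) :
    (opE q i * opF q j - opF q j * opE q i) (u * v) =
      opK q i u * (opE q i * opF q j - opF q j * opE q i) v +
      (opE q i * opF q j - opF q j * opE q i) u * opKinv q j v := by
  rw [add_comm]
  exact (isSkewL_opE i).commutator (isSkewR_opF j) (opF_mul_opK i j)
    (by rw [opE_mul_opKinv, qCartan_comm]) u v

theorem commutator_ne {i j : Idx n} (h : i ≠ j) : opE q i * opF q j - opF q j * opE q i = 0 := by
  by_cases hi : (i : ℕ) < n
  · refine skewDer_ext (α := opK q i) (β := opKinv q j) (commutator_skew i j)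
      (fun a b => by simp) (by simp [opE_one, opF_one]) (fun a b _ hab _ => ?_)
    rw [← zt_of_le hab, LinearMap.zero_apply]
    by_cases hj : (j : ℕ) < n
    · have := (isSkewL_vecE (q := q) hi).commutator (isSkewR_vecF hj) (vecF_mul_vecK i hj)
        (by rw [vecE_mul_vecKinv j hi, qCartan_comm]) (Vec.x a) (Vec.x b)
      rw [pairing_x, vec_commutator_ne h] at this
      simpa using this
    · exact opE_opF_top_zt hi (eq_top hj) a b
  · have hi := eq_top hi
    have hj : (j : ℕ) < n := by
      by_contra hj
      exact h (Subtype.ext (hi.trans (eq_top hj).symm))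
    have e : opF q j (zt n q n n) = 0 := by
      simp [opF_zt hj, shiftR, hj.ne']
    ext u
    rw [opE_top_opF hi, e]
    simp

theorem commutator_self (i : Idx n) : opE q i * opF q i - opF q i * opE q i =
    (qC q ^ symm n i - (qC q ^ symm n i)⁻¹)⁻¹ • (opK q i - opKinv q i) := by
  have h1 := (generic_qC q).h1
  by_cases hi : (i : ℕ) < n
  · rw [symm, if_neg hi.ne, pow_one]
    refine skewDer_ext (α := opK q i) (β := opKinv q i) (commutator_skew i i)
      (fun a b => ?_) (by simp [opE_one, opF_one, opK_one, opKinv_one]) (fun a b _ hab _ => ?_)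
    · simp only [LinearMap.smul_apply, LinearMap.sub_apply, opK_mul, opKinv_mul, mul_smul_comm,
        smul_mul_assoc, mul_sub, sub_mul, ← smul_add]
      congr 1
      abel
    · have := (isSkewL_vecE (q := q) hi).commutator (isSkewR_vecF hi) (vecF_mul_vecK i hi)
        (vecE_mul_vecKinv i hi) (Vec.x a) (Vec.x b)
      rw [← zt_of_le hab, ← pairing_x, this, vec_commutator_self hi]
      have e1 : opK q i (pairing n q (Vec.x a) (Vec.x b)) =
          pairing n q (vecK q i (Vec.x a)) (vecK q i (Vec.x b)) := diag_pairing _ _ _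
      have e2 : opKinv q i (pairing n q (Vec.x a) (Vec.x b)) =
          pairing n q (vecKinv q i (Vec.x a)) (vecKinv q i (Vec.x b)) := diag_pairing _ _ _
      simp only [LinearMap.smul_apply, LinearMap.sub_apply, map_smul, map_sub, e1, e2, ← smul_add]
      congr 1
      abel
  · have hi := eq_top hi
    have h0 := qC_ne_zero q
    ext u
    rw [opE_top_opF hi, opF_top_zt hi, symm, if_pos hi]
    simp only [and_self, if_true, mul_smul_comm, smul_mul_assoc, mul_one, one_mul, ← smul_sub,
      smul_smul, LinearMap.smul_apply, LinearMap.sub_apply]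
    congr 1
    rw [mul_inv, mul_comm, ← mul_assoc, mul_inv_cancel₀ h0, one_mul, inv_pow]

/-! ### The Serre relations -/

theorem qCartan_self (i : Idx n) : qCartan q i i = (qC q ^ symm n i) ^ 2 := Uq.qpow_self i

theorem qCartan_eq {i j : Idx n} {r : ℕ} (h : cartan n i j = 1 - r) :
    qCartan q i j = (qC q ^ symm n i) ^ (1 - r : ℤ) := by
  rw [qCartan, zpow_mul, zpow_natCast, h]

theorem pow_mul_apply_one {k l : Module.End ℂ (Cp n q)} (hk : k 1 = 1) (hl : l 1 = 1) (r : ℕ) :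
    (k ^ r * l) 1 = 1 := by
  rw [Module.End.mul_apply, hl, Module.End.pow_apply, Function.iterate_fixed hk]

/-- The Serre expression is a skew derivation twisted by `K_i ^ r * K_j`, and so it is `0` if it
kills the generators. -/
theorem serre_E_of_zt {i j : Idx n} {r : ℕ} (hc : cartan n i j = 1 - r)
    (hr : r = 1 ∨ r = 2 ∨ r = 3)
    (hz : ∀ a b, qSerre (qC q ^ symm n i) r (opE q i) (opE q j) (zt n q a b) = 0) :
    qSerre (qC q ^ symm n i) r (opE q i) (opE q j) = 0 :=
  skewL_eq_zero (pow_mul_apply_one (opK_one i) (opK_one j) r)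
    ((isSkewL_opE i).qSerre (generic_pow q (symm_ne_zero n i)) hr (qCartan_eq hc) (isSkewL_opE j)
      (opK_comm j i) (by rw [opK_mul_opE, qCartan_self]) (opK_mul_opE i j)
      (by rw [opK_mul_opE, qCartan_comm])) hz

theorem serre_F_of_zt {i j : Idx n} {r : ℕ} (hc : cartan n i j = 1 - r)
    (hr : r = 1 ∨ r = 2 ∨ r = 3)
    (hz : ∀ a b, qSerre (qC q ^ symm n i) r (opF q i) (opF q j) (zt n q a b) = 0) :
    qSerre (qC q ^ symm n i) r (opF q i) (opF q j) = 0 :=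
  skewR_eq_zero (pow_mul_apply_one (opKinv_one i) (opKinv_one j) r)
    ((isSkewR_opF i).qSerre (generic_pow q (symm_ne_zero n i)) hr
      (c := (qCartan q i j)⁻¹) (by rw [qCartan_eq hc, inv_zpow]) (isSkewR_opF j)
      (opKinv_comm j i) (by rw [opF_mul_opKinv, qCartan_self, inv_pow]) 
      (opF_mul_opKinv i j)
      (by rw [opF_mul_opKinv, qCartan_comm])) hz

theorem vecE_mul_vecE {i j : Idx n} (h : (j : ℕ) ≠ i + 1) :
    vecE q i * vecE q j = 0 := by
  simp only [vecE, smul_mul_smul_comm, Vec.shift_mul_shift]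
  rw [if_neg h, smul_zero]

theorem vecF_mul_vecF {i j : Idx n} (h : (i : ℕ) ≠ j + 1) :
    vecF q i * vecF q j = 0 := by
  simp only [vecF, smul_mul_smul_comm, Vec.shift_mul_shift]
  rw [if_neg h.symm, smul_zero]

theorem qSerre_eq_zero_of_adjacent {A : Type*} [Ring A] [Algebra ℂ A] {Q : ℂ} (hQ : Generic Q)
    {x y : A} (hx : x * x = 0) (h : x * y = 0 ∨ y * x = 0) : qSerre Q 2 x y = 0 := by
  rw [qSerre_two hQ, ← mul_assoc, hx, ← mul_assoc x y x]
  rcases h with h | h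
  · simp [h]
  · simp [h, mul_assoc]

theorem cartan_of_lt {i j : Idx n} (h : i ≠ j) (hj : (j : ℕ) < n) {r : ℕ}
    (hc : cartan n i j = 1 - r) :
    r = 2 ∨ r = 1 ∧ (i : ℕ) ≠ j + 1 ∧ (j : ℕ) ≠ i + 1 := by
  have h' : (i : ℕ) ≠ j := fun e => h (Subtype.ext e)
  simp only [cartan, if_neg h', if_neg hj.ne] at hc
  split_ifs at hc <;> omega

/-- `E_i` is a multiple of a matrix unit with square `0`, and `E_i E_j ≠ 0` forces `j = i + 1`. So
every monomial of the Serre expression contains a vanishing product. -/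
theorem vec_serre_E {i j : Idx n} (h : i ≠ j) (hj : (j : ℕ) < n) {r : ℕ}
    (hc : cartan n i j = 1 - r) {Q : ℂ} (hQ : Generic Q) :
    qSerre Q r (vecE q i) (vecE q j) = 0 := by
  rcases cartan_of_lt h hj hc with rfl | ⟨rfl, h1, h2⟩
  · refine qSerre_eq_zero_of_adjacent hQ (vecE_mul_vecE (by omega)) ?_
    by_cases h3 : (j : ℕ) = i + 1
    · exact .inr (vecE_mul_vecE (by omega))
    · exact .inl (vecE_mul_vecE h3)
  · rw [qSerre_one hQ]
    exact sub_eq_zero_of_eq (G := Module.End ℂ Vec) ((vecE_mul_vecE (by omega)).trans (vecE_mul_vecE (by omega)).symm)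

theorem vec_serre_F {i j : Idx n} (h : i ≠ j) (hj : (j : ℕ) < n) {r : ℕ}
    (hc : cartan n i j = 1 - r) {Q : ℂ} (hQ : Generic Q) :
    qSerre Q r (vecF q i) (vecF q j) = 0 := by
  rcases cartan_of_lt h hj hc with rfl | ⟨rfl, h1, h2⟩
  · refine qSerre_eq_zero_of_adjacent hQ (vecF_mul_vecF (by omega)) ?_
    by_cases h3 : (j : ℕ) = i + 1
    · exact .inl (vecF_mul_vecF (by omega))
    · exact .inr (vecF_mul_vecF h3)
  · rw [qSerre_one hQ]
    exact sub_eq_zero_of_eq (G := Module.End ℂ Vec) ((vecF_mul_vecF (by omega)).trans (vecF_mul_vecF (by omega)).symm)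

theorem serre_E_lt {i j : Idx n} (h : i ≠ j) (hi : (i : ℕ) < n) (hj : (j : ℕ) < n) {r : ℕ}
    (hc : cartan n i j = 1 - r) (hr : r = 1 ∨ r = 2 ∨ r = 3) :
    qSerre (qC q ^ symm n i) r (opE q i) (opE q j) = 0 := by
  refine serre_E_of_zt hc hr fun a b => ?_
  have hQ := generic_pow q (symm_ne_zero n i)
  have := (isSkewL_vecE (q := q) hi).qSerre hQ hr (qCartan_eq hc) (isSkewL_vecE hj)
    (Vec.diag_mul_diag _ _) (by rw [vecK_mul_vecE i hi, qCartan_self]) (vecK_mul_vecE i hj)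
    (by rw [vecK_mul_vecE j hi, qCartan_comm]) (Vec.x a) (Vec.x b)
  rw [← pairing_x, this, vec_serre_E h hj hc hQ]
  simp

theorem serre_F_lt {i j : Idx n} (h : i ≠ j) (hi : (i : ℕ) < n) (hj : (j : ℕ) < n) {r : ℕ}
    (hc : cartan n i j = 1 - r) (hr : r = 1 ∨ r = 2 ∨ r = 3) :
    qSerre (qC q ^ symm n i) r (opF q i) (opF q j) = 0 := by
  refine serre_F_of_zt hc hr fun a b => ?_
  have hQ := generic_pow q (symm_ne_zero n i)
  have := (isSkewR_vecF (q := q) hi).qSerre hQ hr (c := (qCartan q i j)⁻¹)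
    (by rw [qCartan_eq hc, inv_zpow]) (isSkewR_vecF hj)
    (Vec.diag_mul_diag _ _) (by rw [vecF_mul_vecKinv i hi, qCartan_self, inv_pow])
    (vecF_mul_vecKinv i hj)
    (by rw [vecF_mul_vecKinv j hi, qCartan_comm]) (Vec.x a) (Vec.x b)
  rw [← pairing_x, this, vec_serre_F h hj hc hQ]
  simp

theorem cartan_top {i j : Idx n} (hi : (i : ℕ) < n) (hj : (j : ℕ) = n) {r : ℕ}
    (hc : cartan n i j = 1 - r) :
    r = 3 ∧ (i : ℕ) + 1 = n ∨ r = 1 ∧ (i : ℕ) + 1 ≠ n := by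
  rw [cartan] at hc
  split_ifs at hc <;> omega

theorem cartan_top' {i j : Idx n} (hi : (i : ℕ) = n) (hj : (j : ℕ) < n) {r : ℕ}
    (hc : cartan n i j = 1 - r) :
    r = 2 ∧ (j : ℕ) + 1 = n ∨ r = 1 ∧ (j : ℕ) + 1 ≠ n := by
  rw [cartan] at hc
  split_ifs at hc <;> omega

theorem opF_comm_top_zt {i j : Idx n} (hi : (i : ℕ) < n) (hj : (j : ℕ) = n)
    (h : (i : ℕ) + 1 ≠ n) (a b : ℕ) :
    opF q i (opF q j (zt n q a b)) = 0 ∧ opF q j (opF q i (zt n q a b)) = 0 := by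
  constructor
  · rw [opF_top_zt hj]
    split_ifs <;> simp [opF_one]
  · rw [opF_zt hi, shiftR]
    split_ifs <;> simp [opF_top_zt hj, h]

/-- Let `i = n - 1`. A monomial with some `F_i` to the left of `F_n` kills `z_{ab}`, since `F_n`
produces a scalar or `0`. The remaining monomial `F_n F_i³` does so because `F_i` can shift each of
the two indices only once. -/
theorem serre_F_top_right {i j : Idx n} (hi : (i : ℕ) < n) (hj : (j : ℕ) = n) {r : ℕ}
    (hc : cartan n i j = 1 - r) (hr : r = 1 ∨ r = 2 ∨ r = 3) :
    qSerre (qC q ^ symm n i) r (opF q i) (opF q j) = 0 := by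
  refine serre_F_of_zt hc hr fun a b => ?_
  have hQ := generic_pow q (symm_ne_zero n i)
  rcases cartan_top hi hj hc with ⟨rfl, h⟩ | ⟨rfl, h⟩
  · rw [qSerre_three hQ]
    by_cases ha : a = i <;> by_cases hb : b = i <;>
      simp [Module.End.mul_apply, opF_zt hi, opF_top_zt hj, shiftR, ha, hb, h, opF_one, hi.ne,
        hi.ne', apply_ite]
  · rw [qSerre_one hQ, LinearMap.sub_apply, Module.End.mul_apply, Module.End.mul_apply,
      (opF_comm_top_zt hi hj h a b).1, (opF_comm_top_zt hi hj h a b).2, sub_zero]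

/-- Here `F_n F_j z_{ab}` and `F_n z_{ab}` are scalars, so the next operator to act kills them. -/
theorem serre_F_top_left {i j : Idx n} (hi : (i : ℕ) = n) (hj : (j : ℕ) < n) {r : ℕ}
    (hc : cartan n i j = 1 - r) (hr : r = 1 ∨ r = 2 ∨ r = 3) :
    qSerre (qC q ^ symm n i) r (opF q i) (opF q j) = 0 := by
  refine serre_F_of_zt hc hr fun a b => ?_
  have hQ := generic_pow q (symm_ne_zero n i)
  rcases cartan_top' hi hj hc with ⟨rfl, h⟩ | ⟨rfl, h⟩
  · rw [qSerre_two hQ]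
    by_cases ha : a = j <;> by_cases hb : b = j <;>
      simp [Module.End.mul_apply, opF_zt hj, opF_top_zt hi, shiftR, ha, hb, h, opF_one, hj.ne,
        hj.ne', apply_ite]
  · rw [qSerre_one hQ, LinearMap.sub_apply, Module.End.mul_apply, Module.End.mul_apply,
      (opF_comm_top_zt hj hi h a b).1, (opF_comm_top_zt hj hi h a b).2, sub_zero]

theorem opE_top_eq {j : Idx n} (hj : (j : ℕ) = n) : opE q j =
    (qC q * (qC q ^ 2 - (qC q)⁻¹ ^ 2))⁻¹ • (LinearMap.mulLeft ℂ (zt n q n n)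
      - LinearMap.mulRight ℂ (zt n q n n) * opK q j) :=
  LinearMap.ext fun u => opE_top hj u

theorem opE_mul_mulLeft (i : Idx n) {z : Cp n q} {c : ℂ} (h : opK q i z = c • z) :
    opE q i * LinearMap.mulLeft ℂ z =
      c • (LinearMap.mulLeft ℂ z * opE q i) + LinearMap.mulLeft ℂ (opE q i z) := by
  ext u
  simp [opE_mul, h, add_comm]

/-- Together with `opE_mul_mulLeft` this makes the two parts of `E_n` the beginnings of strings of
twisted commutators. At each step `z` is replaced by `E_i z`, and the twist `k` acquires a factor
`K_i`. -/
theorem opE_mul_mulRight (i : Idx n) (z : Cp n q) {k : Module.End ℂ (Cp n q)} {c : ℂ}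
    (h : opE q i * k = c • (k * opE q i)) :
    opE q i * (LinearMap.mulRight ℂ z * k) = c • (LinearMap.mulRight ℂ z * k * opE q i)
      + LinearMap.mulRight ℂ (opE q i z) * (opK q i * k) := by
  ext u
  have e : opE q i (k u) = c • k (opE q i u) := LinearMap.congr_fun h u
  simp [opE_mul, e]

theorem opE_mul_opK (i j : Idx n) : opE q j * opK q i = (qCartan q i j)⁻¹ • (opK q i * opE q j) := by
  rw [opK_mul_opE, smul_smul, inv_mul_cancel₀ (qCartan_ne_zero i j), one_smul]

theorem opE_mul_opK_mul (i j : Idx n) {k : Module.End ℂ (Cp n q)} {c : ℂ}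
    (h : opE q j * k = c • (k * opE q j)) :
    opE q j * (opK q i * k) = ((qCartan q i j)⁻¹ * c) • (opK q i * k * opE q j) := by
  rw [← mul_assoc, opE_mul_opK, smul_mul_assoc, mul_assoc, h, mul_smul_comm, smul_smul, mul_assoc]

theorem qCartan_adjacent {i j : Idx n} (hj : (j : ℕ) = n) (h : (i : ℕ) + 1 = n) :
    qCartan q j i = (qC q)⁻¹ ^ 2 := by
  rw [qCartan, symm, cartan, if_pos hj, if_neg (by omega), if_neg (by omega), if_pos (by omega)]
  simp [zpow_neg]

theorem wt_adjacent {i : Idx n} (h : (i : ℕ) + 1 = n) : wt n q i n = (qC q)⁻¹ := by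
  rw [wt, if_neg (by omega), if_neg (by omega), if_pos h.symm]

theorem opK_zt_adjacent {i : Idx n} (h : (i : ℕ) + 1 = n) :
    opK q i (zt n q n n) = (qC q)⁻¹ ^ 2 • zt n q n n := by
  rw [opK_zt, wt_adjacent h, pow_two]

theorem opK_opE (i j : Idx n) (u : Cp n q) :
    opK q i (opE q j u) = qCartan q i j • opE q j (opK q i u) :=
  LinearMap.congr_fun (opK_mul_opE i j) u

theorem opE_three {i : Idx n} (h : (i : ℕ) + 1 = n) :
    opE q i (opE q i (opE q i (zt n q n n))) = 0 := by
  have hi : (i : ℕ) < n := by omega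
  simp [opE_zt hi, shiftL, h, hi.ne, hi.ne']

theorem opE_zt_adjacent {i : Idx n} (h : (i : ℕ) + 1 = n) :
    opE q i (zt n q n n) = ((qHalf q)⁻¹ * (qC q + (qC q)⁻¹)) • zt n q n i := by
  have hi : (i : ℕ) < n := by omega
  rw [opE_zt hi, shiftL, if_pos h.symm, if_pos h.symm, (isQSymm_zt n q).symm hi, wt_adjacent h]
  module

/-- For `i < n - 1` the operator `E_i` kills `z_{nn}`, `K_i` fixes it, and `E_i` commutes with
`K_n`. Hence `E_i` passes through the inner formula. -/
theorem opE_comm_top {i j : Idx n} (hi : (i : ℕ) < n) (hj : (j : ℕ) = n) (h : (i : ℕ) + 1 ≠ n) :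
    opE q i * opE q j = opE q j * opE q i := by
  have e1 : opE q i (zt n q n n) = 0 := by simp [opE_zt hi, shiftL, h.symm]
  have e2 : opK q i (zt n q n n) = zt n q n n := by
    rw [opK_zt, wt, if_neg hi.ne, if_neg hi.ne', if_neg h.symm, mul_one, one_smul]
  have e3 : ∀ u, opE q i (opK q j u) = opK q j (opE q i u) := fun u => by
    have : qCartan q j i = 1 := by
      rw [qCartan, cartan, if_neg (by omega), if_neg (by omega), if_neg (by omega), mul_zero,
        zpow_zero]
    rw [opK_opE, this, one_smul]
  ext u
  simp only [Module.End.mul_apply, opE_top hj, map_smul, map_sub, opE_mul, e1, e2, e3, zero_mul,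
    mul_zero, zero_add, add_zero]

/-- The Serre expression is linear in `E_n`, so the left and the twisted right multiplication by
`z_{nn}` are treated separately. Each starts a string under `E_{n-1}`: the multipliers are `q⁻², 1,
q²` for the former and `q², 1, q⁻²` for the latter. Both strings stop because `E_{n-1}³ z_{nn} = 0`.
-/
theorem serre_E_top_right {i j : Idx n} (hi : (i : ℕ) < n) (hj : (j : ℕ) = n) {r : ℕ}
    (hc : cartan n i j = 1 - r) :
    qSerre (qC q ^ symm n i) r (opE q i) (opE q j) = 0 := by
  have h0 := qC_ne_zero q
  have hs : symm n i = 1 := if_neg hi.ne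
  rcases cartan_top hi hj hc with ⟨rfl, h⟩ | ⟨rfl, h⟩
  · have hQ := generic_qC q
    have hii : qCartan q i i = qC q ^ 2 := by rw [qCartan_self, hs, pow_one]
    have hk0 := opK_zt_adjacent (q := q) h
    have hk1 : opK q i (opE q i (zt n q n n)) = (1 : ℂ) • opE q i (zt n q n n) := by
      rw [opK_opE, hk0, map_smul, smul_smul, hii]
      congr 1
      field_simp
    have hk2 : opK q i (opE q i (opE q i (zt n q n n))) =
        qC q ^ 2 • opE q i (opE q i (zt n q n n)) := by
      rw [opK_opE, hk1, map_smul, smul_smul, hii, mul_one]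
    have hc0 : opE q i * opK q j = qC q ^ 2 • (opK q j * opE q i) := by
      rw [opE_mul_opK, qCartan_adjacent hj h, inv_pow, inv_inv]
    have hc1 : opE q i * (opK q i * opK q j) = (1 : ℂ) • (opK q i * opK q j * opE q i) := by
      rw [opE_mul_opK_mul i i hc0, hii, inv_mul_cancel₀ (pow_ne_zero 2 h0)]
    have hc2 : opE q i * (opK q i * (opK q i * opK q j)) =
        (qC q ^ 2)⁻¹ • (opK q i * (opK q i * opK q j) * opE q i) := by
      rw [opE_mul_opK_mul i i hc1, hii, mul_one]
    rw [hs, pow_one, opE_top_eq hj]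
    have e := Uq.qSerre_smul (qC q) 3 1 (qC q * (qC q ^ 2 - (qC q)⁻¹ ^ 2))⁻¹ (opE q i)
      (LinearMap.mulLeft ℂ (zt n q n n) - LinearMap.mulRight ℂ (zt n q n n) * opK q j)
    rw [one_smul] at e
    rw [e, qSerre_sub_right, qSerre_three_string hQ (.inr rfl) (opE_mul_mulLeft i hk0)
      (by rw [opE_mul_mulLeft i hk1, one_smul])
      (by rw [opE_mul_mulLeft i hk2, opE_three h]; simp),
      qSerre_three_string hQ (.inl rfl) (opE_mul_mulRight i _ hc0)
      (by rw [opE_mul_mulRight i _ hc1, one_smul])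
      (by rw [opE_mul_mulRight i _ hc2, opE_three h]; simp), sub_zero, smul_zero]
  · rw [qSerre_one (generic_pow q (symm_ne_zero n i)), opE_comm_top hi hj h, sub_self]

/-- Now `E_n` occurs twice, so its two parts interact. `qSerre_two_string` is applied to the left
multiplication `l` and the twisted right multiplication `m` by `z_{nn}`, and to their twisted
commutators `l'`, `m'` with `E_{n-1}`. The remaining goals are `q`-commutation rules, which follow
from the weights of `z_{nn}` and `E_{n-1} z_{nn}` and from `hz`. -/
theorem serre_E_top_left {i j : Idx n} (hi : (i : ℕ) = n) (hj : (j : ℕ) < n) {r : ℕ}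
    (hc : cartan n i j = 1 - r) :
    qSerre (qC q ^ symm n i) r (opE q i) (opE q j) = 0 := by
  have h0 := qC_ne_zero q
  have hs : symm n i = 2 := if_pos hi
  rcases cartan_top' hi hj hc with ⟨rfl, h⟩ | ⟨rfl, h⟩
  · have hk0 := opK_zt_adjacent (q := q) h
    have hkn : opK q i (zt n q n n) = qC q ^ 4 • zt n q n n := by
      rw [opK_zt, wt_top_eq i hi, qCartan_self, hs, ← pow_mul]
    have hc0 : opE q j * opK q i = qC q ^ 2 • (opK q i * opE q j) := by
      rw [opE_mul_opK, qCartan_adjacent hi h, inv_pow, inv_inv]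
    have hkn1 : opK q i (opE q j (zt n q n n)) = qC q ^ 2 • opE q j (zt n q n n) := by
      rw [opK_opE, hkn, map_smul, smul_smul, qCartan_adjacent hi h]
      congr 1
      field_simp
    -- `E_{n-1} z_{nn}` is a multiple of `z_{n,n-1}`, which `q`-commutes with `z_{nn}` by the
    -- relation `r2`.
    have hz : opE q j (zt n q n n) * zt n q n n =
        qC q ^ 2 • (zt n q n n * opE q j (zt n q n n)) := by
      rw [opE_zt_adjacent h, smul_mul_assoc, (isQSymm_zt n q).r2 hj, mul_smul_comm, smul_comm]
    rw [hs, opE_top_eq hi]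
    have e := Uq.qSerre_smul (qC q ^ 2) 2 (qC q * (qC q ^ 2 - (qC q)⁻¹ ^ 2))⁻¹ 1
      (LinearMap.mulLeft ℂ (zt n q n n) - LinearMap.mulRight ℂ (zt n q n n) * opK q i) (opE q j)
    rw [one_smul] at e
    rw [e, qSerre_two_string h0 (generic_pow q two_ne_zero) (opE_mul_mulLeft j hk0)
      (opE_mul_mulRight j _ hc0), smul_zero]
    · ext u
      simp [opK_mul, hkn, mul_assoc]
    · ext u
      simp [← mul_assoc, hz]
    · ext u
      simp [opK_mul, hkn1, mul_assoc]
    · ext u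
      simp only [Module.End.mul_apply, LinearMap.mulRight_apply, LinearMap.smul_apply, opK_mul,
        hkn, hkn1, hk0, map_smul, mul_smul_comm, smul_mul_assoc, mul_assoc, hz, smul_smul,
        opK_opK j i]
      congr 1
      field_simp
  · rw [qSerre_one (generic_pow q (symm_ne_zero n i)), opE_comm_top hj hi h, sub_self]

theorem serre_E {i j : Idx n} (h : i ≠ j) :
    qSerre (qC q ^ symm n i) (1 - cartan n i j).toNat (opE q i) (opE q j) = 0 := by
  obtain ⟨r, hr, hc, hr3⟩ := cartan_cases h
  rw [hr]
  by_cases hi : (i : ℕ) < n <;> by_cases hj : (j : ℕ) < n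
  · exact serre_E_lt h hi hj hc hr3
  · exact serre_E_top_right hi (eq_top hj) hc
  · exact serre_E_top_left (eq_top hi) hj hc
  · exact absurd (Subtype.ext ((eq_top hi).trans (eq_top hj).symm)) h

theorem serre_F {i j : Idx n} (h : i ≠ j) :
    qSerre (qC q ^ symm n i) (1 - cartan n i j).toNat (opF q i) (opF q j) = 0 := by
  obtain ⟨r, hr, hc, hr3⟩ := cartan_cases h
  rw [hr]
  by_cases hi : (i : ℕ) < n <;> by_cases hj : (j : ℕ) < n
  · exact serre_F_lt h hi hj hc hr3
  · exact serre_F_top_right hi (eq_top hj) hc hr3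
  · exact serre_F_top_left (eq_top hi) hj hc hr3
  · exact absurd (Subtype.ext ((eq_top hi).trans (eq_top hj).symm)) h

end Cp

/-! ### The action of `U_q sp_{2n}` and the module algebra property -/

section ModuleAlgebra

variable {R H A : Type*} [CommRing R] [Ring H] [HopfAlgebra R H] [Ring A] [Algebra R A]

/-- The action of `H ⊗ H` on `A ⊗ A` that is induced by an action of `H` on `A`. -/
def tensorHom (ρ : H →ₐ[R] Module.End R A) : H ⊗[R] H →ₐ[R] Module.End R (A ⊗[R] A) :=
  Module.endTensorEndAlgHom.comp (Algebra.TensorProduct.map ρ ρ)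

/-- As a composition of algebra homomorphisms, the action on the tensor square is visibly
multiplicative in `h`. -/
theorem tensorAction_eq (ρ : H →ₐ[R] Module.End R A) (h : H) :
    tensorAction ρ h = tensorHom ρ (Bialgebra.comulAlgHom R H h) := rfl

theorem tensorHom_tmul (ρ : H →ₐ[R] Module.End R A) (h h' : H) (a b : A) :
    tensorHom ρ (h ⊗ₜ h') (a ⊗ₜ b) = ρ h a ⊗ₜ ρ h' b := rfl

end ModuleAlgebra

namespace Cp

variable {n : ℕ} {q : Set.Ioo (0 : ℝ) 1}

/-- The operators by which the generators of `U_q sp_{2n}` act on `ℂ[𝔭⁻]_q`. -/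
def actGen (q : Set.Ioo (0 : ℝ) 1) : Gen n → Module.End ℂ (Cp n q)
  | .K i => opK q i
  | .Kinv i => opKinv q i
  | .E i => opE q i
  | .F i => opF q i

theorem actGen_rel (x y : Module.End ℂ (Cp n q)) (h : Rel q (actGen q) x y) : x = y := by
  cases h with
  | K_K i j => exact opK_comm i j
  | K_Kinv i => exact opK_mul_opKinv i
  | Kinv_K i => exact opKinv_mul_opK i
  | K_E i j => exact opK_mul_opE i j
  | K_F i j => rw [zpow_neg]; exact opK_mul_opF i j
  | E_F_same i => exact commutator_self i
  | E_F_ne i j h => exact commutator_ne h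
  | serre_E i j h => exact serre_E h
  | serre_F i j h => exact serre_F h

/-- The action of `U_q sp_{2n}` on `ℂ[𝔭⁻]_q`. -/
def action (n : ℕ) (q : Set.Ioo (0 : ℝ) 1) : Uq n q →ₐ[ℂ] Module.End ℂ (Cp n q) :=
  Uq.lift (actGen q) actGen_rel

theorem action_K (i : Idx n) : action n q (Uq.K q i) = opK q i := Uq.lift_gen _ _ _
theorem action_Kinv (i : Idx n) : action n q (Uq.Kinv q i) = opKinv q i := Uq.lift_gen _ _ _
theorem action_E (i : Idx n) : action n q (Uq.E q i) = opE q i := Uq.lift_gen _ _ _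
theorem action_F (i : Idx n) : action n q (Uq.F q i) = opF q i := Uq.lift_gen _ _ _

theorem action_mul_gen (x : Gen n) : action n q (Uq.gen q x) ∘ₗ LinearMap.mul' ℂ (Cp n q) =
    LinearMap.mul' ℂ (Cp n q) ∘ₗ tensorHom (action n q) (Uq.comul (Uq.gen q x)) := by
  refine TensorProduct.ext' fun u v => ?_
  cases x with
  | K i =>
    change action n q (Uq.K q i) (u * v) =
      LinearMap.mul' ℂ (Cp n q) (tensorHom (action n q) (Uq.comul (Uq.K q i)) (u ⊗ₜ v))
    rw [Uq.comul_K, tensorHom_tmul, action_K, opK_mul, LinearMap.mul'_apply]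
  | Kinv i =>
    change action n q (Uq.Kinv q i) (u * v) =
      LinearMap.mul' ℂ (Cp n q) (tensorHom (action n q) (Uq.comul (Uq.Kinv q i)) (u ⊗ₜ v))
    rw [Uq.comul_Kinv, tensorHom_tmul, action_Kinv, opKinv_mul, LinearMap.mul'_apply]
  | E i =>
    change action n q (Uq.E q i) (u * v) =
      LinearMap.mul' ℂ (Cp n q) (tensorHom (action n q) (Uq.comul (Uq.E q i)) (u ⊗ₜ v))
    rw [Uq.comul_E, map_add, LinearMap.add_apply, tensorHom_tmul, tensorHom_tmul, action_E,
      action_K, opE_mul, map_add, LinearMap.mul'_apply, LinearMap.mul'_apply, map_one,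
      Module.End.one_apply]
  | F i =>
    change action n q (Uq.F q i) (u * v) =
      LinearMap.mul' ℂ (Cp n q) (tensorHom (action n q) (Uq.comul (Uq.F q i)) (u ⊗ₜ v))
    rw [Uq.comul_F, map_add, LinearMap.add_apply, tensorHom_tmul, tensorHom_tmul, action_F,
      action_Kinv, opF_mul, map_add, LinearMap.mul'_apply, LinearMap.mul'_apply, map_one,
      Module.End.one_apply]

/-- The elements `h` that satisfy either condition form a subalgebra, so generators suffice. For
these, equivariance is the product rule, and invariance says that the `K_i^{±1}` fix `1` while `E_i`
and `F_i` kill it. -/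
theorem isModuleAlgebra_action (n : ℕ) (q : Set.Ioo (0 : ℝ) 1) :
    IsModuleAlgebra (action n q) where
  mul_equivariant h := by
    rw [tensorAction_eq]
    change _ = LinearMap.mul' ℂ (Cp n q) ∘ₗ tensorHom (action n q) (Uq.comul h)
    induction h using Uq.induction with
    | hc c =>
      refine TensorProduct.ext' fun u v => ?_
      simp [Algebra.algebraMap_eq_smul_one]
    | hg x => exact action_mul_gen x
    | hadd a b ha hb =>
      rw [map_add, map_add, map_add, LinearMap.add_comp, LinearMap.comp_add, ha, hb]
    | hmul a b ha hb =>
      rw [map_mul, map_mul, map_mul, Module.End.mul_eq_comp, Module.End.mul_eq_comp,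
        LinearMap.comp_assoc, hb, ← LinearMap.comp_assoc, ha, LinearMap.comp_assoc]
  one_invariant h := by
    change action n q h 1 = Uq.counit h • (1 : Cp n q)
    induction h using Uq.induction with
    | hc c => simp [Algebra.algebraMap_eq_smul_one]
    | hg x =>
      rw [Uq.counit_gen, action, Uq.lift_gen]
      cases x with
      | K i => exact (opK_one i).trans (one_smul _ _).symm
      | Kinv i => exact (opKinv_one i).trans (one_smul _ _).symm
      | E i => exact (opE_one i).trans (zero_smul _ _).symm
      | F i => exact (opF_one i).trans (zero_smul _ _).symm
    | hadd a b ha hb => rw [map_add, LinearMap.add_apply, ha, hb, map_add, add_smul]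
    | hmul a b ha hb =>
      rw [map_mul, Module.End.mul_apply, hb, map_smul, ha, map_mul, smul_smul, mul_comm]

/-! ### The action on the generators -/

theorem opK_z {k : Idx n} (hk : (k : ℕ) < n) {i j : ℕ} (h : j ≤ i) :
    opK q k (z n q i j) = actK n q k i j := by
  have h0 := qC_ne_zero q
  have hk1 := k.2.1
  rw [← zt_of_le h, opK_zt, zt_of_le h, actK]
  simp only [wt, if_neg hk.ne]
  split_ifs <;> first
    | (exfalso; omega)
    | (match_scalars; simp [zpow_neg] <;> field_simp)

/-- The factor `q + q⁻¹` at `i = j = k + 1` is the sum of two contributions to `z_{k+1,k}`: `q` from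
the `q`-symmetry `z_{k,k+1} = q z_{k+1,k}`, and `q⁻¹` from the eigenvalue of `K_k` on `x_{k+1}`. -/
theorem opE_z {k : Idx n} (hk : (k : ℕ) < n) {i j : ℕ} (h : j ≤ i) :
    opE q k (z n q i j) = actE n q k i j := by
  have h0 := qC_ne_zero q
  have hs := (isQSymm_zt n q).symm (Nat.lt_succ_self (k : ℕ))
  rw [← zt_of_le h, opE_zt hk, actE]
  congr 1
  simp only [shiftL, wt, if_neg hk.ne]
  split_ifs <;> first
    | (exfalso; omega)
    | (subst_vars; simp (disch := omega) [← zt_of_le, hs] <;> try module)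

theorem opF_z {k : Idx n} (hk : (k : ℕ) < n) {i j : ℕ} (h : j ≤ i) :
    opF q k (z n q i j) = actF n q k i j := by
  have h0 := qC_ne_zero q
  have hs := (isQSymm_zt n q).symm (Nat.lt_succ_self (k : ℕ))
  rw [← zt_of_le h, opF_zt hk, actF]
  congr 1
  simp only [shiftR, wt, if_neg hk.ne]
  split_ifs <;> first
    | (exfalso; omega)
    | (subst_vars; simp (disch := omega) [← zt_of_le, hs] <;> try module)

theorem opK_top_z {k : Idx n} (hk : (k : ℕ) = n) {i j : ℕ} (h : j ≤ i) (hi : i ≤ n) :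
    opK q k (z n q i j) = actKn n q i j := by
  rw [← zt_of_le h, opK_zt, zt_of_le h, actKn]
  simp only [wt, if_pos hk]
  split_ifs <;> first
    | (exfalso; omega)
    | (match_scalars; ring)

theorem opF_top_z {k : Idx n} (hk : (k : ℕ) = n) {i j : ℕ} (h : j ≤ i) :
    opF q k (z n q i j) = actFn n q i j := by
  rw [← zt_of_le h, opF_top_zt hk, actFn]
  split_ifs <;> first
    | (exfalso; omega)
    | rfl

/-- For `i < n` the numerator of the inner formula is a commutator, computed by `r8` and `r3`, or by
`r6` if `i = j`. For `i = n > j` the relation `r2` and the weight `q²` of `z_{nj}` combine to the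
factor `1 - q⁴`; for `i = j = n` the weight `q⁴` alone gives it. -/
theorem opE_top_z {k : Idx n} (hk : (k : ℕ) = n) {i j : ℕ} (h : j ≤ i) (hi : i ≤ n) :
    opE q k (z n q i j) = actEn n q i j := by
  have h0 := qC_ne_zero q
  have hZ := isQSymm_zt n q
  have h2 : qC q ^ 2 - (qC q)⁻¹ ^ 2 ≠ 0 := by
    have := (generic_pow q two_ne_zero).h1
    rwa [inv_pow]
  rw [opE_top hk, inv_smul_eq_iff₀ (mul_ne_zero h0 h2), opK_top_z hk h hi, actEn, actKn]
  simp only [← zt_of_le h, ← zt_of_le (le_refl n), ← zt_of_le hi, ← zt_of_le (h.trans hi)]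
  rcases hi.lt_or_eq with hi' | rfl
  · rw [if_neg (by omega), if_neg (by omega), if_neg (by omega)]
    rcases h.lt_or_eq with h' | rfl
    · rw [hZ.r8 h' hi', hZ.r3 h' hi']
      module
    · rw [hZ.r6 hi']
      module
  · rcases h.lt_or_eq with h' | rfl
    · rw [if_neg (by omega), if_pos (by omega), if_pos (by omega), smul_mul_assoc, hZ.r2 h']
      match_scalars
      field_simp
      ring
    · rw [if_pos (by omega), if_pos (by omega), smul_mul_assoc]
      match_scalars
      field_simp
      ring

/-! ### Uniqueness -/

variable {ρ ρ' : Uq n q →ₐ[ℂ] Module.End ℂ (Cp n q)}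

theorem moduleAlgebra_apply_mul (hρ : IsModuleAlgebra ρ) (h : Uq n q) (u v : Cp n q) :
    ρ h (u * v) = LinearMap.mul' ℂ (Cp n q) (tensorHom ρ (Uq.comul h) (u ⊗ₜ v)) :=
  LinearMap.congr_fun (hρ.mul_equivariant h) (u ⊗ₜ v)

/-- The twists of the skew derivations `E_k` and `F_k` are `K_k` and `K_k⁻¹`. So these have to be
identified first, and only then can `skewDer_ext` compare `E_k` and `F_k` on the generators. -/
theorem moduleAlgebra_ext (hρ : IsModuleAlgebra ρ) (hρ' : IsModuleAlgebra ρ')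
    (hK : ∀ k i j, 1 ≤ j → j ≤ i → i ≤ n → ρ (Uq.K q k) (z n q i j) = ρ' (Uq.K q k) (z n q i j))
    (hE : ∀ k i j, 1 ≤ j → j ≤ i → i ≤ n → ρ (Uq.E q k) (z n q i j) = ρ' (Uq.E q k) (z n q i j))
    (hF : ∀ k i j, 1 ≤ j → j ≤ i → i ≤ n → ρ (Uq.F q k) (z n q i j) = ρ' (Uq.F q k) (z n q i j)) :
    ρ = ρ' := by
  have h1 : ∀ h, ρ h 1 = ρ' h 1 := fun h => by rw [hρ.one_invariant, hρ'.one_invariant]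
  have mulK : ∀ {σ : Uq n q →ₐ[ℂ] Module.End ℂ (Cp n q)}, IsModuleAlgebra σ → ∀ k u v,
      σ (Uq.K q k) (u * v) = σ (Uq.K q k) u * σ (Uq.K q k) v := fun hσ k u v => by
    rw [moduleAlgebra_apply_mul hσ, Uq.comul_K, tensorHom_tmul, LinearMap.mul'_apply]
  have eK : ∀ k, ρ (Uq.K q k) = ρ' (Uq.K q k) := fun k => by
    ext u
    induction u using induction with
    | hc c => rw [Algebra.algebraMap_eq_smul_one, map_smul, map_smul, h1]
    | hz i j h h' h'' => exact hK k i j h h' h''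
    | hadd a b ha hb => rw [map_add, map_add, ha, hb]
    | hmul a b ha hb => rw [mulK hρ, mulK hρ', ha, hb]
  have eKinv : ∀ k, ρ (Uq.Kinv q k) = ρ' (Uq.Kinv q k) := fun k => by
    -- No values of `K_k⁻¹` are prescribed; the two operators agree as inverses of the same
    -- operator.
    refine left_inv_eq_right_inv (a := ρ (Uq.K q k)) ?_ ?_
    · rw [← map_mul, Uq.Kinv_mul_K, map_one]
    · rw [eK, ← map_mul, Uq.K_mul_Kinv, map_one]
  have mulE : ∀ {σ : Uq n q →ₐ[ℂ] Module.End ℂ (Cp n q)}, IsModuleAlgebra σ → ∀ k u v,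
      σ (Uq.E q k) (u * v) = σ (Uq.K q k) u * σ (Uq.E q k) v + σ (Uq.E q k) u * v :=
    fun hσ k u v => by
      rw [moduleAlgebra_apply_mul hσ, Uq.comul_E, map_add, LinearMap.add_apply, tensorHom_tmul,
        tensorHom_tmul, map_add, LinearMap.mul'_apply, LinearMap.mul'_apply, map_one,
        Module.End.one_apply, add_comm]
  have mulF : ∀ {σ : Uq n q →ₐ[ℂ] Module.End ℂ (Cp n q)}, IsModuleAlgebra σ → ∀ k u v,
      σ (Uq.F q k) (u * v) = u * σ (Uq.F q k) v + σ (Uq.F q k) u * σ (Uq.Kinv q k) v :=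
    fun hσ k u v => by
      rw [moduleAlgebra_apply_mul hσ, Uq.comul_F, map_add, LinearMap.add_apply, tensorHom_tmul,
        tensorHom_tmul, map_add, LinearMap.mul'_apply, LinearMap.mul'_apply, map_one,
        Module.End.one_apply, add_comm]
  refine Uq.algHom_ext fun x => ?_
  cases x with
  | K k => exact eK k
  | Kinv k => exact eKinv k
  | E k =>
    refine skewDer_ext (α := ρ (Uq.K q k)) (β := id) (mulE hρ k) (fun u v => ?_) (h1 _) (hE k)
    rw [eK]
    exact mulE hρ' k u v
  | F k =>
    refine skewDer_ext (α := id) (β := ρ (Uq.Kinv q k)) (mulF hρ k) (fun u v => ?_) (h1 _) (hF k)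
    rw [eKinv]
    exact mulF hρ' k u v

end Cp

end QSp

end

theorem theorem2 (n : ℕ) (hn : 1 ≤ n) (q : Set.Ioo (0 : ℝ) 1) :
    ∃! ρ : QSp.Uq n q →ₐ[ℂ] Module.End ℂ (QSp.Cp n q),
      QSp.IsModuleAlgebra ρ ∧
      (∀ k : QSp.Idx n, (k : ℕ) < n → ∀ i j : ℕ, 1 ≤ j → j ≤ i → i ≤ n →
        ρ (QSp.Uq.K q k) (QSp.z n q i j) = QSp.actK n q k i j ∧
        ρ (QSp.Uq.E q k) (QSp.z n q i j) = QSp.actE n q k i j ∧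
        ρ (QSp.Uq.F q k) (QSp.z n q i j) = QSp.actF n q k i j) ∧
      (∀ i j : ℕ, 1 ≤ j → j ≤ i → i ≤ n →
        ρ (QSp.Uq.K q ⟨n, hn, le_rfl⟩) (QSp.z n q i j) = QSp.actKn n q i j ∧
        ρ (QSp.Uq.E q ⟨n, hn, le_rfl⟩) (QSp.z n q i j) = QSp.actEn n q i j ∧
        ρ (QSp.Uq.F q ⟨n, hn, le_rfl⟩) (QSp.z n q i j) = QSp.actFn n q i j) := by
  refine ⟨QSp.Cp.action n q, ⟨QSp.Cp.isModuleAlgebra_action n q, fun k hk i j hj h hi => ?_,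
    fun i j hj h hi => ?_⟩, fun ρ ⟨hρ, hlt, htop⟩ => ?_⟩
  · rw [QSp.Cp.action_K, QSp.Cp.action_E, QSp.Cp.action_F]
    exact ⟨QSp.Cp.opK_z hk h, QSp.Cp.opE_z hk h, QSp.Cp.opF_z hk h⟩
  · rw [QSp.Cp.action_K, QSp.Cp.action_E, QSp.Cp.action_F]
    exact ⟨QSp.Cp.opK_top_z rfl h hi, QSp.Cp.opE_top_z rfl h hi, QSp.Cp.opF_top_z rfl h⟩
  -- The cases `k < n` and `k = n` of the prescribed formulas are merged: since the constructed
  -- action satisfies the same formulas, `ρ` agrees with it on all `z_{ij}`.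
  · have key : ∀ k : QSp.Idx n, ∀ i j : ℕ, 1 ≤ j → j ≤ i → i ≤ n →
        ρ (QSp.Uq.K q k) (QSp.z n q i j) = QSp.Cp.action n q (QSp.Uq.K q k) (QSp.z n q i j) ∧
        ρ (QSp.Uq.E q k) (QSp.z n q i j) = QSp.Cp.action n q (QSp.Uq.E q k) (QSp.z n q i j) ∧
        ρ (QSp.Uq.F q k) (QSp.z n q i j) = QSp.Cp.action n q (QSp.Uq.F q k) (QSp.z n q i j) := by
      intro k i j hj h hi
      rw [QSp.Cp.action_K, QSp.Cp.action_E, QSp.Cp.action_F]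
      by_cases hk : (k : ℕ) < n
      · rw [QSp.Cp.opK_z hk h, QSp.Cp.opE_z hk h, QSp.Cp.opF_z hk h]
        exact hlt k hk i j hj h hi
      · have hk := QSp.Cp.eq_top hk
        rw [QSp.Cp.opK_top_z hk h hi, QSp.Cp.opE_top_z hk h hi, QSp.Cp.opF_top_z hk h]
        obtain rfl : k = ⟨n, hn, le_rfl⟩ := Subtype.ext hk
        exact htop i j hj h hi
    exact QSp.Cp.moduleAlgebra_ext hρ (QSp.Cp.isModuleAlgebra_action n q)
      (fun k i j hj h hi => (key k i j hj h hi).1) (fun k i j hj h hi => (key k i j hj h hi).2.1)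
      (fun k i j hj h hi => (key k i j hj h hi).2.2)
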